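/- **Setting.** Let $f(\theta;\xi)$, $\theta\in\mathbb R^d$, be a random loss, differentiable in $\theta$, and $F(\theta)=\mathbb E_\xi[f(\theta;\xi)]$. Let $\Theta\subseteq\mathbb R^d$ be closed and convex and let $F$ have a unique global minimizer $\theta^*\in\Theta$. Let $C_\rho\in\mathbb N$, $C_\rho\ge1$, $\rho\in[0,1)$, $C_\gamma,C_\sigma>0$, $\beta\in[0,1]$, $\alpha\in\mathbb R$, $\nu>0$, $\sigma\in[0,1/2]$, $\sigma'\in(0,1/2]$, $C_\sigma',D_\nu,B_\nu\ge0$, and put, for $t\ge1$, $$n_t=\lceil C_\rho t^\rho\rceil,\quad N_t=\sum_{i=1}^t n_i,\quad \gamma_t=C_\gamma n_t^\beta t^{-\alpha},\quad \nu_t=n_t^{-\nu},\quad \sigma_t=C_\sigma n_t^{-\sigma}.$$ At time $t$ a mini-batch $\xi_{t,1},\dots,\xi_{t,n_t}$ arrives; $f_t(\theta)=n_t^{-1}\sum_{i=1}^{n_t}f(\theta;\xi_{t,i})$. Let $(\mathcal F_t)_{t\ge0}$ be a filtration to which $(f_t)_{t\geq 1}$ is adapted (e.g. the natural one), and let $\theta_0$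 be $\mathcal F_0$-measurable with finite fourth moment. The iterates $(\theta_t)$ follow either * (SSG) $\theta_t=\theta_{t-1}-\gamma_t\nabla f_t(\theta_{t-1})$, with $\Theta=\mathbb R^d$, or * (PSSG) $\theta_t=\mathcal P_\Theta\big(\theta_{t-1}-\gamma_t\nabla f_t(\theta_{t-1})\big)$, with $\theta_0\in\Theta$ and $\mathcal P_\Theta$ the Euclidean projection onto $\Theta$, and $\bar\theta_t=N_t^{-1}\sum_{i=0}^{t-1}n_{i+1}\theta_i$, $\bar\delta_t=\mathbb E\|\bar\theta_t-\theta^*\|^2$. **Assumptions.** 1. $F$ is differentiable, $\nabla F(\theta^*)=0$, and for some $\mu>0$ and all $\theta\in\Theta$: $F(\theta^*)\ge F(\theta)+\langle\nabla F(\theta),\theta^*-\theta\rangle+\frac\mu2\|\theta^*-\theta\|^2$. 2. $\nabla F$ is differentiable on $\Theta$, and for some $C_\nabla>0$, $C_\nabla'\ge0$ and all $\theta\in\Theta$: $\|\nabla F(\theta)-\nabla F(\theta^*)\|\le C_\nabla\|\theta-\theta^*\|$ and $\|\nabla^2F(\theta)-\nabla^2F(\theta^*)\|\le C_\nabla'\|\theta-\theta^*\|$.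 3. For every $t\ge1$ and every $\mathcal F_{t-1}$-measurable $\Theta$-valued random vector $\vartheta$ with finite fourth moment, $\nabla f_t(\vartheta)$ is square-integrable and, for some $C_\kappa>0$, $$\mathbb E\big\|\mathbb E[\nabla f_t(\vartheta)\mid\mathcal F_{t-1}]-\nabla F(\vartheta)\big\|^4\le\nu_t^4\big(D_\nu^4\,\mathbb E\|\vartheta-\theta^*\|^4+B_\nu^4\big),$$ $$\mathbb E\|\nabla f_t(\vartheta)-\nabla f_t(\theta^*)\|^4\le C_\kappa^4\,\mathbb E\|\vartheta-\theta^*\|^4,\qquad \mathbb E\|\nabla f_t(\theta^*)\|^4\le\sigma_t^4 .$$ 4. There are symmetric positive semidefinite matrices $\Sigma$, $\Sigma_t$ with $\operatorname{Tr}\Sigma_t=C_\sigma'n_t^{-2\sigma'}$ and $n_t^{2\sigma}\,\mathbb E[\nabla f_t(\theta^*)\nabla f_t(\theta^*)^\top]\preceq\Sigma+\Sigma_t$ for all $t\ge1$. 5. In the case of PSSG: $D_\Theta=\inf_{\theta\in\partial\Theta}\|\theta-\theta^*\|>0$, and for some $G_\Theta>0$ and all $t\ge1$, $\sup_{\theta\in\Theta}\|\nabla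 f_t(\theta)\|^2\le G_\Theta^2$ almost surely. **Theorem.** Suppose that $\mu_\nu=\mu-\mathbb 1_{\{\rho=0\}}2D_\nu C_\rho^{-\nu}>0$ and $\alpha-\rho\beta\in(1/2,1)$. Put $\Lambda=\operatorname{Tr}(\nabla^2F(\theta^*)^{-1}\Sigma\nabla^2F(\theta^*)^{-1})$ and $\delta=\rho(2\sigma-\beta)+\alpha$ if $B_\nu=0$, $\delta=\min\{\rho(2\sigma-\beta)+\alpha,\,2\rho\nu\}$ if $B_\nu\ne0$. Then, for all $t\ge1$, $\bar\theta_t$ is square-integrable and $$\begin{aligned}\bar\delta_t^{1/2}\le{}&\frac{\Lambda^{1/2}}{N_t^{1/2}}\mathbb 1_{\{\sigma=1/2\}}+\frac{2^{1/2}\Lambda^{1/2}C_\rho^{\frac{1-2\sigma}{2(1+\rho)}}}{N_t^{\frac{1+2\rho\sigma}{2(1+\rho)}}}\mathbb 1_{\{\sigma<1/2\}}+\frac{2^{1/2}C_\sigma'^{1/2}C_\rho^{\frac{1-2(\sigma+\sigma')}{2(1+\rho)}}}{\mu N_t^{\frac{1+2\rho(\sigma+\sigma')}{2(1+\rho)}}}\\&+\tilde{\mathcal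 O}\Big(\max\Big\{N_t^{-\frac{2+\rho(2\sigma+\beta)-\alpha}{2(1+\rho)}},N_t^{-\frac{\rho(2\sigma-\beta)+\alpha}{1+\rho}}\Big\}\Big)+\mathbb 1_{\{D_\nu\ne0\}}\tilde{\mathcal O}\Big(N_t^{-\frac{\delta+\rho\nu}{2(1+\rho)}}\Big)+\mathbb 1_{\{B_\nu\ne0\}}\Psi_t,\end{aligned}$$ $$\Psi_t=\tilde{\mathcal O}\Big(\max\Big\{N_t^{-\frac{\rho(\sigma+\nu)}{2(1+\rho)}},N_t^{-\frac{1+\rho(\beta+\nu)-\alpha}{1+\rho}},N_t^{-\frac{1+2\rho\nu}{2(1+\rho)}},N_t^{-\frac{\delta/2+\rho\nu}{2(1+\rho)}},N_t^{-\frac{2\rho\nu}{1+\rho}}\Big\}\Big).$$ Here $u_t=\tilde{\mathcal O}(v_t)$ means $|u_t|\le K(1+\log N_t)^k v_t$ for all $t\ge1$, where $K$ and $k$ depend only on $\mu,C_\nabla,C_\nabla',C_\kappa,C_\sigma,\sigma,C_\sigma',\sigma',D_\nu,B_\nu,\nu,C_\gamma,\alpha,\beta,C_\rho,\rho$, on an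 upper bound for $\mathbb E\|\theta_0-\theta^*\|^4$ and, for PSSG, on $G_\Theta$ and (a positive lower bound for) $D_\Theta$. -/

import Mathlib

open MeasureTheory

noncomputable section

namespace Streaming

/-- The numerical constants of the problem and of the algorithm.
`Delta0` bounds the fourth moment of the initial error; `G` and `DTheta` (gradient bound and
distance from the minimizer to the boundary of the constraint set) matter only with projection. -/
structure Params where
  mu : ℝ
  Cgrad : ℝ
  Chess : ℝ
  Ckappa : ℝ
  Csigma : ℝ
  sigma : ℝ
  Csigma' : ℝ
  sigma' : ℝ
  Dnu : ℝ
  Bnu : ℝ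
  nu : ℝ
  Cgamma : ℝ
  alpha : ℝ
  beta : ℝ
  Crho : ℕ
  rho : ℝ
  Delta0 : ℝ
  G : ℝ
  DTheta : ℝ

namespace Params

variable (p : Params)

/-- Size of the `t`-th mini-batch, `n_t = ⌈C_ρ t^ρ⌉`. -/
def batch (t : ℕ) : ℕ := ⌈(p.Crho : ℝ) * (t : ℝ) ^ p.rho⌉₊

/-- `N_t = n_1 + ⋯ + n_t`. -/
def total (t : ℕ) : ℕ := ∑ i ∈ Finset.Icc 1 t, p.batch i

/-- Learning rate `γ_t = C_γ n_t^β t^{-α}`. -/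
def rate (t : ℕ) : ℝ := p.Cgamma * (p.batch t : ℝ) ^ p.beta * (t : ℝ) ^ (-p.alpha)

/-- `ν_t = n_t^{-ν}`. -/
def depRate (t : ℕ) : ℝ := (p.batch t : ℝ) ^ (-p.nu)

/-- `σ_t = C_σ n_t^{-σ}`. -/
def noiseRate (t : ℕ) : ℝ := p.Csigma * (p.batch t : ℝ) ^ (-p.sigma)

/-- `μ_ν = μ - 1_{ρ = 0} 2 D_ν C_ρ^{-ν}`. -/
def muNu : ℝ := p.mu - if p.rho = 0 then 2 * p.Dnu * (p.Crho : ℝ) ^ (-p.nu) else 0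

/-- The decay exponent `δ` of the mean squared error of the non-averaged iterates. -/
def delta : ℝ :=
  if p.Bnu = 0 then p.rho * (2 * p.sigma - p.beta) + p.alpha
  else min (p.rho * (2 * p.sigma - p.beta) + p.alpha) (2 * p.rho * p.nu)

/-- The ranges of the constants. -/
structure Valid : Prop where
  mu_pos : 0 < p.mu
  Cgrad_pos : 0 < p.Cgrad
  Chess_nonneg : 0 ≤ p.Chess
  Ckappa_pos : 0 < p.Ckappa
  Csigma_pos : 0 < p.Csigma
  sigma_mem : p.sigma ∈ Set.Icc (0 : ℝ) (1 / 2)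
  Csigma'_nonneg : 0 ≤ p.Csigma'
  sigma'_mem : p.sigma' ∈ Set.Ioc (0 : ℝ) (1 / 2)
  Dnu_nonneg : 0 ≤ p.Dnu
  Bnu_nonneg : 0 ≤ p.Bnu
  nu_pos : 0 < p.nu
  Cgamma_pos : 0 < p.Cgamma
  beta_mem : p.beta ∈ Set.Icc (0 : ℝ) 1
  Crho_pos : 0 < p.Crho
  rho_mem : p.rho ∈ Set.Ico (0 : ℝ) 1

/-- `u_t = Õ(v_t)`: bounded by `v_t` up to a constant and a power of `log N_t`, for all `t ≥ 1`. -/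
def IsSoftO (u v : ℕ → ℝ) : Prop :=
  ∃ (K : ℝ) (k : ℕ), ∀ t : ℕ, 1 ≤ t →
    |u t| ≤ K * (1 + Real.log (p.total t : ℝ)) ^ k * v t

end Params

section Problem

variable {d : ℕ} {Ξ Ω : Type*}

/-- The objective `F(θ) = E_ξ[f(θ; ξ)]`, with `π` the law of `ξ`. -/
def objective [MeasurableSpace Ξ] (f : EuclideanSpace ℝ (Fin d) → Ξ → ℝ) (π : Measure Ξ)
    (θ : EuclideanSpace ℝ (Fin d)) : ℝ :=
  ∫ x, f θ x ∂π

/-- The loss of the `t`-th mini-batch, `f_t(θ) = n_t⁻¹ ∑_{i=1}^{n_t} f(θ; ξ_{t,i})`. -/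
def batchLoss (p : Params) (f : EuclideanSpace ℝ (Fin d) → Ξ → ℝ) (ξ : ℕ → ℕ → Ω → Ξ)
    (t : ℕ) (ω : Ω) (θ : EuclideanSpace ℝ (Fin d)) : ℝ :=
  (p.batch t : ℝ)⁻¹ * ∑ i ∈ Finset.Icc 1 (p.batch t), f θ (ξ t i ω)

/-- The gradient estimate `∇f_t(θ) = n_t⁻¹ ∑_{i=1}^{n_t} ∇f_{t,i}(θ)`. -/
def batchGrad (p : Params) (f : EuclideanSpace ℝ (Fin d) → Ξ → ℝ) (ξ : ℕ → ℕ → Ω → Ξ)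
    (t : ℕ) (ω : Ω) (θ : EuclideanSpace ℝ (Fin d)) : EuclideanSpace ℝ (Fin d) :=
  (p.batch t : ℝ)⁻¹ • ∑ i ∈ Finset.Icc 1 (p.batch t), gradient (fun η => f η (ξ t i ω)) θ

/-- The recursion `θ_t = θ_{t-1} - γ_t ∇f_t(θ_{t-1})`; `g` stands for the gradient estimates. -/
def IsSSG (p : Params) (g : ℕ → Ω → EuclideanSpace ℝ (Fin d) → EuclideanSpace ℝ (Fin d))
    (θ : ℕ → Ω → EuclideanSpace ℝ (Fin d)) : Prop :=
  ∀ (t : ℕ) (ω : Ω), θ (t + 1) ω = θ t ω - p.rate (t + 1) • g (t + 1) ω (θ t ω)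

/-- `y` is a Euclidean projection of `x` onto `Θ`, i.e. a point of `Θ` closest to `x`. -/
def IsProjection (Θ : Set (EuclideanSpace ℝ (Fin d))) (x y : EuclideanSpace ℝ (Fin d)) : Prop :=
  y ∈ Θ ∧ ∀ z ∈ Θ, ‖x - y‖ ≤ ‖x - z‖

/-- The projected recursion `θ_t = P_Θ(θ_{t-1} - γ_t ∇f_t(θ_{t-1}))`, started in `Θ`. -/
def IsPSSG (p : Params) (Θ : Set (EuclideanSpace ℝ (Fin d)))
    (g : ℕ → Ω → EuclideanSpace ℝ (Fin d) → EuclideanSpace ℝ (Fin d))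
    (θ : ℕ → Ω → EuclideanSpace ℝ (Fin d)) : Prop :=
  (∀ ω, θ 0 ω ∈ Θ) ∧
  ∀ (t : ℕ) (ω : Ω),
    IsProjection Θ (θ t ω - p.rate (t + 1) • g (t + 1) ω (θ t ω)) (θ (t + 1) ω)

/-- The Polyak–Ruppert average `θ̄_t = N_t⁻¹ ∑_{i=0}^{t-1} n_{i+1} θ_i`. -/
def average (p : Params) (θ : ℕ → Ω → EuclideanSpace ℝ (Fin d)) (t : ℕ) (ω : Ω) :
    EuclideanSpace ℝ (Fin d) :=
  (p.total t : ℝ)⁻¹ • ∑ i ∈ Finset.range t, (p.batch (i + 1) : ℝ) • θ i ω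

/-- `μ`-quasi-strong convexity on `Θ`. -/
structure QuasiStronglyConvex (p : Params) (Θ : Set (EuclideanSpace ℝ (Fin d)))
    (F : EuclideanSpace ℝ (Fin d) → ℝ) (θs : EuclideanSpace ℝ (Fin d)) : Prop where
  differentiable : Differentiable ℝ F
  gradient_eq_zero : gradient F θs = 0
  le : ∀ θ ∈ Θ,
    F θ + inner ℝ (gradient F θ) (θs - θ) + p.mu / 2 * ‖θs - θ‖ ^ 2 ≤ F θs

/-- Gradient and Hessian of `F` are Lipschitz around the minimizer, on `Θ`. -/
structure Smooth (p : Params) (Θ : Set (EuclideanSpace ℝ (Fin d)))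
    (F : EuclideanSpace ℝ (Fin d) → ℝ) (θs : EuclideanSpace ℝ (Fin d)) : Prop where
  gradient_lipschitz : ∀ θ ∈ Θ, ‖gradient F θ - gradient F θs‖ ≤ p.Cgrad * ‖θ - θs‖
  twice_differentiable : ∀ θ ∈ Θ, DifferentiableAt ℝ (gradient F) θ
  hessian_lipschitz : ∀ θ ∈ Θ,
    ‖fderiv ℝ (gradient F) θ - fderiv ℝ (gradient F) θs‖ ≤ p.Chess * ‖θ - θs‖

/-- The Hessian matrix of `F` at `θ`. -/
def hessianMatrix (F : EuclideanSpace ℝ (Fin d) → ℝ) (θ : EuclideanSpace ℝ (Fin d)) :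
    Matrix (Fin d) (Fin d) ℝ :=
  Matrix.of fun i j => (fderiv ℝ (gradient F) θ (EuclideanSpace.single j (1 : ℝ))) i

/-- `Λ = Tr(∇²F(θ*)⁻¹ Σ ∇²F(θ*)⁻¹)`. -/
def Lam (F : EuclideanSpace ℝ (Fin d) → ℝ) (θs : EuclideanSpace ℝ (Fin d))
    (S : Matrix (Fin d) (Fin d) ℝ) : ℝ :=
  ((hessianMatrix F θs)⁻¹ * S * (hessianMatrix F θs)⁻¹).trace

variable [mΩ : MeasurableSpace Ω]

/-- Dependence and bias, with moment order `q`: for every random parameter `ϑ` known at time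
`t - 1`, with values in `Θ` and a finite moment of order `q`,
`E‖E[∇f_t(ϑ) | ℱ_{t-1}] - ∇F(ϑ)‖^q ≤ ν_t^q (D_ν^q E‖ϑ - θ*‖^q + B_ν^q)`. -/
def DependenceBias (p : Params) (q : ℕ) (P : Measure Ω) (𝓕 : Filtration ℕ mΩ)
    (Θ : Set (EuclideanSpace ℝ (Fin d)))
    (g : ℕ → Ω → EuclideanSpace ℝ (Fin d) → EuclideanSpace ℝ (Fin d))
    (F : EuclideanSpace ℝ (Fin d) → ℝ) (θs : EuclideanSpace ℝ (Fin d)) : Prop :=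
  ∀ t : ℕ, 1 ≤ t → ∀ ϑ : Ω → EuclideanSpace ℝ (Fin d),
    Measurable[𝓕 (t - 1)] ϑ → (∀ ω, ϑ ω ∈ Θ) → MemLp ϑ (q : ENNReal) P →
      MemLp (fun ω => g t ω (ϑ ω)) 2 P ∧
      Integrable (fun ω =>
        ‖(P[fun ω => g t ω (ϑ ω) | 𝓕 (t - 1)]) ω - gradient F (ϑ ω)‖ ^ q) P ∧
      ∫ ω, ‖(P[fun ω => g t ω (ϑ ω) | 𝓕 (t - 1)]) ω - gradient F (ϑ ω)‖ ^ q ∂P ≤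
        p.depRate t ^ q * (p.Dnu ^ q * ∫ ω, ‖ϑ ω - θs‖ ^ q ∂P + p.Bnu ^ q)

/-- Expected smoothness, with moment order `q`, for the same random parameters `ϑ`. -/
def ExpectedSmooth (p : Params) (q : ℕ) (P : Measure Ω) (𝓕 : Filtration ℕ mΩ)
    (Θ : Set (EuclideanSpace ℝ (Fin d)))
    (g : ℕ → Ω → EuclideanSpace ℝ (Fin d) → EuclideanSpace ℝ (Fin d))
    (θs : EuclideanSpace ℝ (Fin d)) : Prop :=
  ∀ t : ℕ, 1 ≤ t → ∀ ϑ : Ω → EuclideanSpace ℝ (Fin d),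
    Measurable[𝓕 (t - 1)] ϑ → (∀ ω, ϑ ω ∈ Θ) → MemLp ϑ (q : ENNReal) P →
      Integrable (fun ω => ‖g t ω (ϑ ω) - g t ω θs‖ ^ q) P ∧
      ∫ ω, ‖g t ω (ϑ ω) - g t ω θs‖ ^ q ∂P ≤ p.Ckappa ^ q * ∫ ω, ‖ϑ ω - θs‖ ^ q ∂P

/-- Gradient noise at the minimizer, with moment order `q`. -/
def GradientNoise (p : Params) (q : ℕ) (P : Measure Ω)
    (g : ℕ → Ω → EuclideanSpace ℝ (Fin d) → EuclideanSpace ℝ (Fin d))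
    (θs : EuclideanSpace ℝ (Fin d)) : Prop :=
  ∀ t : ℕ, 1 ≤ t →
    Integrable (fun ω => ‖g t ω θs‖ ^ q) P ∧ ∫ ω, ‖g t ω θs‖ ^ q ∂P ≤ p.noiseRate t ^ q

/-- `E[∇f_t(θ*) ∇f_t(θ*)ᵀ]`. -/
def scoreMatrix (P : Measure Ω)
    (g : ℕ → Ω → EuclideanSpace ℝ (Fin d) → EuclideanSpace ℝ (Fin d))
    (θs : EuclideanSpace ℝ (Fin d)) (t : ℕ) : Matrix (Fin d) (Fin d) ℝ :=
  Matrix.of fun i j => ∫ ω, g t ω θs i * g t ω θs j ∂P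

/-- Covariance of the scores: `n_t^{2σ} E[∇f_t(θ*) ∇f_t(θ*)ᵀ] ≼ Σ + Σ_t` with `Σ`, `Σ_t`
positive semidefinite and `Tr Σ_t = C_σ' n_t^{-2σ'}`. -/
structure ScoreCovariance (p : Params) (P : Measure Ω)
    (g : ℕ → Ω → EuclideanSpace ℝ (Fin d) → EuclideanSpace ℝ (Fin d))
    (θs : EuclideanSpace ℝ (Fin d)) (S : Matrix (Fin d) (Fin d) ℝ)
    (St : ℕ → Matrix (Fin d) (Fin d) ℝ) : Prop where
  posSemidef : S.PosSemidef
  posSemidef_t : ∀ t : ℕ, 1 ≤ t → (St t).PosSemidef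
  trace_t : ∀ t : ℕ, 1 ≤ t →
    (St t).trace = p.Csigma' * (p.batch t : ℝ) ^ (-(2 * p.sigma'))
  le : ∀ t : ℕ, 1 ≤ t →
    (S + St t - (p.batch t : ℝ) ^ (2 * p.sigma) • scoreMatrix P g θs t).PosSemidef

/-- Bounded gradients on `Θ`, with the minimizer at distance at least `D_Θ > 0` from `∂Θ`. -/
structure BoundedGradients (p : Params) (P : Measure Ω) (Θ : Set (EuclideanSpace ℝ (Fin d)))
    (g : ℕ → Ω → EuclideanSpace ℝ (Fin d) → EuclideanSpace ℝ (Fin d))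
    (θs : EuclideanSpace ℝ (Fin d)) : Prop where
  DTheta_pos : 0 < p.DTheta
  le_dist : ∀ θ ∈ frontier Θ, p.DTheta ≤ ‖θ - θs‖
  G_pos : 0 < p.G
  bounded : ∀ t : ℕ, 1 ≤ t → ∀ᵐ ω ∂P, ∀ θ ∈ Θ, ‖g t ω θ‖ ^ 2 ≤ p.G ^ 2

end Problem

end Streaming

end

/-!
Quasi-strong convexity makes `E‖θ_t - θ*‖⁴` contract along the recursion, which gives an `L⁴` rate
for the iterates. Write `H = ∇²F(θ*)`, `g_t = ∇f_t(θ_{t-1})` and `m_t = ∇f_t(θ*)`. Solving the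
recursion for the first-order expansion of `∇F(θ_{t-1})` at `θ*` expresses `n_t H(θ_{t-1} - θ*)` as
the increment `(n_t / γ_t)(θ_{t-1} - θ_t)`, minus the martingale difference
`n_t (m_t - E[m_t | ℱ_{t-1}])`, plus errors. Applying `N_t⁻¹ H⁻¹` to the sum over time yields
`θ̄_t - θ*`. The martingale differences are orthogonal, and their second moments give the leading
terms. Everything else is of lower order: the increments by summation by parts, the linearization
error and the displacement caused by the projection because they are quadratic in `θ_t - θ*`, the
bias `E[g_t | ℱ_{t-1}] - ∇F(θ_{t-1})` by assumption, and the martingale differences of `g_t - m_t`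
by orthogonality and expected smoothness.
-/

namespace Streaming

open Filter Topology

/-! ### Powers, sums and recursions -/

section RealAnalysis

lemma sum_range_add_one_eq_sum_Icc {M : Type*} [AddCommMonoid M] (f : ℕ → M) (t : ℕ) :
    ∑ i ∈ Finset.range t, f (i + 1) = ∑ i ∈ Finset.Icc 1 t, f i := by
  rw [Finset.range_eq_Ico, Finset.sum_Ico_add' f 0 t 1]
  rfl

lemma sum_range_sub_smul {R M : Type*} [Ring R] [AddCommGroup M] [Module R M] {w : ℕ → R}
    (hw : w 0 = 0) (x : ℕ → M) (t : ℕ) :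
    ∑ i ∈ Finset.range t, (w (i + 1) - w i) • x i =
      ∑ i ∈ Finset.range t, w (i + 1) • (x i - x (i + 1)) + w t • x t := by
  induction t with
  | zero => simp [hw]
  | succ t ih =>
    rw [Finset.sum_range_succ, Finset.sum_range_succ, ih]
    simp only [sub_smul, smul_sub]
    abel

lemma sqrt_add_le_sqrt_add_sqrt {x y : ℝ} (hx : 0 ≤ x) (hy : 0 ≤ y) : √(x + y) ≤ √x + √y :=
  Real.sqrt_le_iff.2 ⟨by positivity, by
    nlinarith [Real.sq_sqrt hx, Real.sq_sqrt hy,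
      mul_nonneg (Real.sqrt_nonneg x) (Real.sqrt_nonneg y)]⟩

lemma rpow_sub_rpow_le {q x y : ℝ} (hq : 1 ≤ q) (hx : 0 ≤ x) (hy : 0 < y) :
    y ^ q - x ^ q ≤ q * y ^ (q - 1) * (y - x) := by
  have bernoulli : 1 + q * (x / y - 1) ≤ (x / y) ^ q := by
    simpa using one_add_mul_self_le_rpow_one_add
      (by linarith [div_nonneg hx hy.le] : -1 ≤ x / y - 1) hq
  rw [Real.div_rpow hx hy.le, le_div_iff₀ (by positivity)] at bernoulli
  have hyq : y ^ q = y ^ (q - 1) * y := by rw [← Real.rpow_add_one hy.ne', sub_add_cancel]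
  have : (1 + q * (x / y - 1)) * y ^ q = y ^ q - q * y ^ (q - 1) * (y - x) := by
    rw [hyq]; field_simp; ring
  linarith

lemma rpow_neg_sub_rpow_neg_le {s x y : ℝ} (hs : 0 ≤ s) (hx : 0 < x) (hy : 0 < y) :
    x ^ (-s) - y ^ (-s) ≤ s * x ^ (-s - 1) * (y - x) := by
  have bernoulli : 1 - s * (y / x - 1) ≤ (y / x) ^ (-s) := by
    rw [Real.rpow_def_of_pos (by positivity)]
    have := Real.log_le_sub_one_of_pos (by positivity : 0 < y / x)
    nlinarith [Real.add_one_le_exp (Real.log (y / x) * -s)]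
  rw [Real.div_rpow hy.le hx.le, le_div_iff₀ (by positivity)] at bernoulli
  have : (1 - s * (y / x - 1)) * x ^ (-s) = x ^ (-s) - s * x ^ (-s - 1) * (y - x) := by
    rw [Real.rpow_sub_one hx.ne']; field_simp
  linarith

lemma rpow_one_div_mul_rpow_div {r y : ℝ} (hr : 0 < 1 + r) (hy : 0 < y) :
    y ^ (1 / (1 + r)) * y ^ (r / (1 + r)) = y := by
  rw [← Real.rpow_add hy, ← add_div, div_self hr.ne', Real.rpow_one]

lemma one_add_rpow_div_le_sqrt_two {r : ℝ} (h0 : 0 ≤ r) (h1 : r ≤ 1) :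
    (1 + r) ^ (r / (1 + r)) ≤ √2 := by
  rw [Real.sqrt_eq_rpow]
  calc (1 + r) ^ (r / (1 + r)) ≤ (1 + r) ^ (1 / 2 : ℝ) := by
        refine Real.rpow_le_rpow_of_exponent_le (by linarith) ?_
        rw [div_le_div_iff₀ (by linarith) (by norm_num)]
        linarith
    _ ≤ 2 ^ (1 / 2 : ℝ) := by gcongr; linarith

lemma sum_rpow_one_sub_le {ι : Type*} {s : Finset ι} (hs : s.Nonempty) {y : ι → ℝ}
    (hy : ∀ i ∈ s, 0 ≤ y i) {e : ℝ} (he0 : 0 ≤ e) (he1 : e ≤ 1) :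
    ∑ i ∈ s, y i ^ (1 - e) ≤ (s.card : ℝ) ^ e * (∑ i ∈ s, y i) ^ (1 - e) := by
  have hc : (0 : ℝ) < s.card := by exact_mod_cast hs.card_pos
  have jensen := (Real.concaveOn_rpow (p := 1 - e) (by linarith) (by linarith)).le_map_sum
    (t := s) (w := fun _ => (s.card : ℝ)⁻¹) (p := y) (fun i _ => by positivity)
    (by rw [Finset.sum_const, nsmul_eq_mul, mul_inv_cancel₀ hc.ne']) hy
  simp only [smul_eq_mul, ← Finset.mul_sum] at jensen
  rw [Real.mul_rpow (by positivity) (Finset.sum_nonneg hy), inv_mul_le_iff₀ hc, ← mul_assoc]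
    at jensen
  refine jensen.trans_eq ?_
  congr 1
  rw [Real.inv_rpow hc.le, ← Real.rpow_neg hc.le]
  nth_rewrite 1 [← Real.rpow_one (s.card : ℝ)]
  rw [← Real.rpow_add hc]
  congr 1
  ring

lemma sum_inv_le_one_add_log (t : ℕ) : ∑ i ∈ Finset.Icc 1 t, (i : ℝ)⁻¹ ≤ 1 + Real.log t := by
  simpa [harmonic_eq_sum_Icc] using harmonic_le_one_add_log t

lemma one_le_one_add_log (t : ℕ) : 1 ≤ 1 + Real.log t :=
  le_add_of_nonneg_right (Real.log_natCast_nonneg t)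

lemma sum_rpow_le (s : ℝ) (t : ℕ) :
    ∑ i ∈ Finset.Icc 1 t, (i : ℝ) ^ s ≤ (1 + Real.log t) * ((t : ℝ) ^ (s + 1) + 1) := by
  have hterm : ∀ i ∈ Finset.Icc 1 t, (i : ℝ) ^ s ≤ (i : ℝ)⁻¹ * ((t : ℝ) ^ (s + 1) + 1) := by
    intro i hi
    obtain ⟨hi1, hit⟩ := Finset.mem_Icc.1 hi
    have hi0 : (0 : ℝ) < i := by exact_mod_cast hi1
    rw [le_inv_mul_iff₀ hi0, mul_comm, ← Real.rpow_add_one hi0.ne']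
    rcases le_total 0 (s + 1) with h | h
    · have : (i : ℝ) ^ (s + 1) ≤ (t : ℝ) ^ (s + 1) := by gcongr
      linarith
    · have := Real.rpow_le_one_of_one_le_of_nonpos (by exact_mod_cast hi1 : (1 : ℝ) ≤ i) h
      have : 0 ≤ (t : ℝ) ^ (s + 1) := by positivity
      linarith
  refine (Finset.sum_le_sum hterm).trans ?_
  rw [← Finset.sum_mul]
  gcongr
  exact sum_inv_le_one_add_log t

lemma mul_rpow_neg_sub_rpow_neg_le {b s v W : ℝ} (hW : 0 ≤ W) (hs : 0 ≤ s) {i : ℕ} (hi : 1 ≤ i)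
    (hv : v ≤ W * (i : ℝ) ^ b) :
    v * ((i : ℝ) ^ (-s) - ((i + 1 : ℕ) : ℝ) ^ (-s)) ≤ W * s * (i : ℝ) ^ (b - s - 1) := by
  have hi0 : (0 : ℝ) < i := by exact_mod_cast hi
  have hdecr : 0 ≤ (i : ℝ) ^ (-s) - ((i + 1 : ℕ) : ℝ) ^ (-s) :=
    sub_nonneg.2 (Real.rpow_le_rpow_of_nonpos hi0 (by push_cast; linarith) (by linarith))
  have hdiff := rpow_neg_sub_rpow_neg_le hs hi0 (by positivity : (0 : ℝ) < ((i + 1 : ℕ) : ℝ))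
  rw [show ((i + 1 : ℕ) : ℝ) - i = 1 by push_cast; ring, mul_one] at hdiff
  calc v * ((i : ℝ) ^ (-s) - ((i + 1 : ℕ) : ℝ) ^ (-s))
      ≤ W * (i : ℝ) ^ b * (s * (i : ℝ) ^ (-s - 1)) := by gcongr
    _ = W * s * ((i : ℝ) ^ b * (i : ℝ) ^ (-s - 1)) := by ring
    _ = W * s * (i : ℝ) ^ (b - s - 1) := by rw [← Real.rpow_add hi0]; congr 2; ring

lemma mul_succ_rpow_neg_le {b s v W : ℝ} (hW : 0 ≤ W) (hs : 0 ≤ s) {t : ℕ} (ht : 1 ≤ t)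
    (hv : v ≤ W * (t : ℝ) ^ b) : v * ((t + 1 : ℕ) : ℝ) ^ (-s) ≤ W * (t : ℝ) ^ (b - s) := by
  have ht0 : (0 : ℝ) < t := by exact_mod_cast ht
  calc v * ((t + 1 : ℕ) : ℝ) ^ (-s) ≤ W * (t : ℝ) ^ b * ((t + 1 : ℕ) : ℝ) ^ (-s) := by gcongr
    _ ≤ W * (t : ℝ) ^ b * (t : ℝ) ^ (-s) :=
        mul_le_mul_of_nonneg_left
          (Real.rpow_le_rpow_of_nonpos ht0 (by push_cast; linarith) (by linarith)) (by positivity)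
    _ = W * (t : ℝ) ^ (b - s) := by rw [mul_assoc, ← Real.rpow_add ht0, sub_eq_add_neg]

lemma sum_sub_mul_rpow_neg_le {w : ℕ → ℝ} {b s W : ℝ} (hw0 : w 0 = 0)
    (hw : ∀ i, 1 ≤ i → w i ≤ W * (i : ℝ) ^ b) (hW : 0 ≤ W) (hs : 0 ≤ s) {t : ℕ} (ht : 1 ≤ t) :
    ∑ i ∈ Finset.range t, (w (i + 1) - w i) * ((i + 1 : ℕ) : ℝ) ^ (-s) +
        w t * ((t + 1 : ℕ) : ℝ) ^ (-s) ≤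
      W * (s + 2) * ((1 + Real.log t) * ((t : ℝ) ^ (b - s) + 1)) := by
  have hparts := sum_range_sub_smul hw0 (fun i : ℕ => ((i + 1 : ℕ) : ℝ) ^ (-s)) t
  simp only [smul_eq_mul] at hparts
  rw [sum_range_add_one_eq_sum_Icc
    (fun i : ℕ => w i * ((i : ℝ) ^ (-s) - ((i + 1 : ℕ) : ℝ) ^ (-s))) t] at hparts
  have hsum : ∑ i ∈ Finset.Icc 1 t, w i * ((i : ℝ) ^ (-s) - ((i + 1 : ℕ) : ℝ) ^ (-s)) ≤
      W * s * ((1 + Real.log t) * ((t : ℝ) ^ (b - s) + 1)) := by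
    have hpow := sum_rpow_le (b - s - 1) t
    rw [sub_add_cancel] at hpow
    calc ∑ i ∈ Finset.Icc 1 t, w i * ((i : ℝ) ^ (-s) - ((i + 1 : ℕ) : ℝ) ^ (-s))
        ≤ ∑ i ∈ Finset.Icc 1 t, W * s * (i : ℝ) ^ (b - s - 1) :=
          Finset.sum_le_sum fun i hi =>
            have hi1 := (Finset.mem_Icc.1 hi).1
            mul_rpow_neg_sub_rpow_neg_le hW hs hi1 (hw i hi1)
      _ ≤ W * s * ((1 + Real.log t) * ((t : ℝ) ^ (b - s) + 1)) := by
          rw [← Finset.mul_sum]; gcongr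
  have hlast : w t * ((t + 1 : ℕ) : ℝ) ^ (-s) ≤
      W * ((1 + Real.log t) * ((t : ℝ) ^ (b - s) + 1)) :=
    (mul_succ_rpow_neg_le hW hs ht (hw t ht)).trans (by
      gcongr
      have : 0 ≤ (t : ℝ) ^ (b - s) := by positivity
      nlinarith [one_le_one_add_log t])
  rw [hparts]
  linarith

lemma exists_forall_le_of_recursion {b : ℕ → ℝ} (hb : ∀ t, 0 ≤ b t) (f : ℕ → ℝ) (u₀ : ℝ) (t : ℕ) :
    ∃ M : ℝ, ∀ u : ℕ → ℝ, u 0 ≤ u₀ → (∀ t, u (t + 1) ≤ b (t + 1) * u t + f (t + 1)) →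
      u t ≤ M := by
  induction t with
  | zero => exact ⟨u₀, fun _ h _ => h⟩
  | succ t ih =>
    obtain ⟨M, hM⟩ := ih
    refine ⟨b (t + 1) * M + f (t + 1), fun u h0 hu => (hu t).trans ?_⟩
    gcongr
    exacts [hb _, hM u h0 hu]

lemma recursion_step_le {b f r r' c y C K u : ℝ} (hb0 : 0 ≤ b) (hc : 0 < c) (hC : 0 ≤ C)
    (hy : 0 ≤ y) (hr' : 0 ≤ r') (hb : b ≤ 1 - c * y) (hf : f ≤ C * y * r')
    (hr : r ≤ r' * (1 + c / 2 * y)) (hK : 2 * C / c ≤ K) (hu : u ≤ K * r) :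
    b * u + f ≤ K * r' := by
  have hCK : C ≤ c / 2 * K := by rw [div_le_iff₀ hc] at hK; linarith
  have hK0 : 0 ≤ K := le_trans (by positivity) hK
  have hgrow : u ≤ K * r' * (1 + c / 2 * y) :=
    hu.trans (by rw [mul_assoc]; exact mul_le_mul_of_nonneg_left hr hK0)
  calc b * u + f ≤ (1 - c * y) * (K * r' * (1 + c / 2 * y)) + c / 2 * K * y * r' :=
        add_le_add ((mul_le_mul_of_nonneg_left hgrow hb0).trans (by gcongr)) (hf.trans (by gcongr))
    _ = K * r' - K * r' * (c * y * (c / 2 * y)) := by ring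
    _ ≤ K * r' := sub_le_self _ (by positivity)

lemma eventually_div_le_mul_rpow_neg {a c : ℝ} (ha : a < 1) (hc : 0 < c) (m : ℝ) :
    ∀ᶠ t : ℕ in atTop, m / t ≤ c * (t : ℝ) ^ (-a) := by
  have hlim : Tendsto (fun t : ℕ => m * (t : ℝ) ^ (-(1 - a))) atTop (𝓝 0) := by
    simpa using ((tendsto_rpow_neg_atTop (by linarith : 0 < 1 - a)).comp
      tendsto_natCast_atTop_atTop).const_mul m
  filter_upwards [hlim.eventually_le_const hc, eventually_gt_atTop 0] with t ht ht0
  have ht0 : (0 : ℝ) < t := by exact_mod_cast ht0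
  calc m / t = m * (t : ℝ) ^ (-(1 - a)) * (t : ℝ) ^ (-a) := by
        rw [mul_assoc, ← Real.rpow_add ht0, div_eq_mul_inv, ← Real.rpow_neg_one]
        congr 2
        ring
    _ ≤ c * (t : ℝ) ^ (-a) := by gcongr

lemma exists_bound_of_recursion {b f r : ℕ → ℝ} {a c C m : ℝ} (ha : a < 1) (hc : 0 < c)
    (hC : 0 ≤ C) (hr : ∀ t, 0 < r t)
    (hrm : ∀ t : ℕ, r t ≤ r (t + 1) * (1 + m / ((t + 1 : ℕ) : ℝ)))
    (hb0 : ∀ t, 0 ≤ b t)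
    (hb : ∀ᶠ t : ℕ in atTop, b t ≤ 1 - c * (t : ℝ) ^ (-a))
    (hf : ∀ᶠ t : ℕ in atTop, f t ≤ C * (t : ℝ) ^ (-a) * r t) (u₀ : ℝ) :
    ∃ K : ℝ, 0 ≤ K ∧ ∀ u : ℕ → ℝ, u 0 ≤ u₀ →
      (∀ t, u (t + 1) ≤ b (t + 1) * u t + f (t + 1)) → ∀ t, u t ≤ K * r t := by
  obtain ⟨T, hT⟩ := eventually_atTop.1
    (hb.and (hf.and (eventually_div_le_mul_rpow_neg ha (half_pos hc) m)))
  choose M hM using exists_forall_le_of_recursion hb0 f u₀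
  obtain ⟨K, hK, hKM⟩ := ((eventually_ge_atTop (2 * C / c)).and
    ((Finset.range (T + 1)).eventually_all.2 fun i _ =>
      eventually_ge_atTop (M i / r i))).exists
  refine ⟨K, le_trans (by positivity) hK, fun u hu0 hu t => ?_⟩
  have hstart : ∀ i < T + 1, u i ≤ K * r i := fun i hi =>
    (hM i u hu0 hu).trans ((div_le_iff₀ (hr i)).1 (hKM i (Finset.mem_range.2 hi)))
  induction t with
  | zero => exact hstart 0 T.succ_pos
  | succ t ih =>
    rcases lt_or_ge (t + 1) (T + 1) with hlt | hge
    · exact hstart _ hlt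
    obtain ⟨hbt, hft, hmt⟩ := hT (t + 1) (by omega)
    refine (hu t).trans (recursion_step_le (hb0 _) hc hC (by positivity) (hr _).le hbt hft ?_ hK ih)
    have := (hr (t + 1)).le
    exact (hrm t).trans (by gcongr)

end RealAnalysis

/-! ### Moments and martingale differences -/

section Moments

variable {Ω E E' : Type*} {mΩ : MeasurableSpace Ω} {P : Measure Ω} [NormedAddCommGroup E]
  [NormedAddCommGroup E'] {X : Ω → E} {Y : Ω → E'}

lemma lpNorm_natCast_pow {n : ℕ} (hn : n ≠ 0) (hX : AEStronglyMeasurable X P) :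
    lpNorm X n P ^ n = ∫ ω, ‖X ω‖ ^ n ∂P := by
  rw [lpNorm_eq_integral_norm_rpow_toReal (by exact_mod_cast hn) (ENNReal.natCast_ne_top n) hX,
    ENNReal.toReal_natCast, ← Real.rpow_natCast,
    Real.rpow_inv_rpow (integral_nonneg fun ω => by positivity) (by exact_mod_cast hn)]
  simp only [Real.rpow_natCast]

lemma lpNorm_four_pow (hX : AEStronglyMeasurable X P) :
    lpNorm X 4 P ^ 4 = ∫ ω, ‖X ω‖ ^ 4 ∂P := by
  exact_mod_cast lpNorm_natCast_pow four_ne_zero hX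

lemma lpNorm_two_eq_sqrt (hX : AEStronglyMeasurable X P) :
    lpNorm X 2 P = √(∫ ω, ‖X ω‖ ^ 2 ∂P) := by
  rw [← Real.sqrt_sq (lpNorm_nonneg : 0 ≤ lpNorm X 2 P)]
  congr 1
  exact_mod_cast lpNorm_natCast_pow two_ne_zero hX

lemma memLp_four_of_integrable (hX : AEStronglyMeasurable X P)
    (h : Integrable (fun ω => ‖X ω‖ ^ 4) P) : MemLp X 4 P := by
  rw [← integrable_norm_rpow_iff hX four_ne_zero ENNReal.ofNat_ne_top]
  simpa using (by exact_mod_cast h : Integrable (fun ω => ‖X ω‖ ^ (4 : ℝ)) P)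

lemma integrable_norm_pow_four (h : MemLp X 4 P) : Integrable (fun ω => ‖X ω‖ ^ 4) P :=
  MemLp.integrable_norm_pow (p := 4) (by exact_mod_cast h) four_ne_zero

lemma integrable_norm_sq (h : MemLp X 2 P) : Integrable (fun ω => ‖X ω‖ ^ 2) P :=
  MemLp.integrable_norm_pow (p := 2) (by exact_mod_cast h) two_ne_zero

lemma memLp_two_of_memLp_four [IsFiniteMeasure P] (h : MemLp X 4 P) : MemLp X 2 P :=
  h.mono_exponent (by norm_num)

lemma lpNorm_mono_exponent [IsProbabilityMeasure P] {p q : ENNReal} (hpq : p ≤ q)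
    (h : MemLp X q P) : lpNorm X p P ≤ lpNorm X q P := by
  rw [← toReal_eLpNorm h.aestronglyMeasurable, ← toReal_eLpNorm h.aestronglyMeasurable]
  exact ENNReal.toReal_mono h.eLpNorm_ne_top
    (eLpNorm_le_eLpNorm_of_exponent_le hpq h.aestronglyMeasurable)

lemma lpNorm_congr_ae {X Y : Ω → E} {p : ENNReal} (hX : AEStronglyMeasurable X P)
    (h : X =ᵐ[P] Y) : lpNorm X p P = lpNorm Y p P := by
  rw [← toReal_eLpNorm hX, ← toReal_eLpNorm (hX.congr h), eLpNorm_congr_ae h]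

lemma memLp_two_of_norm_le_sq {c : ℝ} (hX : MemLp X 4 P) (hY : AEStronglyMeasurable Y P)
    (h : ∀ᵐ ω ∂P, ‖Y ω‖ ≤ c * ‖X ω‖ ^ 2) : MemLp Y 2 P := by
  have hX2 : MemLp (fun ω => ‖X ω‖ ^ 2) 2 P := by
    refine (memLp_two_iff_integrable_sq_norm (hX.aestronglyMeasurable.norm.pow 2)).2 ?_
    simpa [← pow_mul] using integrable_norm_pow_four hX
  refine hX2.of_le_mul (c := c) hY (h.mono fun ω hω => ?_)
  rwa [norm_pow, norm_norm]

lemma lpNorm_two_le_of_norm_le_sq {c : ℝ} (hc : 0 ≤ c) (hX : MemLp X 4 P)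
    (hY : AEStronglyMeasurable Y P) (h : ∀ᵐ ω ∂P, ‖Y ω‖ ≤ c * ‖X ω‖ ^ 2) :
    lpNorm Y 2 P ≤ c * lpNorm X 4 P ^ 2 := by
  rw [lpNorm_two_eq_sqrt hY, Real.sqrt_le_left (by positivity)]
  calc ∫ ω, ‖Y ω‖ ^ 2 ∂P ≤ ∫ ω, c ^ 2 * ‖X ω‖ ^ 4 ∂P := by
        refine integral_mono_ae (integrable_norm_sq (memLp_two_of_norm_le_sq hX hY h))
          ((integrable_norm_pow_four hX).const_mul _) (h.mono fun ω hω => ?_)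
        calc ‖Y ω‖ ^ 2 ≤ (c * ‖X ω‖ ^ 2) ^ 2 := by gcongr
          _ = c ^ 2 * ‖X ω‖ ^ 4 := by ring
    _ = (c * lpNorm X 4 P ^ 2) ^ 2 := by
        rw [integral_const_mul, ← lpNorm_four_pow hX.aestronglyMeasurable]; ring

lemma lpNorm_le_mul_lpNorm {p : ENNReal} {c : ℝ} (hc : 0 ≤ c) (hX : MemLp X p P)
    (h : ∀ ω, ‖Y ω‖ ≤ c * ‖X ω‖) : lpNorm Y p P ≤ c * lpNorm X p P := by
  have hmono : lpNorm Y p P ≤ lpNorm (c • fun ω => ‖X ω‖) p P :=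
    lpNorm_mono_real (hX.norm.const_smul c) h
  rwa [lpNorm_const_smul, coe_nnnorm, Real.norm_of_nonneg hc,
    lpNorm_norm hX.aestronglyMeasurable] at hmono

lemma lpNorm_sum_smul_le [NormedSpace ℝ E] {ι : Type*} {s : Finset ι} {p : ENNReal} (hp : 1 ≤ p)
    {c b : ι → ℝ} {Z : ι → Ω → E} (hc : ∀ i, 0 ≤ c i) (hZ : ∀ i, MemLp (Z i) p P)
    (hb : ∀ i, lpNorm (Z i) p P ≤ b i) :
    lpNorm (fun ω => ∑ i ∈ s, c i • Z i ω) p P ≤ ∑ i ∈ s, c i * b i := by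
  have hsum : (fun ω => ∑ i ∈ s, c i • Z i ω) = ∑ i ∈ s, c i • Z i := by
    funext ω; simp only [Finset.sum_apply, Pi.smul_apply]
  rw [hsum]
  refine (lpNorm_sum_le (fun i _ => (hZ i).const_smul (c i)) hp).trans
    (Finset.sum_le_sum fun i _ => ?_)
  rw [lpNorm_const_smul, coe_nnnorm, Real.norm_of_nonneg (hc i)]
  exact mul_le_mul_of_nonneg_left (hb i) (hc i)

end Moments

section CondExp

variable {Ω E : Type*} {m mΩ : MeasurableSpace Ω} {P : Measure Ω} [NormedAddCommGroup E]
  [InnerProductSpace ℝ E]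

lemma integrable_inner_of_memLp {X Y : Ω → E} (hX : MemLp X 2 P) (hY : MemLp Y 2 P) :
    Integrable (fun ω => inner ℝ (X ω) (Y ω)) P :=
  (hX.norm.integrable_mul hY.norm).mono' (hX.aestronglyMeasurable.inner hY.aestronglyMeasurable)
    (ae_of_all _ fun ω => norm_inner_le_norm (X ω) (Y ω))

variable [CompleteSpace E]

lemma condExp_inner_of_stronglyMeasurable_left {X Y : Ω → E} (hY : StronglyMeasurable[m] Y)
    (hX : Integrable X P) (hXY : Integrable (fun ω => inner ℝ (Y ω) (X ω)) P) :
    P[fun ω => inner ℝ (Y ω) (X ω) | m] =ᵐ[P] fun ω => inner ℝ (Y ω) ((P[X | m]) ω) :=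
  condExp_bilin_of_stronglyMeasurable_left (innerSL ℝ) hY hXY hX

lemma memLp_sum_smul_sub_condExp (𝓕 : Filtration ℕ mΩ) {X : ℕ → Ω → E} (c : ℕ → ℝ)
    (hX : ∀ i, MemLp (X i) 2 P) (t : ℕ) :
    MemLp (fun ω => ∑ i ∈ Finset.range t, c i • (X i ω - (P[X i | 𝓕 i]) ω)) 2 P :=
  memLp_finsetSum _ fun i _ => ((hX i).sub ((hX i).condExp one_le_two)).const_smul (c i)

variable [IsFiniteMeasure P]

lemma integral_inner_condExp (hm : m ≤ mΩ) {X Y : Ω → E} (hY : StronglyMeasurable[m] Y)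
    (hX : Integrable X P) (hXY : Integrable (fun ω => inner ℝ (Y ω) (X ω)) P) :
    ∫ ω, inner ℝ (Y ω) ((P[X | m]) ω) ∂P = ∫ ω, inner ℝ (Y ω) (X ω) ∂P := by
  rw [← integral_congr_ae (condExp_inner_of_stronglyMeasurable_left hY hX hXY),
    integral_condExp hm]

lemma integral_norm_sub_condExp_sq_le (hm : m ≤ mΩ) {X : Ω → E} (hX : MemLp X 2 P) :
    ∫ ω, ‖X ω - (P[X | m]) ω‖ ^ 2 ∂P ≤ ∫ ω, ‖X ω‖ ^ 2 ∂P := by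
  have hC : MemLp (P[X | m]) 2 P := hX.condExp one_le_two
  have hin := integrable_inner_of_memLp hC hX
  have hproj := integral_inner_condExp hm stronglyMeasurable_condExp (hX.integrable one_le_two) hin
  have hX2 := integrable_norm_sq hX
  have hexp : ∀ ω, ‖X ω - (P[X | m]) ω‖ ^ 2 =
      ‖X ω‖ ^ 2 - 2 * inner ℝ ((P[X | m]) ω) (X ω) + ‖(P[X | m]) ω‖ ^ 2 := fun ω => by
    rw [norm_sub_sq_real, real_inner_comm]
  simp only [real_inner_self_eq_norm_sq] at hproj
  have hsub : Integrable (fun ω => ‖X ω‖ ^ 2 - 2 * inner ℝ ((P[X | m]) ω) (X ω)) P :=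
    hX2.sub (hin.const_mul 2)
  simp only [hexp]
  rw [integral_add hsub (integrable_norm_sq hC), integral_sub hX2 (hin.const_mul 2),
    integral_const_mul, ← hproj]
  have : 0 ≤ ∫ ω, ‖(P[X | m]) ω‖ ^ 2 ∂P := integral_nonneg fun ω => by positivity
  linarith

lemma integral_norm_sum_sq_of_condExp_eq_zero (𝓕 : Filtration ℕ mΩ) {D : ℕ → Ω → E}
    (hD : ∀ i, StronglyMeasurable[𝓕 (i + 1)] (D i)) (hD2 : ∀ i, MemLp (D i) 2 P)
    (hD0 : ∀ i, P[D i | 𝓕 i] =ᵐ[P] 0) (t : ℕ) :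
    ∫ ω, ‖∑ i ∈ Finset.range t, D i ω‖ ^ 2 ∂P =
      ∑ i ∈ Finset.range t, ∫ ω, ‖D i ω‖ ^ 2 ∂P := by
  induction t with
  | zero => simp
  | succ t ih =>
    have hS : StronglyMeasurable[𝓕 t] fun ω => ∑ i ∈ Finset.range t, D i ω :=
      Finset.stronglyMeasurable_fun_sum _ fun i hi => (hD i).mono (𝓕.mono (Finset.mem_range.1 hi))
    have hS2 : MemLp (fun ω => ∑ i ∈ Finset.range t, D i ω) 2 P :=
      memLp_finsetSum _ fun i _ => hD2 i
    have hin := integrable_inner_of_memLp hS2 (hD2 t)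
    have horth : ∫ ω, inner ℝ (∑ i ∈ Finset.range t, D i ω) (D t ω) ∂P = 0 := by
      rw [← integral_inner_condExp (𝓕.le t) hS ((hD2 t).integrable one_le_two) hin,
        integral_congr_ae (g := fun _ => (0 : ℝ)), integral_zero]
      filter_upwards [hD0 t] with ω hω
      rw [hω, Pi.zero_apply, inner_zero_right]
    have hadd : Integrable (fun ω => ‖∑ i ∈ Finset.range t, D i ω‖ ^ 2 +
        2 * inner ℝ (∑ i ∈ Finset.range t, D i ω) (D t ω)) P :=
      (integrable_norm_sq hS2).add (hin.const_mul 2)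
    simp only [Finset.sum_range_succ, norm_add_sq_real]
    rw [integral_add hadd (integrable_norm_sq (hD2 t)),
      integral_add (integrable_norm_sq hS2) (hin.const_mul 2), integral_const_mul, horth, ih]
    ring

lemma condExp_smul_sub_condExp (hm : m ≤ mΩ) {X : Ω → E} (hX : Integrable X P) (c : ℝ) :
    P[fun ω => c • (X ω - (P[X | m]) ω) | m] =ᵐ[P] 0 := by
  have hsmul : P[fun ω => c • (X ω - (P[X | m]) ω) | m] =ᵐ[P] c • P[X - P[X | m] | m] :=
    condExp_smul c (X - P[X | m]) m
  have hsub := condExp_sub hX (integrable_condExp (μ := P) (f := X) (m := m)) m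
  have hidem : P[P[X | m] | m] = P[X | m] :=
    condExp_of_stronglyMeasurable hm stronglyMeasurable_condExp integrable_condExp
  filter_upwards [hsmul, hsub] with ω h1 h2
  rw [h1, Pi.smul_apply, h2, Pi.sub_apply, hidem, sub_self, smul_zero, Pi.zero_apply]

lemma lpNorm_sum_smul_sub_condExp_le (𝓕 : Filtration ℕ mΩ) {X : ℕ → Ω → E} (c : ℕ → ℝ)
    (hXm : ∀ i, StronglyMeasurable[𝓕 (i + 1)] (X i)) (hX : ∀ i, MemLp (X i) 2 P) (t : ℕ) :
    lpNorm (fun ω => ∑ i ∈ Finset.range t, c i • (X i ω - (P[X i | 𝓕 i]) ω)) 2 P ≤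
      √(∑ i ∈ Finset.range t, c i ^ 2 * ∫ ω, ‖X i ω‖ ^ 2 ∂P) := by
  rw [lpNorm_two_eq_sqrt (memLp_sum_smul_sub_condExp 𝓕 c hX t).aestronglyMeasurable]
  refine Real.sqrt_le_sqrt ?_
  refine (integral_norm_sum_sq_of_condExp_eq_zero 𝓕
    (D := fun i ω => c i • (X i ω - (P[X i | 𝓕 i]) ω))
    (fun i => ((hXm i).sub (stronglyMeasurable_condExp.mono (𝓕.mono i.le_succ))).const_smul (c i))
    (fun i => ((hX i).sub ((hX i).condExp one_le_two)).const_smul (c i))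
    (fun i => condExp_smul_sub_condExp (𝓕.le i) ((hX i).integrable one_le_two) (c i))
    t).trans_le (Finset.sum_le_sum fun i _ => ?_)
  simp only [norm_smul, mul_pow, Real.norm_eq_abs, sq_abs]
  rw [integral_const_mul]
  exact mul_le_mul_of_nonneg_left (integral_norm_sub_condExp_sq_le (𝓕.le i) (hX i)) (sq_nonneg _)

end CondExp

/-! ### One step of the fourth-moment recursion -/

section FourthMoment

lemma pow_three_mul_le {x b l : ℝ} (hl : 0 < l) :
    x ^ 3 * b ≤ 3 / 4 * l * x ^ 4 + l⁻¹ ^ 3 / 4 * b ^ 4 := by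
  have young : ∀ c : ℝ, 4 * x ^ 3 * c ≤ 3 * x ^ 4 + c ^ 4 := fun c => by
    have : 0 ≤ (x - c) ^ 2 * ((x + c) ^ 2 + 2 * x ^ 2) := by positivity
    nlinarith
  have hscaled := mul_le_mul_of_nonneg_left (young (b * l⁻¹)) hl.le
  have hlhs : l * (4 * x ^ 3 * (b * l⁻¹)) = 4 * (x ^ 3 * b) := by field_simp
  have hrhs : l * (3 * x ^ 4 + (b * l⁻¹) ^ 4) = 3 * l * x ^ 4 + l⁻¹ ^ 3 * b ^ 4 := by field_simp
  linarith

lemma two_mul_sq_mul_sq_le {x w c ε : ℝ} (hε : 0 < ε) :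
    2 * (x ^ 2 * (c * w ^ 2)) ≤ ε * x ^ 4 + c ^ 2 / ε * w ^ 4 := by
  have hsq : 0 ≤ (ε * x ^ 2 - c * w ^ 2) ^ 2 / ε := by positivity
  have hexp : (ε * x ^ 2 - c * w ^ 2) ^ 2 / ε =
      ε * x ^ 4 + c ^ 2 / ε * w ^ 4 - 2 * (x ^ 2 * (c * w ^ 2)) := by
    field_simp; ring
  linarith

lemma norm_add_pow_four_le {E : Type*} [SeminormedAddGroup E] (a b : E) :
    ‖a + b‖ ^ 4 ≤ 8 * (‖a‖ ^ 4 + ‖b‖ ^ 4) :=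
  calc ‖a + b‖ ^ 4 ≤ (‖a‖ + ‖b‖) ^ 4 := by gcongr; exact norm_add_le a b
    _ ≤ 2 ^ (4 - 1) * (‖a‖ ^ 4 + ‖b‖ ^ 4) := add_pow_le (norm_nonneg a) (norm_nonneg b) 4
    _ = 8 * (‖a‖ ^ 4 + ‖b‖ ^ 4) := by norm_num

variable {E : Type*} [NormedAddCommGroup E] [InnerProductSpace ℝ E]

lemma inner_norm_sq_smul (x y : E) : inner ℝ (‖x‖ ^ 2 • x) y = ‖x‖ ^ 2 * inner ℝ x y :=
  real_inner_smul_left x y _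

lemma norm_sub_smul_pow_four_le (x G : E) {γ : ℝ} (hγ : 0 ≤ γ) :
    ‖x - γ • G‖ ^ 4 ≤ ‖x‖ ^ 4 - 4 * γ * inner ℝ (‖x‖ ^ 2 • x) G +
      8 * γ ^ 2 * (‖x‖ ^ 2 * ‖G‖ ^ 2) + 3 * γ ^ 4 * ‖G‖ ^ 4 := by
  have hsq : ‖x - γ • G‖ ^ 2 = ‖x‖ ^ 2 - 2 * γ * inner ℝ x G + γ ^ 2 * ‖G‖ ^ 2 := by
    rw [norm_sub_sq_real, inner_smul_right, norm_smul, Real.norm_of_nonneg hγ]; ring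
  have habs := abs_real_inner_le_norm x G
  have hinner_sq : inner ℝ x G ^ 2 ≤ ‖x‖ ^ 2 * ‖G‖ ^ 2 := by
    rw [← mul_pow, ← sq_abs]; gcongr
  have hsecond : 4 * γ ^ 2 * inner ℝ x G ^ 2 ≤ 4 * γ ^ 2 * (‖x‖ ^ 2 * ‖G‖ ^ 2) := by gcongr
  have hthird : 4 * γ ^ 3 * ‖G‖ ^ 2 * -inner ℝ x G ≤ 4 * γ ^ 3 * ‖G‖ ^ 2 * (‖x‖ * ‖G‖) := by
    gcongr; linarith [(abs_le.1 habs).1]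
  have hfourth : 0 ≤ 2 * γ ^ 2 * ‖G‖ ^ 2 * (‖x‖ - γ * ‖G‖) ^ 2 := by positivity
  rw [show ‖x - γ • G‖ ^ 4 = (‖x - γ • G‖ ^ 2) ^ 2 by ring, hsq, inner_norm_sq_smul]
  linarith

lemma norm_sub_smul_pow_four_le_add (x G H : E) {γ ε : ℝ} (hγ : 0 ≤ γ) (hε : 0 < ε) :
    ‖x - γ • G‖ ^ 4 ≤ (1 + 8 * γ ^ 2 + 8 * γ * ε) * ‖x‖ ^ 4 -
      4 * γ * inner ℝ (‖x‖ ^ 2 • x) G + (8 * γ ^ 2 + 24 * γ ^ 4) * ‖G - H‖ ^ 4 +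
      (8 * γ ^ 3 / ε + 24 * γ ^ 4) * ‖H‖ ^ 4 := by
  have hG4 : ‖G‖ ^ 4 ≤ 8 * (‖G - H‖ ^ 4 + ‖H‖ ^ 4) := by
    simpa using norm_add_pow_four_le (G - H) H
  have hG2 : ‖G‖ ^ 2 ≤ 2 * ‖G - H‖ ^ 2 + 2 * ‖H‖ ^ 2 := by
    have : ‖G‖ ≤ ‖G - H‖ + ‖H‖ := by simpa using norm_add_le (G - H) H
    nlinarith [sq_nonneg (‖G - H‖ - ‖H‖), norm_nonneg G]
  have hcross : 8 * γ ^ 2 * (‖x‖ ^ 2 * ‖G‖ ^ 2) ≤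
      8 * γ ^ 2 * (‖x‖ ^ 4 + ‖G - H‖ ^ 4) + 8 * γ * (ε * ‖x‖ ^ 4 + γ ^ 2 / ε * ‖H‖ ^ 4) := by
    calc 8 * γ ^ 2 * (‖x‖ ^ 2 * ‖G‖ ^ 2)
        ≤ 8 * γ ^ 2 * (‖x‖ ^ 2 * (2 * ‖G - H‖ ^ 2 + 2 * ‖H‖ ^ 2)) := by gcongr
      _ = 8 * γ ^ 2 * (2 * (‖x‖ ^ 2 * ‖G - H‖ ^ 2)) +
          8 * γ * (2 * (‖x‖ ^ 2 * (γ * ‖H‖ ^ 2))) := by ring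
      _ ≤ _ := by
          gcongr
          · nlinarith [sq_nonneg (‖x‖ ^ 2 - ‖G - H‖ ^ 2)]
          · exact two_mul_sq_mul_sq_le hε
  have hlast : 3 * γ ^ 4 * ‖G‖ ^ 4 ≤ 3 * γ ^ 4 * (8 * (‖G - H‖ ^ 4 + ‖H‖ ^ 4)) := by gcongr
  refine (norm_sub_smul_pow_four_le x G hγ).trans ?_
  calc _ ≤ ‖x‖ ^ 4 - 4 * γ * inner ℝ (‖x‖ ^ 2 • x) G +
        (8 * γ ^ 2 * (‖x‖ ^ 4 + ‖G - H‖ ^ 4) + 8 * γ * (ε * ‖x‖ ^ 4 + γ ^ 2 / ε * ‖H‖ ^ 4)) +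
        3 * γ ^ 4 * (8 * (‖G - H‖ ^ 4 + ‖H‖ ^ 4)) := by gcongr
    _ = _ := by ring

lemma le_inner_norm_sq_smul {x y z : E} {a l : ℝ} (hl : 0 < l)
    (hz : a * ‖x‖ ^ 2 ≤ inner ℝ x z) :
    (a - 3 / 4 * l) * ‖x‖ ^ 4 - l⁻¹ ^ 3 / 4 * ‖y - z‖ ^ 4 ≤ inner ℝ (‖x‖ ^ 2 • x) y := by
  have hdrift := mul_le_mul_of_nonneg_left hz (sq_nonneg ‖x‖)
  have hbias := mul_le_mul_of_nonneg_left (abs_le.1 (abs_real_inner_le_norm x (y - z))).1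
    (sq_nonneg ‖x‖)
  have hyoung := pow_three_mul_le (x := ‖x‖) (b := ‖y - z‖) hl
  calc (a - 3 / 4 * l) * ‖x‖ ^ 4 - l⁻¹ ^ 3 / 4 * ‖y - z‖ ^ 4
      ≤ ‖x‖ ^ 2 * inner ℝ x z + ‖x‖ ^ 2 * inner ℝ x (y - z) := by linarith
    _ = inner ℝ (‖x‖ ^ 2 • x) y := by rw [inner_norm_sq_smul, inner_sub_right]; ring

variable {Ω : Type*} {m mΩ : MeasurableSpace Ω} {P : Measure Ω}

lemma integrable_inner_norm_sq_smul {x G : Ω → E} (hx : MemLp x 4 P) (hG : MemLp G 4 P) :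
    Integrable (fun ω => inner ℝ (‖x ω‖ ^ 2 • x ω) (G ω)) P := by
  refine ((integrable_norm_pow_four hx).add (integrable_norm_pow_four hG)).mono'
    (((hx.aestronglyMeasurable.norm.pow 2).smul hx.aestronglyMeasurable).inner
      hG.aestronglyMeasurable) (ae_of_all _ fun ω => ?_)
  have hyoung := pow_three_mul_le (x := ‖x ω‖) (b := ‖G ω‖) one_pos
  calc ‖inner ℝ (‖x ω‖ ^ 2 • x ω) (G ω)‖ ≤ ‖‖x ω‖ ^ 2 • x ω‖ * ‖G ω‖ := norm_inner_le_norm _ _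
    _ = ‖x ω‖ ^ 3 * ‖G ω‖ := by rw [norm_smul, norm_pow, norm_norm]; ring
    _ ≤ ‖x ω‖ ^ 4 + ‖G ω‖ ^ 4 := by
        have : 0 ≤ ‖x ω‖ ^ 4 := by positivity
        have : 0 ≤ ‖G ω‖ ^ 4 := by positivity
        norm_num at hyoung
        linarith

variable [CompleteSpace E] [IsFiniteMeasure P]

lemma le_integral_inner_norm_sq_smul (hm : m ≤ mΩ) {x G N : Ω → E} {ε a v B : ℝ}
    (hε : 0 < ε) (hv : 0 ≤ v) (hxm : StronglyMeasurable[m] x) (hx : MemLp x 4 P)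
    (hG : MemLp G 4 P) (hN : ∀ ω, a * ‖x ω‖ ^ 2 ≤ inner ℝ (x ω) (N ω))
    (hint : Integrable (fun ω => ‖(P[G | m]) ω - N ω‖ ^ 4) P)
    (hbias : ∫ ω, ‖(P[G | m]) ω - N ω‖ ^ 4 ∂P ≤ v ^ 4 * ∫ ω, ‖x ω‖ ^ 4 ∂P + B ^ 4) :
    (a - (v + ε)) * ∫ ω, ‖x ω‖ ^ 4 ∂P - ε⁻¹ ^ 3 / 4 * B ^ 4 ≤
      ∫ ω, inner ℝ (‖x ω‖ ^ 2 • x ω) (G ω) ∂P := by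
  have hΔ : 0 ≤ ∫ ω, ‖x ω‖ ^ 4 ∂P := integral_nonneg fun ω => by positivity
  set Δ := ∫ ω, ‖x ω‖ ^ 4 ∂P
  have hl : 0 < v + ε := by positivity
  have hx4 := integrable_norm_pow_four hx
  have hYm : StronglyMeasurable[m] fun ω => ‖x ω‖ ^ 2 • x ω := (hxm.norm.pow 2).smul hxm
  have hin := integrable_inner_norm_sq_smul hx hG
  have hGi : Integrable G P := hG.integrable (by norm_num)
  have hlow : (a - 3 / 4 * (v + ε)) * Δ -
      (v + ε)⁻¹ ^ 3 / 4 * ∫ ω, ‖(P[G | m]) ω - N ω‖ ^ 4 ∂P ≤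
      ∫ ω, inner ℝ (‖x ω‖ ^ 2 • x ω) (G ω) ∂P := by
    rw [← integral_inner_condExp hm hYm hGi hin, ← integral_const_mul, ← integral_const_mul,
      ← integral_sub (hx4.const_mul _) (hint.const_mul _)]
    exact integral_mono ((hx4.const_mul _).sub (hint.const_mul _))
      (integrable_condExp.congr (condExp_inner_of_stronglyMeasurable_left hYm hGi hin))
      fun ω => le_inner_norm_sq_smul hl (hN ω)
  have hmain : (v + ε)⁻¹ ^ 3 * v ^ 4 ≤ v + ε :=
    calc (v + ε)⁻¹ ^ 3 * v ^ 4 ≤ (v + ε)⁻¹ ^ 3 * (v + ε) ^ 4 := by gcongr; linarith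
      _ = v + ε := by field_simp
  have hconst : (v + ε)⁻¹ ^ 3 * B ^ 4 ≤ ε⁻¹ ^ 3 * B ^ 4 := by
    gcongr
    exact le_add_of_nonneg_left hv
  have hb := mul_le_mul_of_nonneg_left hbias (by positivity : 0 ≤ (v + ε)⁻¹ ^ 3 / 4)
  have := mul_le_mul_of_nonneg_right hmain hΔ
  linarith

lemma fourth_moment_step (hm : m ≤ mΩ) {x y G H N : Ω → E} {γ ε a v B κ s : ℝ}
    (hγ : 0 ≤ γ) (hε : 0 < ε) (hv : 0 ≤ v)
    (hxm : StronglyMeasurable[m] x) (hx : MemLp x 4 P) (hG : MemLp G 4 P) (hH : MemLp H 4 P)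
    (hN : ∀ ω, a * ‖x ω‖ ^ 2 ≤ inner ℝ (x ω) (N ω))
    (hint : Integrable (fun ω => ‖(P[G | m]) ω - N ω‖ ^ 4) P)
    (hbias : ∫ ω, ‖(P[G | m]) ω - N ω‖ ^ 4 ∂P ≤ v ^ 4 * ∫ ω, ‖x ω‖ ^ 4 ∂P + B ^ 4)
    (hκ : ∫ ω, ‖G ω - H ω‖ ^ 4 ∂P ≤ κ ^ 4 * ∫ ω, ‖x ω‖ ^ 4 ∂P)
    (hs : ∫ ω, ‖H ω‖ ^ 4 ∂P ≤ s ^ 4)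
    (hy : MemLp y 4 P) (hyx : ∀ ω, ‖y ω‖ ≤ ‖x ω - γ • G ω‖) :
    ∫ ω, ‖y ω‖ ^ 4 ∂P ≤
      (1 - γ * (4 * a - 4 * v - 12 * ε) + 8 * γ ^ 2 * (1 + κ ^ 4) + 24 * γ ^ 4 * κ ^ 4) *
        ∫ ω, ‖x ω‖ ^ 4 ∂P +
      (γ * (ε⁻¹ ^ 3 * B ^ 4) + 8 * γ ^ 3 * s ^ 4 / ε + 24 * γ ^ 4 * s ^ 4) := by
  have hx4 := (integrable_norm_pow_four hx).const_mul (1 + 8 * γ ^ 2 + 8 * γ * ε)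
  have hin := (integrable_inner_norm_sq_smul hx hG).const_mul (4 * γ)
  have hGH4 := (integrable_norm_pow_four (hG.sub hH)).const_mul (8 * γ ^ 2 + 24 * γ ^ 4)
  have hH4 := (integrable_norm_pow_four hH).const_mul (8 * γ ^ 3 / ε + 24 * γ ^ 4)
  have hstep := integral_mono (integrable_norm_pow_four hy) (((hx4.sub hin).add hGH4).add hH4)
    fun ω => (pow_le_pow_left₀ (norm_nonneg _) (hyx ω) 4).trans
      (norm_sub_smul_pow_four_le_add (x ω) (G ω) (H ω) hγ hε)
  rw [integral_add' ((hx4.sub hin).add hGH4) hH4, integral_add' (hx4.sub hin) hGH4,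
    integral_sub' hx4 hin] at hstep
  simp only [Pi.sub_apply, integral_const_mul] at hstep
  have hdrift := mul_le_mul_of_nonneg_left
    (le_integral_inner_norm_sq_smul hm hε hv hxm hx hG hN hint hbias) (by positivity : 0 ≤ 4 * γ)
  have hκ' := mul_le_mul_of_nonneg_left hκ (by positivity : 0 ≤ 8 * γ ^ 2 + 24 * γ ^ 4)
  have hs' := mul_le_mul_of_nonneg_left hs (by positivity : 0 ≤ 8 * γ ^ 3 / ε + 24 * γ ^ 4)
  have : 8 * γ ^ 3 * s ^ 4 / ε = 8 * γ ^ 3 / ε * s ^ 4 := by ring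
  linarith

end FourthMoment

/-! ### Second-order calculus at a minimizer -/

section Calculus

variable {E : Type*} [NormedAddCommGroup E] [InnerProductSpace ℝ E] [CompleteSpace E]
  {F : E → ℝ} {x : E}

lemma two_mul_le_of_eventually_sub_mul_add_le {f f' : ℝ → ℝ} {c h : ℝ}
    (hf : ∀ s, HasDerivAt f (f' s) s) (hf' : HasDerivAt f' h 0) (h0 : f' 0 = 0)
    (hle : ∀ᶠ s in 𝓝 0, f s - s * f' s + c * s ^ 2 ≤ f 0) : 2 * c ≤ h := by
  have hfirst : (fun s => f' s - h * s) =o[𝓝 0] fun s => s := by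
    simpa [h0, mul_comm] using hasDerivAt_iff_isLittleO_nhds_zero.1 hf'
  have hsecond : (fun s => f s - h / 2 * s ^ 2 - f 0) =o[𝓝 0] fun s => s ^ 2 := by
    have hderiv (s : ℝ) : HasDerivAt (fun s => f s - h / 2 * s ^ 2) (f' s - h * s) s :=
      ((hf s).sub ((hasDerivAt_pow 2 s).const_mul (h / 2))).congr_deriv (by push_cast; ring)
    simpa using convex_univ.isLittleO_pow_succ_real (x₀ := (0 : ℝ)) (n := 1) (Set.mem_univ _)
      (fun s _ => (hderiv s).hasDerivWithinAt) (by simpa using hfirst)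
  have hbound : (fun s => s * (f' s - h * s) - (f s - h / 2 * s ^ 2 - f 0)) =o[𝓝 0]
      fun s => s ^ 2 := by
    refine .sub ?_ hsecond
    simpa only [sq] using (Asymptotics.isBigO_refl (fun s : ℝ => s) _).mul_isLittleO hfirst
  by_contra! hlt
  obtain ⟨s, ⟨hs, hles⟩, hs0⟩ := ((((hbound.def (c := (c - h / 2) / 2) (by linarith)).and
    hle).filter_mono nhdsWithin_le_nhds).and (self_mem_nhdsWithin (s := Set.Ioi 0))).exists
  have hpos : 0 < (c - h / 2) * s ^ 2 := mul_pos (by linarith) (pow_pos hs0 2)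
  rw [Real.norm_eq_abs, Real.norm_of_nonneg (sq_nonneg s)] at hs
  nlinarith [(abs_le.1 hs).2]

lemma mul_norm_sq_le_inner_fderiv_gradient (hF : Differentiable ℝ F) (hx : gradient F x = 0)
    (h2 : DifferentiableAt ℝ (gradient F) x) {c : ℝ}
    (hconv : ∀ᶠ y in 𝓝 x, F y + inner ℝ (gradient F y) (x - y) + c / 2 * ‖x - y‖ ^ 2 ≤ F x)
    (v : E) : c * ‖v‖ ^ 2 ≤ inner ℝ (fderiv ℝ (gradient F) x v) v := by
  have hline (s : ℝ) : HasDerivAt (fun s : ℝ => x + s • v) v s := by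
    simpa using ((hasDerivAt_id s).smul_const v).const_add x
  have hf (s : ℝ) : HasDerivAt (fun s => F (x + s • v)) (inner ℝ (gradient F (x + s • v)) v) s := by
    have h := (hF (x + s • v)).hasGradientAt.hasFDerivAt.comp_hasDerivAt s (hline s)
    rwa [InnerProductSpace.toDual_apply_apply] at h
  have hf' : HasDerivAt (fun s : ℝ => inner ℝ (gradient F (x + s • v)) v)
      (inner ℝ (fderiv ℝ (gradient F) x v) v) 0 := by
    have h2' : HasFDerivAt (gradient F) (fderiv ℝ (gradient F) x) (x + (0 : ℝ) • v) := by
      simpa using h2.hasFDerivAt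
    simpa using (h2'.comp_hasDerivAt 0 (hline 0)).inner ℝ (hasDerivAt_const (0 : ℝ) v)
  have htend : Tendsto (fun s : ℝ => x + s • v) (𝓝 0) (𝓝 x) := by
    simpa using (hline 0).continuousAt.tendsto
  have hle : ∀ᶠ s : ℝ in 𝓝 0, F (x + s • v) - s * inner ℝ (gradient F (x + s • v)) v +
      c / 2 * ‖v‖ ^ 2 * s ^ 2 ≤ F (x + (0 : ℝ) • v) := by
    filter_upwards [htend.eventually hconv] with s hs
    have hneg : x - (x + s • v) = -(s • v) := by abel
    rw [hneg, inner_neg_right, inner_smul_right, norm_neg, norm_smul, mul_pow, Real.norm_eq_abs,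
      sq_abs] at hs
    simp only [zero_smul, add_zero]
    linarith
  linarith [two_mul_le_of_eventually_sub_mul_add_le hf hf' (by simp [hx]) hle]

lemma inner_fderiv_gradient_comm (hF : Differentiable ℝ F)
    (h2 : DifferentiableAt ℝ (gradient F) x) (v w : E) :
    inner ℝ (fderiv ℝ (gradient F) x v) w = inner ℝ (fderiv ℝ (gradient F) x w) v :=
  second_derivative_symmetric (f := F) (f' := fun y => innerSL ℝ (gradient F y))
    (f'' := (innerSL ℝ).comp (fderiv ℝ (gradient F) x))
    (fun y => (hF y).hasGradientAt.hasFDerivAt)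
    ((innerSL ℝ : E →L[ℝ] E →L[ℝ] ℝ).hasFDerivAt.comp x h2.hasFDerivAt) v w

end Calculus

/-! ### Symmetric positive definite matrices -/

section Matrices

open Matrix

variable {n : Type*} [Fintype n] {K M S : Matrix n n ℝ}

lemma trace_mul_mul_nonneg (hK : K.IsHermitian) (hS : S.PosSemidef) :
    0 ≤ (K * S * K).trace := by
  simpa only [hK.eq] using (hS.mul_mul_conjTranspose_same K).trace_nonneg

variable [DecidableEq n]

lemma trace_mul_vecMulVec_mul (hK : K.IsHermitian) (v : n → ℝ) :
    (K * vecMulVec v v * K).trace = ‖toEuclideanCLM (𝕜 := ℝ) K (WithLp.toLp 2 v)‖ ^ 2 := by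
  have hKt : Kᵀ = K := by simpa only [conjTranspose_eq_transpose_of_trivial] using hK.eq
  rw [mul_vecMulVec, vecMulVec_mul, trace_vecMulVec, ← mulVec_transpose, hKt,
    EuclideanSpace.norm_sq_eq]
  simp [dotProduct, sq, toEuclideanCLM_toLp]

lemma trace_mul_mul_le (hK : K.IsHermitian) (hS : S.PosSemidef) {c : ℝ}
    (hc : ∀ v, ‖toEuclideanCLM (𝕜 := ℝ) K v‖ ≤ c * ‖v‖) :
    (K * S * K).trace ≤ c ^ 2 * S.trace := by
  obtain ⟨m, v, rfl⟩ := posSemidef_iff_eq_sum_vecMulVec.1 hS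
  simp only [star_trivial, Finset.mul_sum, Finset.sum_mul, trace_sum]
  refine Finset.sum_le_sum fun i _ => ?_
  rw [trace_mul_vecMulVec_mul hK, trace_vecMulVec]
  have h := pow_le_pow_left₀ (norm_nonneg _) (hc (WithLp.toLp 2 (v i))) 2
  rw [mul_pow, EuclideanSpace.norm_sq_eq (WithLp.toLp 2 (v i))] at h
  simpa [dotProduct, sq] using h

lemma isHermitian_of_inner_toEuclideanCLM_comm
    (h : ∀ v w, inner ℝ (toEuclideanCLM (𝕜 := ℝ) M v) w =
      inner ℝ (toEuclideanCLM (𝕜 := ℝ) M w) v) : M.IsHermitian := by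
  ext i j
  simpa [EuclideanSpace.inner_single_right, ofLp_toEuclideanCLM, mulVec_single] using
    h (EuclideanSpace.single i 1) (EuclideanSpace.single j 1)

lemma posDef_of_coercive (hM : M.IsHermitian) {c : ℝ} (hc : 0 < c)
    (h : ∀ v, c * ‖v‖ ^ 2 ≤ inner ℝ (toEuclideanCLM (𝕜 := ℝ) M v) v) : M.PosDef := by
  refine .of_dotProduct_mulVec_pos hM fun {v} hv => ?_
  have hpos : 0 < c * ‖WithLp.toLp 2 v‖ ^ 2 :=
    mul_pos hc (pow_pos (norm_pos_iff.2 fun h0 => hv (by simpa using h0)) 2)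
  simpa [EuclideanSpace.inner_eq_star_dotProduct, ofLp_toEuclideanCLM] using
    hpos.trans_le (h (WithLp.toLp 2 v))

lemma toEuclideanCLM_inv_apply (hM : IsUnit M.det) (v : EuclideanSpace ℝ n) :
    toEuclideanCLM (𝕜 := ℝ) M⁻¹ (toEuclideanCLM (𝕜 := ℝ) M v) = v := by
  rw [← mul_apply_eq_comp, ← map_mul, nonsing_inv_mul _ hM, map_one,
    one_apply_eq_self]

lemma norm_toEuclideanCLM_inv_le (hM : IsUnit M.det) {c : ℝ} (hc : 0 < c)
    (h : ∀ v, c * ‖v‖ ^ 2 ≤ inner ℝ (toEuclideanCLM (𝕜 := ℝ) M v) v)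
    (v : EuclideanSpace ℝ n) : ‖toEuclideanCLM (𝕜 := ℝ) M⁻¹ v‖ ≤ c⁻¹ * ‖v‖ := by
  set w := toEuclideanCLM (𝕜 := ℝ) M⁻¹ v
  have hMw : toEuclideanCLM (𝕜 := ℝ) M w = v := by
    rw [← mul_apply_eq_comp, ← map_mul, mul_nonsing_inv _ hM, map_one,
      one_apply_eq_self]
  have hle : ‖w‖ * (c * ‖w‖) ≤ ‖w‖ * ‖v‖ := by
    have := (h w).trans (real_inner_le_norm _ _)
    rw [hMw] at this
    linarith
  rw [inv_mul_eq_div, le_div_iff₀' hc]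
  rcases (norm_nonneg w).eq_or_lt with hw | hw
  · rw [← hw, mul_zero]
    exact norm_nonneg v
  · exact le_of_mul_le_mul_left hle hw

lemma integral_norm_toEuclideanCLM_sq {Ω : Type*} {mΩ : MeasurableSpace Ω} {P : Measure Ω}
    (hK : K.IsHermitian) {X : Ω → EuclideanSpace ℝ n} (hX : MemLp X 2 P) :
    ∫ ω, ‖toEuclideanCLM (𝕜 := ℝ) K (X ω)‖ ^ 2 ∂P =
      (K * Matrix.of (fun i j => ∫ ω, X ω i * X ω j ∂P) * K).trace := by
  have htrace (T : Matrix n n ℝ) : (K * T * K).trace = ∑ i, ∑ j, T i j * (K * K) j i := by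
    rw [Matrix.mul_assoc, trace_mul_comm, Matrix.mul_assoc]
    rfl
  have hnorm (ω : Ω) : ‖toEuclideanCLM (𝕜 := ℝ) K (X ω)‖ ^ 2 =
      ∑ i, ∑ j, X ω i * X ω j * (K * K) j i :=
    (trace_mul_vecMulVec_mul hK (X ω).ofLp).symm.trans (htrace _)
  have hcoord (i : n) : MemLp (fun ω => X ω i) 2 P :=
    hX.of_le ((EuclideanSpace.proj (𝕜 := ℝ) i).continuous.comp_aestronglyMeasurable
      hX.aestronglyMeasurable) (Eventually.of_forall fun ω => PiLp.norm_apply_le (X ω) i)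
  have hint (i j : n) : Integrable (fun ω => X ω i * X ω j * (K * K) j i) P :=
    ((hcoord i).integrable_mul (hcoord j)).mul_const _
  simp only [hnorm]
  rw [htrace, integral_finsetSum _ fun i _ => integrable_finsetSum _ fun j _ => hint i j]
  refine Finset.sum_congr rfl fun i _ => ?_
  rw [integral_finsetSum _ fun j _ => hint i j]
  exact Finset.sum_congr rfl fun j _ => integral_mul_const _ _

end Matrices

/-! ### The Hessian of a quasi-strongly convex function at its minimizer -/

section Hessian

open Matrix

variable {d : ℕ} {p : Params} {Θ : Set (EuclideanSpace ℝ (Fin d))}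
  {F : EuclideanSpace ℝ (Fin d) → ℝ} {θs : EuclideanSpace ℝ (Fin d)}

lemma toEuclideanCLM_hessianMatrix (F : EuclideanSpace ℝ (Fin d) → ℝ)
    (θ v : EuclideanSpace ℝ (Fin d)) :
    toEuclideanCLM (𝕜 := ℝ) (hessianMatrix F θ) v = fderiv ℝ (gradient F) θ v := by
  have hv : v = ∑ j, v j • EuclideanSpace.single j (1 : ℝ) := by
    ext i
    simp [Finset.sum_apply, Pi.single_apply]
  ext i
  rw [ofLp_toEuclideanCLM]
  conv_rhs => rw [hv, map_sum]
  simp [mulVec, dotProduct, hessianMatrix, mul_comm]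

lemma QuasiStronglyConvex.le_inner (hF : QuasiStronglyConvex p Θ F θs)
    (hmin : ∀ η, F θs ≤ F η) {θ : EuclideanSpace ℝ (Fin d)} (hθ : θ ∈ Θ) :
    p.mu / 2 * ‖θ - θs‖ ^ 2 ≤ inner ℝ (θ - θs) (gradient F θ) := by
  have h := hF.le θ hθ
  rw [← neg_sub θ θs, inner_neg_right, norm_neg, real_inner_comm] at h
  linarith [hmin θ]

lemma Smooth.norm_gradient_sub_le (hS : Smooth p Θ F θs) (hΘ : Convex ℝ Θ) (hs : θs ∈ Θ)
    (h0 : gradient F θs = 0) {θ : EuclideanSpace ℝ (Fin d)} (hθ : θ ∈ Θ) (hC : 0 ≤ p.Chess) :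
    ‖gradient F θ - fderiv ℝ (gradient F) θs (θ - θs)‖ ≤ p.Chess * ‖θ - θs‖ ^ 2 := by
  have h := Convex.norm_image_sub_le_of_norm_fderiv_le' (𝕜 := ℝ) (f := gradient F)
    (s := Θ ∩ Metric.closedBall θs ‖θ - θs‖) (C := p.Chess * ‖θ - θs‖)
    (φ := fderiv ℝ (gradient F) θs) (x := θs) (y := θ)
    (fun x hx => hS.twice_differentiable x hx.1)
    (fun x hx => (hS.hessian_lipschitz x hx.1).trans
      (mul_le_mul_of_nonneg_left (by simpa [dist_eq_norm] using hx.2) hC))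
    (hΘ.inter (convex_closedBall _ _)) ⟨hs, by simp⟩ ⟨hθ, by simp [dist_eq_norm]⟩
  rwa [h0, sub_zero, mul_assoc, ← sq] at h

lemma QuasiStronglyConvex.mul_norm_sq_le_inner_hessianMatrix
    (hF : QuasiStronglyConvex p Θ F θs) (hint : θs ∈ interior Θ)
    (h2 : DifferentiableAt ℝ (gradient F) θs) (v : EuclideanSpace ℝ (Fin d)) :
    p.mu * ‖v‖ ^ 2 ≤ inner ℝ (toEuclideanCLM (𝕜 := ℝ) (hessianMatrix F θs) v) v := by
  rw [toEuclideanCLM_hessianMatrix]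
  exact mul_norm_sq_le_inner_fderiv_gradient hF.differentiable hF.gradient_eq_zero h2
    (eventually_of_mem (mem_interior_iff_mem_nhds.1 hint) hF.le) v

lemma QuasiStronglyConvex.posDef_hessianMatrix (hF : QuasiStronglyConvex p Θ F θs)
    (hmu : 0 < p.mu) (hint : θs ∈ interior Θ) (h2 : DifferentiableAt ℝ (gradient F) θs) :
    (hessianMatrix F θs).PosDef := by
  refine posDef_of_coercive (isHermitian_of_inner_toEuclideanCLM_comm fun v w => ?_) hmu
    (hF.mul_norm_sq_le_inner_hessianMatrix hint h2)
  simpa only [toEuclideanCLM_hessianMatrix] using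
    inner_fderiv_gradient_comm hF.differentiable h2 v w

end Hessian

/-! ### Projections and measurability -/

section Projection

variable {d : ℕ} {Θ : Set (EuclideanSpace ℝ (Fin d))} {x y x' y' z : EuclideanSpace ℝ (Fin d)}

lemma isProjection_iff_norm_eq_iInf (hy : y ∈ Θ) :
    IsProjection Θ x y ↔ ‖x - y‖ = ⨅ w : Θ, ‖x - w‖ := by
  have hbdd : BddBelow (Set.range fun w : Θ => ‖x - w‖) :=
    ⟨0, Set.forall_mem_range.2 fun _ => norm_nonneg _⟩
  have : Nonempty Θ := ⟨⟨y, hy⟩⟩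
  refine ⟨fun h => le_antisymm (le_ciInf fun w => h.2 w w.2) (ciInf_le hbdd ⟨y, hy⟩),
    fun h => ⟨hy, fun w hw => h.trans_le (ciInf_le hbdd ⟨w, hw⟩)⟩⟩

lemma IsProjection.inner_le (hΘ : Convex ℝ Θ) (h : IsProjection Θ x y) (hz : z ∈ Θ) :
    inner ℝ (x - y) (z - y) ≤ 0 :=
  (norm_eq_iInf_iff_real_inner_le_zero hΘ h.1).1 ((isProjection_iff_norm_eq_iInf h.1).1 h) z hz

lemma IsProjection.norm_sub_le (hΘ : Convex ℝ Θ) (h : IsProjection Θ x y)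
    (h' : IsProjection Θ x' y') : ‖y - y'‖ ≤ ‖x - x'‖ := by
  have hy' := h.inner_le hΘ h'.1
  have hy := h'.inner_le hΘ h.1
  have hexp : inner ℝ (x - x') (y - y') =
      ‖y - y'‖ ^ 2 - inner ℝ (x - y) (y' - y) - inner ℝ (x' - y') (y - y') := by
    rw [← neg_sub y y', inner_neg_right, ← real_inner_self_eq_norm_sq]
    simp only [inner_sub_left]
    ring
  have hmul : ‖y - y'‖ * ‖y - y'‖ ≤ ‖x - x'‖ * ‖y - y'‖ := by
    nlinarith [real_inner_le_norm (x - x') (y - y')]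
  rcases (norm_nonneg (y - y')).eq_or_lt with h0 | h0
  · rw [← h0]
    exact norm_nonneg _
  · exact le_of_mul_le_mul_right hmul h0

lemma isProjection_self (hx : x ∈ Θ) : IsProjection Θ x x :=
  ⟨hx, fun z _ => by simp⟩

lemma IsProjection.mem_frontier (hΘ : Convex ℝ Θ) (h : IsProjection Θ x y) (hne : y ≠ x) :
    y ∈ frontier Θ := by
  refine ⟨subset_closure h.1, fun hint => ?_⟩
  have htend : Tendsto (fun s : ℝ => y + s • (x - y)) (𝓝[>] 0) (𝓝 y) := by
    have : Continuous fun s : ℝ => y + s • (x - y) := by fun_prop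
    simpa using (this.tendsto 0).mono_left nhdsWithin_le_nhds
  obtain ⟨s, hs, hs0 : 0 < s⟩ := ((htend.eventually (mem_interior_iff_mem_nhds.1 hint)).and
    self_mem_nhdsWithin).exists
  have hle := h.inner_le hΘ hs
  rw [add_sub_cancel_left, inner_smul_right, real_inner_self_eq_norm_sq] at hle
  exact hle.not_gt (mul_pos hs0 (pow_pos (norm_pos_iff.2 (sub_ne_zero.2 hne.symm)) 2))

lemma measurable_of_isProjection (hΘ : Convex ℝ Θ) (hcl : IsClosed Θ) {Ω : Type*}
    {m : MeasurableSpace Ω} {X Y : Ω → EuclideanSpace ℝ (Fin d)} (hX : Measurable X)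
    (h : ∀ ω, IsProjection Θ (X ω) (Y ω)) : Measurable Y := by
  rcases isEmpty_or_nonempty Ω with hΩ | ⟨⟨ω₀⟩⟩
  · exact measurable_of_empty Y
  have hex (u : EuclideanSpace ℝ (Fin d)) : ∃ v, IsProjection Θ u v := by
    obtain ⟨v, hv, he⟩ :=
      exists_norm_eq_iInf_of_complete_convex ⟨Y ω₀, (h ω₀).1⟩ hcl.isComplete hΘ u
    exact ⟨v, (isProjection_iff_norm_eq_iInf hv).2 he⟩
  choose π hπ using hex
  have hlip : LipschitzWith 1 π := LipschitzWith.of_dist_le_mul fun u v => by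
    simpa [dist_eq_norm] using (hπ u).norm_sub_le hΘ (hπ v)
  have hY : Y = π ∘ X := by
    funext ω
    simpa [sub_eq_zero] using (h ω).norm_sub_le hΘ (hπ (X ω))
  rw [hY]
  exact hlip.continuous.measurable.comp hX

end Projection

section Measurability

variable {Ω : Type*} {m : MeasurableSpace Ω}

lemma measurable_apply_of_continuous {E : Type*} [TopologicalSpace E]
    [TopologicalSpace.MetrizableSpace E] [MeasurableSpace E] [SecondCountableTopology E]
    [OpensMeasurableSpace E] {u : Ω → E → ℝ}
    (hc : ∀ ω, Continuous (u ω)) (hu : ∀ η, Measurable fun ω => u ω η) {ϑ : Ω → E}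
    (hϑ : Measurable ϑ) : Measurable fun ω => u ω (ϑ ω) :=
  (measurable_uncurry_of_continuous_of_measurable (u := fun η ω => u ω η) hc hu).comp
    (hϑ.prodMk measurable_id)

lemma tendsto_mul_sub_inner_gradient {E : Type*} [NormedAddCommGroup E]
    [InnerProductSpace ℝ E] [CompleteSpace E] {u : E → ℝ} {x : E}
    (hu : DifferentiableAt ℝ u x) (v : E) :
    Tendsto (fun n : ℕ => ((n : ℝ) + 1) * (u (x + ((n : ℝ) + 1)⁻¹ • v) - u x)) atTop
      (𝓝 (inner ℝ (gradient u x) v)) := by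
  have hinv : Tendsto (fun n : ℕ => ((n : ℝ) + 1)⁻¹) atTop (𝓝[≠] 0) :=
    tendsto_nhdsWithin_iff.2 ⟨by simpa using tendsto_one_div_add_atTop_nhds_zero_nat (𝕜 := ℝ),
      Eventually.of_forall fun n => inv_ne_zero (by positivity)⟩
  refine ((hu.hasGradientAt.hasFDerivAt.hasLineDerivAt v).tendsto_slope_zero.comp hinv).congr
    fun n => ?_
  simp

lemma measurable_gradient_comp {d : ℕ} {u : Ω → EuclideanSpace ℝ (Fin d) → ℝ}
    (hd : ∀ ω, Differentiable ℝ (u ω)) (hu : ∀ η, Measurable fun ω => u ω η)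
    {ϑ : Ω → EuclideanSpace ℝ (Fin d)} (hϑ : Measurable ϑ) :
    Measurable fun ω => gradient (u ω) (ϑ ω) := by
  have hcomp {κ : Ω → EuclideanSpace ℝ (Fin d)} (hκ : Measurable κ) :
      Measurable fun ω => u ω (κ ω) :=
    measurable_apply_of_continuous (fun ω => (hd ω).continuous) hu hκ
  have hcoord (j : Fin d) : Measurable fun ω => gradient (u ω) (ϑ ω) j := by
    refine measurable_of_tendsto_metrizable (f := fun (n : ℕ) ω => ((n : ℝ) + 1) *
        (u ω (ϑ ω + ((n : ℝ) + 1)⁻¹ • EuclideanSpace.single j 1) - u ω (ϑ ω)))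
      (fun n => ((hcomp (hϑ.add_const _)).sub (hcomp hϑ)).const_mul _)
      (tendsto_pi_nhds.2 fun ω => ?_)
    have h := tendsto_mul_sub_inner_gradient (hd ω (ϑ ω)) (EuclideanSpace.single j 1)
    rwa [EuclideanSpace.inner_single_right, one_mul, starRingEnd_apply, star_trivial] at h
  exact (MeasurableEquiv.toLp 2 (Fin d → ℝ)).measurable.comp (measurable_pi_iff.2 hcoord)

lemma measurable_gradient {E : Type*} [NormedAddCommGroup E] [InnerProductSpace ℝ E]
    [CompleteSpace E] [MeasurableSpace E] [BorelSpace E] (F : E → ℝ) :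
    Measurable (gradient F) :=
  (InnerProductSpace.toDual ℝ E).symm.continuous.measurable.comp (measurable_fderiv ℝ F)

end Measurability

/-! ### Mini-batch sizes and sample sizes -/

namespace Params

variable {p : Params}

lemma Crho_mul_rpow_le_batch (p : Params) (t : ℕ) :
    (p.Crho : ℝ) * (t : ℝ) ^ p.rho ≤ p.batch t :=
  Nat.le_ceil _

lemma batch_lt_Crho_mul_rpow_add_one (p : Params) (t : ℕ) :
    (p.batch t : ℝ) < (p.Crho : ℝ) * (t : ℝ) ^ p.rho + 1 :=
  Nat.ceil_lt_add_one (by positivity)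

lemma total_succ (p : Params) (t : ℕ) : p.total (t + 1) = p.total t + p.batch (t + 1) :=
  Finset.sum_Icc_succ_top (by omega) _

lemma cast_total (p : Params) (t : ℕ) :
    (p.total t : ℝ) = ∑ i ∈ Finset.Icc 1 t, (p.batch i : ℝ) := by
  simp [total]

namespace Valid

lemma one_le_Crho (hp : p.Valid) : (1 : ℝ) ≤ p.Crho := by
  exact_mod_cast hp.Crho_pos

lemma cast_Crho_pos (hp : p.Valid) : (0 : ℝ) < p.Crho :=
  zero_lt_one.trans_le hp.one_le_Crho

lemma rho_nonneg (hp : p.Valid) : 0 ≤ p.rho := hp.rho_mem.1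

lemma one_add_rho_pos (hp : p.Valid) : 0 < 1 + p.rho :=
  add_pos_of_pos_of_nonneg one_pos hp.rho_nonneg

lemma one_le_rpow_rho (hp : p.Valid) {t : ℕ} (ht : 1 ≤ t) : (1 : ℝ) ≤ (t : ℝ) ^ p.rho :=
  Real.one_le_rpow (by exact_mod_cast ht) hp.rho_nonneg

lemma rpow_rho_le_batch (hp : p.Valid) (t : ℕ) : (t : ℝ) ^ p.rho ≤ p.batch t :=
  (le_mul_of_one_le_left (by positivity) hp.one_le_Crho).trans (p.Crho_mul_rpow_le_batch t)

lemma Crho_le_batch (hp : p.Valid) {t : ℕ} (ht : 1 ≤ t) : (p.Crho : ℝ) ≤ p.batch t :=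
  (le_mul_of_one_le_right (by positivity) (hp.one_le_rpow_rho ht)).trans
    (p.Crho_mul_rpow_le_batch t)

lemma one_le_batch (hp : p.Valid) {t : ℕ} (ht : 1 ≤ t) : (1 : ℝ) ≤ p.batch t :=
  hp.one_le_Crho.trans (hp.Crho_le_batch ht)

lemma batch_pos (hp : p.Valid) {t : ℕ} (ht : 1 ≤ t) : (0 : ℝ) < p.batch t :=
  zero_lt_one.trans_le (hp.one_le_batch ht)

lemma batch_le (hp : p.Valid) {t : ℕ} (ht : 1 ≤ t) :
    (p.batch t : ℝ) ≤ 2 * p.Crho * (t : ℝ) ^ p.rho := by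
  have h : (1 : ℝ) ≤ p.Crho * (t : ℝ) ^ p.rho :=
    one_le_mul_of_one_le_of_one_le hp.one_le_Crho (hp.one_le_rpow_rho ht)
  linarith [p.batch_lt_Crho_mul_rpow_add_one t]

lemma batch_mono (hp : p.Valid) : Monotone p.batch := fun i j hij =>
  Nat.ceil_mono (mul_le_mul_of_nonneg_left
    (Real.rpow_le_rpow (by positivity) (by exact_mod_cast hij) hp.rho_nonneg) (by positivity))

lemma Crho_mul_rpow_le_mul_total (hp : p.Valid) (t : ℕ) :
    (p.Crho : ℝ) * (t : ℝ) ^ (1 + p.rho) ≤ (1 + p.rho) * p.total t := by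
  have hr := hp.rho_nonneg
  induction t with
  | zero => simp [Real.zero_rpow hp.one_add_rho_pos.ne', total]
  | succ t ih =>
    have hstep := rpow_sub_rpow_le (q := 1 + p.rho) (x := t) (y := t + 1)
      (by linarith) (by positivity) (by positivity)
    rw [add_sub_cancel_left, add_sub_cancel_left, mul_one] at hstep
    have hstep := mul_le_mul_of_nonneg_left hstep p.Crho.cast_nonneg
    have hbatch := mul_le_mul_of_nonneg_left (p.Crho_mul_rpow_le_batch (t + 1))
      hp.one_add_rho_pos.le
    rw [total_succ]
    push_cast at hbatch ⊢
    linarith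

lemma total_le (hp : p.Valid) {t : ℕ} (ht : 1 ≤ t) :
    (p.total t : ℝ) ≤ 2 * p.Crho * (t : ℝ) ^ (1 + p.rho) := by
  have ht0 : (0 : ℝ) < t := by exact_mod_cast ht
  have hterm : ∀ i ∈ Finset.Icc 1 t, (p.batch i : ℝ) ≤ 2 * p.Crho * (t : ℝ) ^ p.rho :=
    fun i hi => le_trans (by exact_mod_cast hp.batch_mono (Finset.mem_Icc.1 hi).2) (hp.batch_le ht)
  rw [cast_total]
  refine (Finset.sum_le_card_nsmul _ _ _ hterm).trans_eq ?_
  rw [Nat.card_Icc, Nat.add_sub_cancel, nsmul_eq_mul, Real.rpow_add ht0, Real.rpow_one]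
  ring

lemma Crho_mul_le_total (hp : p.Valid) (t : ℕ) : (p.Crho : ℝ) * t ≤ p.total t := by
  rw [cast_total]
  calc (p.Crho : ℝ) * t = ∑ _i ∈ Finset.Icc 1 t, (p.Crho : ℝ) := by simp [mul_comm]
    _ ≤ _ := Finset.sum_le_sum fun i hi => hp.Crho_le_batch (Finset.mem_Icc.1 hi).1

lemma natCast_le_total (hp : p.Valid) (t : ℕ) : (t : ℝ) ≤ p.total t :=
  (le_mul_of_one_le_left t.cast_nonneg hp.one_le_Crho).trans (hp.Crho_mul_le_total t)

lemma one_le_total (hp : p.Valid) {t : ℕ} (ht : 1 ≤ t) : (1 : ℝ) ≤ p.total t :=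
  le_trans (by exact_mod_cast ht) (hp.natCast_le_total t)

lemma total_pos (hp : p.Valid) {t : ℕ} (ht : 1 ≤ t) : (0 : ℝ) < p.total t :=
  zero_lt_one.trans_le (hp.one_le_total ht)

lemma rpow_mul_rpow_eq_self (hp : p.Valid) {y : ℝ} (hy : 0 < y) :
    y ^ (1 / (1 + p.rho)) * y ^ (p.rho / (1 + p.rho)) = y :=
  rpow_one_div_mul_rpow_div hp.one_add_rho_pos hy

lemma Crho_le_rpow_mul_total_rpow (hp : p.Valid) {t : ℕ} (ht : 1 ≤ t) :
    (p.Crho : ℝ) ≤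
      (p.Crho : ℝ) ^ (1 / (1 + p.rho)) * (p.total t : ℝ) ^ (p.rho / (1 + p.rho)) := by
  have hC := hp.cast_Crho_pos
  have hle : (p.Crho : ℝ) ≤ p.total t :=
    (le_mul_of_one_le_right hC.le (by exact_mod_cast ht)).trans (hp.Crho_mul_le_total t)
  have hq : 0 ≤ p.rho / (1 + p.rho) := div_nonneg hp.rho_nonneg hp.one_add_rho_pos.le
  calc (p.Crho : ℝ) = _ := (hp.rpow_mul_rpow_eq_self hC).symm
    _ ≤ _ := by gcongr

lemma Crho_mul_rpow_le_sqrt_two_mul (hp : p.Valid) (t : ℕ) :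
    (p.Crho : ℝ) * (t : ℝ) ^ p.rho ≤ √2 *
      ((p.Crho : ℝ) ^ (1 / (1 + p.rho)) * (p.total t : ℝ) ^ (p.rho / (1 + p.rho))) := by
  have hC := hp.cast_Crho_pos
  have h1r := hp.one_add_rho_pos
  have hq : 0 ≤ p.rho / (1 + p.rho) := div_nonneg hp.rho_nonneg h1r.le
  have hpow : (p.Crho : ℝ) ^ (p.rho / (1 + p.rho)) * (t : ℝ) ^ p.rho ≤
      √2 * (p.total t : ℝ) ^ (p.rho / (1 + p.rho)) := by
    have h := Real.rpow_le_rpow (by positivity) (hp.Crho_mul_rpow_le_mul_total t) hq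
    rw [Real.mul_rpow hC.le (by positivity), Real.mul_rpow h1r.le (by positivity),
      ← Real.rpow_mul t.cast_nonneg, mul_div_cancel₀ _ h1r.ne'] at h
    exact h.trans (mul_le_mul_of_nonneg_right
      (one_add_rpow_div_le_sqrt_two hp.rho_nonneg hp.rho_mem.2.le) (by positivity))
  calc (p.Crho : ℝ) * (t : ℝ) ^ p.rho
      = (p.Crho : ℝ) ^ (1 / (1 + p.rho)) *
          ((p.Crho : ℝ) ^ (p.rho / (1 + p.rho)) * (t : ℝ) ^ p.rho) := by
        rw [← mul_assoc, hp.rpow_mul_rpow_eq_self hC]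
    _ ≤ (p.Crho : ℝ) ^ (1 / (1 + p.rho)) *
          (√2 * (p.total t : ℝ) ^ (p.rho / (1 + p.rho))) := by gcongr
    _ = _ := by ring

lemma two_le_batch (hp : p.Valid) (hr : 0 < p.rho) {t : ℕ} (ht : 2 ≤ t) : 2 ≤ p.batch t := by
  have hpow : (1 : ℝ) < (t : ℝ) ^ p.rho := Real.one_lt_rpow (by exact_mod_cast ht) hr
  have : (1 : ℝ) < p.batch t := hpow.trans_le (hp.rpow_rho_le_batch t)
  exact_mod_cast this

lemma two_mul_le_total_add_one (hp : p.Valid) (hr : 0 < p.rho) (t : ℕ) :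
    2 * t ≤ p.total t + 1 := by
  induction t with
  | zero => simp
  | succ t ih =>
    rcases t.eq_zero_or_pos with rfl | ht
    · have : (1 : ℝ) ≤ p.total (0 + 1) := hp.one_le_total le_rfl
      have : 1 ≤ p.total (0 + 1) := by exact_mod_cast this
      omega
    · have : 2 ≤ p.batch (t + 1) := hp.two_le_batch hr (by omega)
      rw [total_succ]
      omega

lemma two_le_total_rpow (hp : p.Valid) {t : ℕ} (ht : 2 ≤ (t : ℝ) ^ p.rho)
    (hb : 3 ≤ p.batch t) : 2 ≤ (p.total t : ℝ) ^ (p.rho / (1 + p.rho)) := by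
  have hr : 0 < p.rho := hp.rho_nonneg.lt_of_ne fun h => by norm_num [← h] at ht
  obtain ⟨s, rfl⟩ : ∃ s, t = s + 1 := Nat.exists_eq_succ_of_ne_zero fun h => by
    norm_num [h, Real.zero_rpow hr.ne'] at ht
  have htotal : (2 : ℝ) * (s + 1 : ℕ) ≤ p.total (s + 1) := by
    have := hp.two_mul_le_total_add_one hr s
    have : 2 * (s + 1) ≤ p.total (s + 1) := by rw [total_succ]; omega
    exact_mod_cast this
  have h1r := hp.one_add_rho_pos
  have : 0 ≤ 1 / (1 + p.rho) := one_div_nonneg.2 h1r.le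
  calc (2 : ℝ) = 2 ^ (1 / (1 + p.rho)) * 2 ^ (p.rho / (1 + p.rho)) :=
        (hp.rpow_mul_rpow_eq_self two_pos).symm
    _ ≤ (((s + 1 : ℕ) : ℝ) ^ p.rho) ^ (1 / (1 + p.rho)) * 2 ^ (p.rho / (1 + p.rho)) := by gcongr
    _ = (2 * (s + 1 : ℕ)) ^ (p.rho / (1 + p.rho)) := by
        rw [Real.mul_rpow two_pos.le (by positivity), ← Real.rpow_mul (by positivity),
          mul_one_div, mul_comm]
    _ ≤ _ := Real.rpow_le_rpow (by positivity) htotal (div_nonneg hr.le h1r.le)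

-- Rounding up is absorbed by `√2 < 2` as soon as `n_t ≥ 4`; the case `n_t = 3 > 2 C_ρ` is special.
lemma batch_le_total_rpow (hp : p.Valid) {t : ℕ} (ht : 1 ≤ t) :
    (p.batch t : ℝ) ≤ 2 * ((p.Crho : ℝ) ^ (1 / (1 + p.rho)) *
      (p.total t : ℝ) ^ (p.rho / (1 + p.rho))) := by
  have hlt := p.batch_lt_Crho_mul_rpow_add_one t
  rcases le_or_gt (p.batch t) (2 * p.Crho) with hsmall | hlarge
  · have : (p.batch t : ℝ) ≤ 2 * p.Crho := by exact_mod_cast hsmall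
    linarith [hp.Crho_le_rpow_mul_total_rpow ht]
  rcases le_or_gt 4 (p.batch t) with hfour | hfour
  · have hfour : (4 : ℝ) ≤ p.batch t := by exact_mod_cast hfour
    have hbound := hp.Crho_mul_rpow_le_sqrt_two_mul t
    have hsqrt : √2 ≤ 1.5 := Real.sqrt_le_iff.2 (by norm_num)
    have hz : 0 ≤ (p.Crho : ℝ) ^ (1 / (1 + p.rho)) *
      (p.total t : ℝ) ^ (p.rho / (1 + p.rho)) := by positivity
    nlinarith
  · have hCpos := hp.Crho_pos
    have hthree : p.batch t = 3 := by omega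
    have hone : p.Crho = 1 := by omega
    rw [hthree, hone] at hlt
    push_cast at hlt
    have := hp.two_le_total_rpow (t := t) (by linarith) hthree.ge
    rw [hthree, hone, Nat.cast_one, Real.one_rpow]
    push_cast
    linarith

lemma sum_batch_rpow_le_of_le_half (hp : p.Valid) {s : ℝ} (hs0 : 0 ≤ s) (hs : s ≤ 1 / 2) {t : ℕ}
    (ht : 1 ≤ t) :
    ∑ i ∈ Finset.Icc 1 t, (p.batch i : ℝ) ^ (2 - 2 * s) ≤
      2 * (p.Crho : ℝ) ^ ((1 - 2 * s) / (1 + p.rho)) *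
        (p.total t : ℝ) ^ (2 - (1 + 2 * p.rho * s) / (1 + p.rho)) := by
  have h1r := hp.one_add_rho_pos
  have hN := hp.total_pos ht
  have hC := hp.cast_Crho_pos
  have he : 0 ≤ 1 - 2 * s := by linarith
  have hmax : (p.batch t : ℝ) ^ (1 - 2 * s) ≤ 2 * (p.Crho : ℝ) ^ ((1 - 2 * s) / (1 + p.rho)) *
      (p.total t : ℝ) ^ (p.rho / (1 + p.rho) * (1 - 2 * s)) := by
    have h := Real.rpow_le_rpow (by positivity) (hp.batch_le_total_rpow ht) he
    rw [Real.mul_rpow (by norm_num) (by positivity), Real.mul_rpow (by positivity)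
      (by positivity), ← Real.rpow_mul hC.le, ← Real.rpow_mul hN.le, one_div_mul_eq_div,
      ← mul_assoc] at h
    have htwo : (2 : ℝ) ^ (1 - 2 * s) ≤ 2 :=
      Real.rpow_le_self_of_one_le one_le_two (by linarith)
    exact h.trans (by gcongr)
  have hterm : ∀ i ∈ Finset.Icc 1 t,
      (p.batch i : ℝ) ^ (2 - 2 * s) ≤ p.batch i * (p.batch t : ℝ) ^ (1 - 2 * s) := by
    intro i hi
    obtain ⟨hi1, hit⟩ := Finset.mem_Icc.1 hi
    rw [show 2 - 2 * s = 1 + (1 - 2 * s) by ring, Real.rpow_add (hp.batch_pos hi1), Real.rpow_one]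
    gcongr
    exact hp.batch_mono hit
  have hexp : 2 - (1 + 2 * p.rho * s) / (1 + p.rho) =
      1 + p.rho / (1 + p.rho) * (1 - 2 * s) := by field_simp; ring
  calc ∑ i ∈ Finset.Icc 1 t, (p.batch i : ℝ) ^ (2 - 2 * s)
      ≤ ∑ i ∈ Finset.Icc 1 t, p.batch i * (p.batch t : ℝ) ^ (1 - 2 * s) :=
        Finset.sum_le_sum hterm
    _ = p.total t * (p.batch t : ℝ) ^ (1 - 2 * s) := by rw [← Finset.sum_mul, cast_total]
    _ ≤ p.total t * (2 * (p.Crho : ℝ) ^ ((1 - 2 * s) / (1 + p.rho)) *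
          (p.total t : ℝ) ^ (p.rho / (1 + p.rho) * (1 - 2 * s))) := by gcongr
    _ = _ := by rw [hexp, Real.rpow_add hN, Real.rpow_one]; ring

lemma natCast_rpow_le_total_rpow (hp : p.Valid) {e : ℝ} (he0 : 0 ≤ e) (he1 : e ≤ 1) (t : ℕ) :
    (t : ℝ) ^ e ≤
      2 * (p.Crho : ℝ) ^ (-e / (1 + p.rho)) * (p.total t : ℝ) ^ (e / (1 + p.rho)) := by
  have h1r := hp.one_add_rho_pos
  have hC := hp.cast_Crho_pos
  have hroot := Real.rpow_le_rpow (by positivity) (hp.Crho_mul_rpow_le_mul_total t)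
    (by positivity : 0 ≤ e / (1 + p.rho))
  rw [Real.mul_rpow hC.le (by positivity), Real.mul_rpow h1r.le (by positivity),
    ← Real.rpow_mul (by positivity), mul_div_cancel₀ _ h1r.ne'] at hroot
  have htwo : (1 + p.rho) ^ (e / (1 + p.rho)) ≤ 2 := by
    refine (Real.rpow_le_self_of_one_le (by linarith [hp.rho_nonneg]) ?_).trans
      (by linarith [hp.rho_mem.2])
    rw [div_le_one h1r]
    linarith [hp.rho_nonneg]
  have hscaled : (p.Crho : ℝ) ^ (e / (1 + p.rho)) * (t : ℝ) ^ e ≤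
      2 * (p.total t : ℝ) ^ (e / (1 + p.rho)) :=
    hroot.trans (mul_le_mul_of_nonneg_right htwo (by positivity))
  rwa [neg_div, Real.rpow_neg hC.le, mul_right_comm, ← div_eq_mul_inv,
    le_div_iff₀ (by positivity), mul_comm ((t : ℝ) ^ e)]

lemma sum_batch_rpow_le_of_half_le (hp : p.Valid) {s : ℝ} (hs : 1 / 2 ≤ s) (hs1 : s ≤ 1) {t : ℕ}
    (ht : 1 ≤ t) :
    ∑ i ∈ Finset.Icc 1 t, (p.batch i : ℝ) ^ (2 - 2 * s) ≤
      2 * (p.Crho : ℝ) ^ ((1 - 2 * s) / (1 + p.rho)) *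
        (p.total t : ℝ) ^ (2 - (1 + 2 * p.rho * s) / (1 + p.rho)) := by
  have h1r := hp.one_add_rho_pos
  obtain ⟨e, rfl⟩ : ∃ e, s = (1 + e) / 2 := ⟨2 * s - 1, by ring⟩
  have he0 : 0 ≤ e := by linarith
  have he1 : e ≤ 1 := by linarith
  have hJensen := sum_rpow_one_sub_le (s := Finset.Icc 1 t) (y := fun i => (p.batch i : ℝ))
    (Finset.nonempty_Icc.2 ht) (fun i _ => Nat.cast_nonneg _) he0 he1
  rw [Nat.card_Icc, Nat.add_sub_cancel, ← cast_total] at hJensen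
  have hexp : 2 - (1 + 2 * p.rho * ((1 + e) / 2)) / (1 + p.rho) = e / (1 + p.rho) + (1 - e) := by
    field_simp
    ring
  calc ∑ i ∈ Finset.Icc 1 t, (p.batch i : ℝ) ^ (2 - 2 * ((1 + e) / 2))
      = ∑ i ∈ Finset.Icc 1 t, (p.batch i : ℝ) ^ (1 - e) := by ring_nf
    _ ≤ (t : ℝ) ^ e * (p.total t : ℝ) ^ (1 - e) := hJensen
    _ ≤ 2 * (p.Crho : ℝ) ^ (-e / (1 + p.rho)) * (p.total t : ℝ) ^ (e / (1 + p.rho)) *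
          (p.total t : ℝ) ^ (1 - e) := by
        gcongr
        exact hp.natCast_rpow_le_total_rpow he0 he1 t
    _ = _ := by
        rw [mul_assoc, ← Real.rpow_add (hp.total_pos ht), ← hexp]
        ring_nf

lemma sum_batch_rpow_le (hp : p.Valid) {s : ℝ} (hs0 : 0 ≤ s) (hs1 : s ≤ 1) {t : ℕ}
    (ht : 1 ≤ t) :
    ∑ i ∈ Finset.Icc 1 t, (p.batch i : ℝ) ^ (2 - 2 * s) ≤
      2 * (p.Crho : ℝ) ^ ((1 - 2 * s) / (1 + p.rho)) *
        (p.total t : ℝ) ^ (2 - (1 + 2 * p.rho * s) / (1 + p.rho)) :=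
  (le_total s (1 / 2)).elim (hp.sum_batch_rpow_le_of_le_half hs0 · ht)
    (hp.sum_batch_rpow_le_of_half_le · hs1 ht)

end Valid

end Params

/-! ### Learning rate and fourth-moment error rate -/

lemma tendsto_natCast_rpow_neg {s : ℝ} (hs : 0 < s) :
    Tendsto (fun t : ℕ => (t : ℝ) ^ (-s)) atTop (𝓝 0) :=
  (tendsto_rpow_neg_atTop hs).comp tendsto_natCast_atTop_atTop

lemma natCast_rpow_neg_le_succ {s : ℝ} (hs : 0 ≤ s) {t : ℕ} (ht : 1 ≤ t) :
    (t : ℝ) ^ (-s) ≤ 2 ^ s * ((t + 1 : ℕ) : ℝ) ^ (-s) := by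
  have ht1 : (1 : ℝ) ≤ t := by exact_mod_cast ht
  have h := Real.rpow_le_rpow_of_nonpos (by positivity)
    (by push_cast; linarith : ((t + 1 : ℕ) : ℝ) ≤ 2 * t) (neg_nonpos.2 hs)
  rwa [Real.mul_rpow two_pos.le (by positivity), Real.rpow_neg two_pos.le,
    inv_mul_le_iff₀ (by positivity)] at h

lemma natCast_rpow_neg_le_succ_mul_one_add_div {s : ℝ} (hs : 0 ≤ s) {t : ℕ} (ht : 1 ≤ t) :
    (t : ℝ) ^ (-s) ≤ ((t + 1 : ℕ) : ℝ) ^ (-s) * (1 + s * 2 ^ s / t) := by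
  have ht0 : (0 : ℝ) < t := by exact_mod_cast ht
  have hdiff := rpow_neg_sub_rpow_neg_le hs ht0 (by positivity : (0 : ℝ) < (t + 1 : ℕ))
  have hslope : s * (t : ℝ) ^ (-s - 1) ≤ s * (2 ^ s * ((t + 1 : ℕ) : ℝ) ^ (-s)) / t := by
    rw [Real.rpow_sub_one ht0.ne', mul_div_assoc]
    gcongr
    exact natCast_rpow_neg_le_succ hs ht
  rw [Nat.cast_add_one, add_sub_cancel_left, mul_one, ← Nat.cast_add_one] at hdiff
  calc (t : ℝ) ^ (-s)
      ≤ ((t + 1 : ℕ) : ℝ) ^ (-s) + s * (2 ^ s * ((t + 1 : ℕ) : ℝ) ^ (-s)) / t := by linarith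
    _ = _ := by ring

lemma one_add_div_pow_le {c x : ℝ} (hc : -1 ≤ c) (hx : 1 ≤ x) (n : ℕ) :
    (1 + c / x) ^ n ≤ 1 + ((1 + c) ^ n - 1) / x := by
  have hx0 : 0 < x := zero_lt_one.trans_le hx
  have hinv : x⁻¹ ≤ 1 := inv_le_one_of_one_le₀ hx
  have h := (convexOn_pow (𝕜 := ℝ) n).2 (Set.mem_Ici.2 zero_le_one)
    (Set.mem_Ici.2 (by linarith : 0 ≤ 1 + c)) (sub_nonneg.2 hinv) (inv_nonneg.2 hx0.le)
    (sub_add_cancel 1 x⁻¹)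
  simp only [smul_eq_mul, mul_one, one_pow] at h
  calc (1 + c / x) ^ n = (1 - x⁻¹ + x⁻¹ * (1 + c)) ^ n := by ring
    _ ≤ 1 - x⁻¹ + x⁻¹ * (1 + c) ^ n := h
    _ = _ := by ring

namespace Params

/-- The exponent `α - ρβ`: the learning rate `γ_t` is of order `t^{-(α - ρβ)}`. -/
noncomputable def decay (p : Params) : ℝ := p.alpha - p.rho * p.beta

/-- The exponent `ρσ + (α - ρβ) / 2`: the gradient noise makes the non-averaged iterate deviate
from the minimizer by an order `t^{-(ρσ + (α - ρβ) / 2)}`. -/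
noncomputable def noiseExponent (p : Params) : ℝ := p.rho * p.sigma + p.decay / 2

/-- The order of the bias of the gradients that does not vanish at the minimizer; it is zero
when `B_ν = 0`. -/
noncomputable def biasRate (p : Params) (t : ℕ) : ℝ :=
  if p.Bnu ≠ 0 then (t : ℝ) ^ (-(p.rho * p.nu)) else 0

/-- The order of the `L⁴` error of the non-averaged iterate `θ_i`, shifted by one so that it is
meaningful at `i = 0`. -/
noncomputable def errRate (p : Params) (i : ℕ) : ℝ :=
  ((i + 1 : ℕ) : ℝ) ^ (-p.noiseExponent) + p.biasRate (i + 1)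

/-- The coefficient of `E‖θ_{t-1} - θ*‖⁴` in the recursion for the fourth moment of the error.
The free parameter of Young's inequality is chosen to be `μ_ν / 32`. -/
noncomputable def contraction (p : Params) (t : ℕ) : ℝ :=
  1 - p.rate t * (2 * p.mu - 4 * (p.depRate t * p.Dnu) - 12 * (p.muNu / 32)) +
    8 * p.rate t ^ 2 * (1 + p.Ckappa ^ 4) + 24 * p.rate t ^ 4 * p.Ckappa ^ 4

/-- The additive term in the recursion for the fourth moment of the error. -/
noncomputable def forcing (p : Params) (t : ℕ) : ℝ :=
  p.rate t * ((p.muNu / 32)⁻¹ ^ 3 * (p.depRate t * p.Bnu) ^ 4) +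
    8 * p.rate t ^ 3 * p.noiseRate t ^ 4 / (p.muNu / 32) +
    24 * p.rate t ^ 4 * p.noiseRate t ^ 4

variable {p : Params}

lemma biasRate_of_Bnu_eq_zero (hB : p.Bnu = 0) (t : ℕ) : p.biasRate t = 0 :=
  if_neg (not_not.2 hB)

lemma biasRate_of_Bnu_ne_zero (hB : p.Bnu ≠ 0) (t : ℕ) :
    p.biasRate t = (t : ℝ) ^ (-(p.rho * p.nu)) :=
  if_pos hB

lemma biasRate_nonneg (p : Params) (t : ℕ) : 0 ≤ p.biasRate t := by
  unfold biasRate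
  split_ifs <;> positivity

lemma rpow_le_errRate (p : Params) (i : ℕ) :
    ((i + 1 : ℕ) : ℝ) ^ (-p.noiseExponent) ≤ p.errRate i :=
  le_add_of_nonneg_right (p.biasRate_nonneg _)

lemma biasRate_le_errRate (p : Params) (i : ℕ) : p.biasRate (i + 1) ≤ p.errRate i :=
  le_add_of_nonneg_left (by positivity)

lemma errRate_pos (p : Params) (i : ℕ) : 0 < p.errRate i :=
  lt_of_lt_of_le (by positivity) (p.rpow_le_errRate i)

lemma errRate_nonneg (p : Params) (i : ℕ) : 0 ≤ p.errRate i := (p.errRate_pos i).le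

lemma depRate_nonneg (p : Params) (t : ℕ) : 0 ≤ p.depRate t := by
  unfold depRate
  positivity

lemma rpow_neg_decay_eq_mul {t : ℕ} (ht : 1 ≤ t) :
    (t : ℝ) ^ (-p.decay) = (t : ℝ) ^ (p.rho * p.beta) * (t : ℝ) ^ (-p.alpha) := by
  rw [← Real.rpow_add (by exact_mod_cast ht), decay]
  ring_nf

namespace Valid

lemma batch_rpow_neg_le (hp : p.Valid) {s : ℝ} (hs : 0 ≤ s) {t : ℕ} (ht : 1 ≤ t) :
    (p.batch t : ℝ) ^ (-s) ≤ (t : ℝ) ^ (-(p.rho * s)) := by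
  have ht0 : (0 : ℝ) < t := by exact_mod_cast ht
  rw [← mul_neg, Real.rpow_mul ht0.le]
  exact Real.rpow_le_rpow_of_nonpos (by positivity) (hp.rpow_rho_le_batch t) (neg_nonpos.2 hs)

lemma depRate_le (hp : p.Valid) {t : ℕ} (ht : 1 ≤ t) :
    p.depRate t ≤ (t : ℝ) ^ (-(p.rho * p.nu)) :=
  hp.batch_rpow_neg_le hp.nu_pos.le ht

lemma noiseRate_nonneg (hp : p.Valid) (t : ℕ) : 0 ≤ p.noiseRate t :=
  mul_nonneg hp.Csigma_pos.le (by positivity)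

lemma noiseRate_le (hp : p.Valid) {t : ℕ} (ht : 1 ≤ t) :
    p.noiseRate t ≤ p.Csigma * (t : ℝ) ^ (-(p.rho * p.sigma)) :=
  mul_le_mul_of_nonneg_left (hp.batch_rpow_neg_le hp.sigma_mem.1 ht) hp.Csigma_pos.le

lemma rho_mul_nu_nonneg (hp : p.Valid) : 0 ≤ p.rho * p.nu :=
  mul_nonneg hp.rho_nonneg hp.nu_pos.le

lemma noiseExponent_nonneg (hp : p.Valid) (ha : 0 < p.decay) : 0 ≤ p.noiseExponent :=
  add_nonneg (mul_nonneg hp.rho_nonneg hp.sigma_mem.1) (by positivity)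

lemma rate_pos (hp : p.Valid) {t : ℕ} (ht : 1 ≤ t) : 0 < p.rate t := by
  have : (0 : ℝ) < t := by exact_mod_cast ht
  have := hp.batch_pos ht
  have := hp.Cgamma_pos
  unfold rate
  positivity

lemma rate_ge (hp : p.Valid) {t : ℕ} (ht : 1 ≤ t) :
    p.Cgamma * (t : ℝ) ^ (-p.decay) ≤ p.rate t := by
  have hbatch : (t : ℝ) ^ (p.rho * p.beta) ≤ (p.batch t : ℝ) ^ p.beta := by
    rw [Real.rpow_mul t.cast_nonneg]
    exact Real.rpow_le_rpow (by positivity) (hp.rpow_rho_le_batch t) hp.beta_mem.1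
  have := hp.Cgamma_pos
  rw [rpow_neg_decay_eq_mul ht, rate, mul_assoc]
  gcongr

lemma rate_le (hp : p.Valid) {t : ℕ} (ht : 1 ≤ t) :
    p.rate t ≤ p.Cgamma * (2 * p.Crho) ^ p.beta * (t : ℝ) ^ (-p.decay) := by
  have hbatch : (p.batch t : ℝ) ^ p.beta ≤
      (2 * p.Crho) ^ p.beta * (t : ℝ) ^ (p.rho * p.beta) := by
    rw [Real.rpow_mul t.cast_nonneg, ← Real.mul_rpow (by positivity) (by positivity)]
    exact Real.rpow_le_rpow (by positivity) (hp.batch_le ht) hp.beta_mem.1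
  have := hp.Cgamma_pos
  rw [rpow_neg_decay_eq_mul ht, rate]
  calc p.Cgamma * (p.batch t : ℝ) ^ p.beta * (t : ℝ) ^ (-p.alpha)
      ≤ p.Cgamma * ((2 * p.Crho) ^ p.beta * (t : ℝ) ^ (p.rho * p.beta)) *
          (t : ℝ) ^ (-p.alpha) := by gcongr
    _ = _ := by ring

lemma tendsto_rate (hp : p.Valid) (ha : 0 < p.decay) : Tendsto p.rate atTop (𝓝 0) := by
  have hupper := (tendsto_natCast_rpow_neg ha).const_mul (p.Cgamma * (2 * p.Crho) ^ p.beta)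
  rw [mul_zero] at hupper
  refine tendsto_of_tendsto_of_tendsto_of_le_of_le' tendsto_const_nhds hupper ?_ ?_
  · filter_upwards [eventually_ge_atTop 1] with t ht using (hp.rate_pos ht).le
  · filter_upwards [eventually_ge_atTop 1] with t ht using hp.rate_le ht

lemma eventually_muNu_le (hp : p.Valid) (hmu : 0 < p.muNu) :
    ∀ᶠ t : ℕ in atTop, p.muNu ≤ 2 * p.mu - 4 * (p.depRate t * p.Dnu) - 12 * (p.muNu / 32) := by
  rcases eq_or_ne p.rho 0 with hr | hr
  · refine Eventually.of_forall fun t => ?_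
    have hbatch : p.batch t = p.Crho := by simp [batch, hr]
    have : p.muNu = p.mu - 2 * p.Dnu * p.depRate t := by simp [muNu, hr, depRate, hbatch]
    linarith
  · have hpos : 0 < p.rho * p.nu := mul_pos (hp.rho_nonneg.lt_of_ne' hr) hp.nu_pos
    have hmuNu : p.muNu = p.mu := by simp [muNu, hr]
    have hlim : Tendsto (fun t : ℕ => (t : ℝ) ^ (-(p.rho * p.nu)) * p.Dnu) atTop (𝓝 0) := by
      simpa using (tendsto_natCast_rpow_neg hpos).mul_const p.Dnu
    filter_upwards [eventually_ge_atTop 1,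
      hlim.eventually_le_const (by positivity : 0 < p.muNu / 8)] with t ht hsmall
    have := mul_le_mul_of_nonneg_right (hp.depRate_le ht) hp.Dnu_nonneg
    linarith

lemma eventually_contraction_le (hp : p.Valid) (hmu : 0 < p.muNu) (ha : 0 < p.decay) :
    ∀ᶠ t : ℕ in atTop, max (p.contraction t) 0 ≤
      1 - p.Cgamma * p.muNu / 2 * (t : ℝ) ^ (-p.decay) := by
  have hrate := hp.tendsto_rate ha
  have hhigher : Tendsto (fun t => 8 * p.rate t * (1 + p.Ckappa ^ 4) +
      24 * p.rate t ^ 3 * p.Ckappa ^ 4) atTop (𝓝 0) := by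
    simpa using ((hrate.const_mul 8).mul_const (1 + p.Ckappa ^ 4)).add
      (((hrate.pow 3).const_mul 24).mul_const (p.Ckappa ^ 4))
  have hlower : Tendsto (fun t : ℕ => p.Cgamma * p.muNu / 2 * (t : ℝ) ^ (-p.decay))
      atTop (𝓝 0) := by
    simpa using (tendsto_natCast_rpow_neg ha).const_mul (p.Cgamma * p.muNu / 2)
  filter_upwards [eventually_ge_atTop 1, hp.eventually_muNu_le hmu,
    hhigher.eventually_le_const (half_pos hmu), hlower.eventually_le_const zero_lt_one]
    with t ht hmuNu hsmall hle
  refine max_le ?_ (by linarith)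
  have hfirst := mul_le_mul_of_nonneg_left hmuNu (hp.rate_pos ht).le
  have hhigher := mul_le_mul_of_nonneg_left hsmall (hp.rate_pos ht).le
  have hrate := mul_le_mul_of_nonneg_left (hp.rate_ge ht) (half_pos hmu).le
  unfold contraction
  linarith

lemma depRate_mul_Bnu_le (hp : p.Valid) {t : ℕ} (ht : 1 ≤ t) :
    p.depRate t * p.Bnu ≤ 2 ^ (p.rho * p.nu) * p.Bnu * p.errRate t := by
  rcases eq_or_ne p.Bnu 0 with hB | hB
  · simp [hB]
  · have hdep : p.depRate t ≤ 2 ^ (p.rho * p.nu) * p.errRate t :=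
      (hp.depRate_le ht).trans <| (natCast_rpow_neg_le_succ hp.rho_mul_nu_nonneg ht).trans <| by
        gcongr
        exact (p.biasRate_of_Bnu_ne_zero hB _).ge.trans (p.biasRate_le_errRate t)
    calc p.depRate t * p.Bnu ≤ 2 ^ (p.rho * p.nu) * p.errRate t * p.Bnu :=
          mul_le_mul_of_nonneg_right hdep hp.Bnu_nonneg
      _ = _ := by ring

lemma rpow_mul_noiseRate_le (hp : p.Valid) (ha : 0 < p.decay) {t : ℕ} (ht : 1 ≤ t) :
    (t : ℝ) ^ (-(p.decay / 2)) * p.noiseRate t ≤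
      p.Csigma * 2 ^ p.noiseExponent * p.errRate t := by
  have ht0 : (0 : ℝ) < t := by exact_mod_cast ht
  have := hp.Csigma_pos
  calc (t : ℝ) ^ (-(p.decay / 2)) * p.noiseRate t
      ≤ (t : ℝ) ^ (-(p.decay / 2)) * (p.Csigma * (t : ℝ) ^ (-(p.rho * p.sigma))) := by
        gcongr
        exact hp.noiseRate_le ht
    _ = p.Csigma * (t : ℝ) ^ (-p.noiseExponent) := by
        rw [mul_left_comm, ← Real.rpow_add ht0, noiseExponent, neg_add_rev]
    _ ≤ p.Csigma * (2 ^ p.noiseExponent * p.errRate t) := by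
        gcongr
        exact (natCast_rpow_neg_le_succ (hp.noiseExponent_nonneg ha) ht).trans
          (mul_le_mul_of_nonneg_left (p.rpow_le_errRate t) (by positivity))
    _ = _ := by ring

lemma exists_forcing_le (hp : p.Valid) (hmu : 0 < p.muNu) (ha : 0 < p.decay) :
    ∃ C : ℝ, 0 ≤ C ∧ ∀ t : ℕ, 1 ≤ t →
      p.forcing t ≤ C * (t : ℝ) ^ (-p.decay) * p.errRate t ^ 4 := by
  set ε : ℝ := p.muNu / 32
  have : 0 < ε := by positivity
  set c : ℝ := p.Cgamma * (2 * p.Crho) ^ p.beta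
  have hc : 0 ≤ c := mul_nonneg hp.Cgamma_pos.le (by positivity)
  set b : ℝ := 2 ^ (p.rho * p.nu) * p.Bnu
  set s : ℝ := p.Csigma * 2 ^ p.noiseExponent
  refine ⟨c * (ε⁻¹ ^ 3 * b ^ 4) + (8 * c ^ 3 / ε + 24 * c ^ 4) * s ^ 4,
    by positivity, fun t ht => ?_⟩
  have ht0 : (0 : ℝ) < t := by exact_mod_cast ht
  have hγ : 0 ≤ p.rate t := (hp.rate_pos ht).le
  have hrate : p.rate t ≤ c * (t : ℝ) ^ (-p.decay) := hp.rate_le ht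
  set y : ℝ := (t : ℝ) ^ (-p.decay) with hydef
  have : 0 ≤ y := by positivity
  have hy1 : y ≤ 1 := Real.rpow_le_one_of_one_le_of_nonpos (by exact_mod_cast ht) (by linarith)
  have hbias : (p.depRate t * p.Bnu) ^ 4 ≤ (b * p.errRate t) ^ 4 :=
    pow_le_pow_left₀ (mul_nonneg (p.depRate_nonneg t) hp.Bnu_nonneg) (hp.depRate_mul_Bnu_le ht) 4
  have hnoise : y ^ 2 * p.noiseRate t ^ 4 ≤ (s * p.errRate t) ^ 4 := by
    refine le_of_eq_of_le ?_ (pow_le_pow_left₀ (mul_nonneg (by positivity)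
      (hp.noiseRate_nonneg t)) (hp.rpow_mul_noiseRate_le ha ht) 4)
    rw [mul_pow, hydef, ← Real.rpow_mul_natCast ht0.le, ← Real.rpow_mul_natCast ht0.le]
    push_cast
    ring_nf
  have hnoise' : 0 ≤ y ^ 2 * p.noiseRate t ^ 4 := by positivity
  calc p.forcing t
      ≤ c * y * (ε⁻¹ ^ 3 * (b * p.errRate t) ^ 4) + 8 * (c * y) ^ 3 * p.noiseRate t ^ 4 / ε +
          24 * (c * y) ^ 4 * p.noiseRate t ^ 4 := by
        unfold forcing
        gcongr
    _ = c * y * (ε⁻¹ ^ 3 * (b * p.errRate t) ^ 4) +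
          8 * c ^ 3 / ε * y * (y ^ 2 * p.noiseRate t ^ 4) +
          24 * c ^ 4 * y * (y * (y ^ 2 * p.noiseRate t ^ 4)) := by ring
    _ ≤ c * y * (ε⁻¹ ^ 3 * (b * p.errRate t) ^ 4) + 8 * c ^ 3 / ε * y * (s * p.errRate t) ^ 4 +
          24 * c ^ 4 * y * (s * p.errRate t) ^ 4 := by
        gcongr
        exact (mul_le_of_le_one_left hnoise' hy1).trans hnoise
    _ = _ := by ring

lemma exists_errRate_le_succ (hp : p.Valid) (ha : 0 < p.decay) :
    ∃ c : ℝ, 0 ≤ c ∧ ∀ t : ℕ, p.errRate t ≤ p.errRate (t + 1) * (1 + c / ((t + 1 : ℕ) : ℝ)) := by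
  have hs := hp.noiseExponent_nonneg ha
  have hν := hp.rho_mul_nu_nonneg
  refine ⟨p.noiseExponent * 2 ^ p.noiseExponent + p.rho * p.nu * 2 ^ (p.rho * p.nu),
    by positivity, fun t => ?_⟩
  have hnoise := natCast_rpow_neg_le_succ_mul_one_add_div hs (Nat.le_add_left 1 t)
  have hbias := natCast_rpow_neg_le_succ_mul_one_add_div hν (Nat.le_add_left 1 t)
  unfold errRate biasRate
  rw [add_mul]
  refine add_le_add (hnoise.trans ?_) ?_
  · gcongr
    exact le_add_of_nonneg_right (by positivity)
  · split_ifs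
    · refine hbias.trans ?_
      gcongr
      exact le_add_of_nonneg_left (by positivity)
    · simp

lemma exists_fourth_moment_bound (hp : p.Valid) (hmu : 0 < p.muNu) (ha : 0 < p.decay)
    (ha1 : p.decay < 1) :
    ∃ K : ℝ, 0 ≤ K ∧ ∀ u : ℕ → ℝ, (∀ t, 0 ≤ u t) → u 0 ≤ p.Delta0 →
      (∀ t, u (t + 1) ≤ p.contraction (t + 1) * u t + p.forcing (t + 1)) →
      ∀ t, u t ≤ (K * p.errRate t) ^ 4 := by
  obtain ⟨C, hC, hforcing⟩ := hp.exists_forcing_le hmu ha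
  obtain ⟨c, hc, hrate⟩ := hp.exists_errRate_le_succ ha
  have hrate4 : ∀ t, p.errRate t ^ 4 ≤
      p.errRate (t + 1) ^ 4 * (1 + ((1 + c) ^ 4 - 1) / ((t + 1 : ℕ) : ℝ)) := fun t =>
    calc p.errRate t ^ 4 ≤ (p.errRate (t + 1) * (1 + c / ((t + 1 : ℕ) : ℝ))) ^ 4 :=
          pow_le_pow_left₀ (p.errRate_nonneg t) (hrate t) 4
      _ ≤ _ := by
          rw [mul_pow]
          exact mul_le_mul_of_nonneg_left (one_add_div_pow_le (by linarith)
            (by exact_mod_cast Nat.le_add_left 1 t) 4) (by positivity)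
  have hγ := hp.Cgamma_pos
  obtain ⟨K, hK, hbound⟩ := exists_bound_of_recursion ha1
    (by positivity : 0 < p.Cgamma * p.muNu / 2) hC (fun t => pow_pos (p.errRate_pos t) 4) hrate4
    (fun t => le_max_right _ _) (hp.eventually_contraction_le hmu ha)
    ((eventually_ge_atTop 1).mono hforcing) p.Delta0
  refine ⟨K + 1, by positivity, fun u hu hu0 hrec t => ?_⟩
  have hK4 : K ≤ (K + 1) ^ 4 := by
    linarith [le_self_pow₀ (by linarith : 1 ≤ K + 1) four_ne_zero]
  rw [mul_pow]
  refine (hbound u hu0 (fun t => (hrec t).trans ?_) t).trans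
    (mul_le_mul_of_nonneg_right hK4 (pow_nonneg (p.errRate_nonneg t) 4))
  gcongr
  · exact hu t
  · exact le_max_left _ _

end Valid

end Params

/-! ### Orders of the remainder terms -/

namespace Params

/-- The order in `t`, up to logarithms, of all the terms of lower order. -/
noncomputable def remainder (p : Params) (t : ℕ) : ℝ :=
  (t : ℝ) ^ (-(1 - p.decay + p.noiseExponent)) + (t : ℝ) ^ (-(2 * p.noiseExponent)) +
    (if p.Dnu ≠ 0 then (t : ℝ) ^ (-(p.rho * p.nu + p.noiseExponent)) else 0) + p.biasRate t

/-- The order of the sums `∑_{i ≤ t} n_i x_i` whose average over the `N_t` samples is of order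
`remainder`. -/
noncomputable def remainderSum (p : Params) (t : ℕ) : ℝ :=
  p.total t * ((1 + Real.log t) * p.remainder t)

/-- The weight `n_t / γ_t` of the increment `θ_t - θ_{t-1}` in the linearized recursion. -/
noncomputable def weight (p : Params) (t : ℕ) : ℝ := p.batch t / p.rate t

variable {p : Params}

lemma rpow_one_sub_decay_le_remainder (p : Params) (t : ℕ) :
    (t : ℝ) ^ (-(1 - p.decay + p.noiseExponent)) ≤ p.remainder t := by
  have := p.biasRate_nonneg t
  have : 0 ≤ (t : ℝ) ^ (-(2 * p.noiseExponent)) := by positivity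
  unfold remainder
  split_ifs
  · have : 0 ≤ (t : ℝ) ^ (-(p.rho * p.nu + p.noiseExponent)) := by positivity
    linarith
  · linarith

lemma rpow_two_mul_le_remainder (p : Params) (t : ℕ) :
    (t : ℝ) ^ (-(2 * p.noiseExponent)) ≤ p.remainder t := by
  have := p.biasRate_nonneg t
  have : 0 ≤ (t : ℝ) ^ (-(1 - p.decay + p.noiseExponent)) := by positivity
  unfold remainder
  split_ifs
  · have : 0 ≤ (t : ℝ) ^ (-(p.rho * p.nu + p.noiseExponent)) := by positivity
    linarith
  · linarith

lemma rpow_add_le_remainder (hD : p.Dnu ≠ 0) (t : ℕ) :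
    (t : ℝ) ^ (-(p.rho * p.nu + p.noiseExponent)) ≤ p.remainder t := by
  rw [remainder, if_pos hD]
  exact (le_add_of_nonneg_left (by positivity)).trans
    (le_add_of_nonneg_right (p.biasRate_nonneg t))

lemma biasRate_le_remainder (p : Params) (t : ℕ) : p.biasRate t ≤ p.remainder t := by
  refine le_add_of_nonneg_left (add_nonneg (by positivity) ?_)
  split_ifs <;> positivity

lemma remainder_nonneg (p : Params) (t : ℕ) : 0 ≤ p.remainder t :=
  (p.biasRate_nonneg t).trans (p.biasRate_le_remainder t)

lemma remainderSum_nonneg (p : Params) (t : ℕ) : 0 ≤ p.remainderSum t :=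
  mul_nonneg (Nat.cast_nonneg _) (mul_nonneg (zero_le_one.trans (one_le_one_add_log t))
    (p.remainder_nonneg t))

lemma weight_zero (h : 0 < p.alpha) : p.weight 0 = 0 := by
  rw [weight, rate, Nat.cast_zero, Real.zero_rpow (neg_ne_zero.2 h.ne'), mul_zero, div_zero]

lemma errRate_sq_le (p : Params) (i : ℕ) :
    p.errRate i ^ 2 ≤ 2 * ((((i + 1 : ℕ) : ℝ) ^ (-p.noiseExponent)) ^ 2 +
      p.biasRate (i + 1) ^ 2) :=
  add_sq_le

namespace Valid

lemma biasRate_le_one (hp : p.Valid) {t : ℕ} (ht : 1 ≤ t) : p.biasRate t ≤ 1 := by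
  unfold biasRate
  split_ifs
  · exact Real.rpow_le_one_of_one_le_of_nonpos (by exact_mod_cast ht)
      (neg_nonpos.2 hp.rho_mul_nu_nonneg)
  · exact zero_le_one

lemma errRate_succ_le (hp : p.Valid) (ha : 0 < p.decay) (i : ℕ) :
    p.errRate (i + 1) ≤ p.errRate i := by
  have hle : ((i + 1 : ℕ) : ℝ) ≤ ((i + 1 + 1 : ℕ) : ℝ) := by exact_mod_cast Nat.le_succ _
  have hmono {s : ℝ} (hs : 0 ≤ s) :
      ((i + 1 + 1 : ℕ) : ℝ) ^ (-s) ≤ ((i + 1 : ℕ) : ℝ) ^ (-s) :=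
    Real.rpow_le_rpow_of_nonpos (by positivity) hle (neg_nonpos.2 hs)
  unfold errRate biasRate
  gcongr ?_ + ?_
  · exact hmono (hp.noiseExponent_nonneg ha)
  · split_ifs
    exacts [hmono hp.rho_mul_nu_nonneg, le_rfl]

lemma one_add_log_mul_rpow_add_one_le (hp : p.Valid) (ha : 0 < p.decay) {s : ℝ} {t : ℕ}
    (ht : 1 ≤ t) (hs : (t : ℝ) ^ (-s) ≤ p.remainder t) :
    (1 + Real.log t) * ((t : ℝ) ^ (1 + p.rho - s) + 1) ≤ 4 * p.remainderSum t := by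
  have ht0 : (0 : ℝ) < t := by exact_mod_cast ht
  have htotal : (t : ℝ) ^ (1 + p.rho) ≤ 2 * p.total t := by
    have hC := mul_le_mul_of_nonneg_right hp.one_le_Crho
      (by positivity : 0 ≤ (t : ℝ) ^ (1 + p.rho))
    have hρ := mul_le_mul_of_nonneg_right hp.rho_mem.2.le (hp.total_pos ht).le
    linarith [hp.Crho_mul_rpow_le_mul_total t]
  have hone : (1 : ℝ) ≤ (t : ℝ) ^ (1 + p.rho) * p.remainder t :=
    calc (1 : ℝ) ≤ (t : ℝ) ^ (1 + p.rho) * (t : ℝ) ^ (-(1 - p.decay + p.noiseExponent)) := by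
          rw [← Real.rpow_add ht0, noiseExponent]
          refine Real.one_le_rpow (by exact_mod_cast ht) ?_
          linarith [hp.rho_nonneg, mul_le_mul_of_nonneg_left hp.sigma_mem.2 hp.rho_nonneg]
      _ ≤ _ := by
          gcongr
          exact p.rpow_one_sub_decay_le_remainder t
  have : 0 ≤ 1 + Real.log t := zero_le_one.trans (one_le_one_add_log t)
  have hrem := p.remainder_nonneg t
  calc (1 + Real.log t) * ((t : ℝ) ^ (1 + p.rho - s) + 1)
      ≤ (1 + Real.log t) * ((t : ℝ) ^ (1 + p.rho) * p.remainder t +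
          (t : ℝ) ^ (1 + p.rho) * p.remainder t) := by
        rw [sub_eq_add_neg, Real.rpow_add ht0]
        gcongr
    _ = 2 * (t : ℝ) ^ (1 + p.rho) * ((1 + Real.log t) * p.remainder t) := by ring
    _ ≤ 2 * (2 * p.total t) * ((1 + Real.log t) * p.remainder t) := by gcongr
    _ = 4 * p.remainderSum t := by rw [remainderSum]; ring

lemma sum_batch_mul_rpow_le (hp : p.Valid) (ha : 0 < p.decay) {s : ℝ} {t : ℕ}
    (ht : 1 ≤ t) (hs : (t : ℝ) ^ (-s) ≤ p.remainder t) :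
    ∑ i ∈ Finset.range t, (p.batch (i + 1) : ℝ) * ((i + 1 : ℕ) : ℝ) ^ (-s) ≤
      8 * p.Crho * p.remainderSum t := by
  rw [sum_range_add_one_eq_sum_Icc (fun i => (p.batch i : ℝ) * (i : ℝ) ^ (-s))]
  calc ∑ i ∈ Finset.Icc 1 t, (p.batch i : ℝ) * (i : ℝ) ^ (-s)
      ≤ ∑ i ∈ Finset.Icc 1 t, 2 * p.Crho * (i : ℝ) ^ (p.rho - s) := by
        refine Finset.sum_le_sum fun i hi => ?_
        have hi := (Finset.mem_Icc.1 hi).1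
        rw [sub_eq_add_neg, Real.rpow_add (by exact_mod_cast hi), ← mul_assoc]
        gcongr
        exact hp.batch_le hi
    _ = 2 * p.Crho * ∑ i ∈ Finset.Icc 1 t, (i : ℝ) ^ (p.rho - s) := by rw [Finset.mul_sum]
    _ ≤ 2 * p.Crho * ((1 + Real.log t) * ((t : ℝ) ^ (1 + p.rho - s) + 1)) := by
        rw [add_comm 1 p.rho, add_sub_right_comm]
        gcongr
        exact sum_rpow_le _ t
    _ ≤ 2 * p.Crho * (4 * p.remainderSum t) :=
        mul_le_mul_of_nonneg_left (hp.one_add_log_mul_rpow_add_one_le ha ht hs) (by positivity)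
    _ = _ := by ring

lemma sum_batch_sq_mul_rpow_sq_le (hp : p.Valid) (s : ℝ) (t : ℕ) :
    ∑ i ∈ Finset.range t, (p.batch (i + 1) : ℝ) ^ 2 * (((i + 1 : ℕ) : ℝ) ^ (-s)) ^ 2 ≤
      (2 * p.Crho) ^ 2 * ((1 + Real.log t) * ((t : ℝ) ^ (2 * p.rho - 2 * s + 1) + 1)) := by
  rw [sum_range_add_one_eq_sum_Icc (fun i => (p.batch i : ℝ) ^ 2 * ((i : ℝ) ^ (-s)) ^ 2)]
  calc ∑ i ∈ Finset.Icc 1 t, (p.batch i : ℝ) ^ 2 * ((i : ℝ) ^ (-s)) ^ 2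
      ≤ ∑ i ∈ Finset.Icc 1 t, (2 * p.Crho) ^ 2 * (i : ℝ) ^ (2 * p.rho - 2 * s) := by
        refine Finset.sum_le_sum fun i hi => ?_
        have hi := (Finset.mem_Icc.1 hi).1
        have hi0 : (0 : ℝ) < i := by exact_mod_cast hi
        have hsq : (i : ℝ) ^ (2 * p.rho - 2 * s) = ((i : ℝ) ^ p.rho * (i : ℝ) ^ (-s)) ^ 2 := by
          rw [← Real.rpow_add hi0, ← Real.rpow_mul_natCast hi0.le]
          push_cast
          ring_nf
        rw [hsq, ← mul_pow, ← mul_pow, ← mul_assoc]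
        gcongr
        exact hp.batch_le hi
    _ = (2 * p.Crho) ^ 2 * ∑ i ∈ Finset.Icc 1 t, (i : ℝ) ^ (2 * p.rho - 2 * s) := by
        rw [Finset.mul_sum]
    _ ≤ _ := by
        gcongr
        exact sum_rpow_le _ t

lemma sqrt_sum_batch_sq_mul_rpow_sq_le (hp : p.Valid) (ha : 0 < p.decay) {s : ℝ} {t : ℕ}
    (ht : 1 ≤ t) (hs : (t : ℝ) ^ (-(1 / 2 + s)) ≤ p.remainder t) :
    √(∑ i ∈ Finset.range t, (p.batch (i + 1) : ℝ) ^ 2 * (((i + 1 : ℕ) : ℝ) ^ (-s)) ^ 2) ≤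
      8 * p.Crho * p.remainderSum t := by
  have hlog := one_le_one_add_log t
  have hsq : (t : ℝ) ^ (2 * p.rho - 2 * s + 1) = ((t : ℝ) ^ (1 + p.rho - (1 / 2 + s))) ^ 2 := by
    rw [← Real.rpow_mul_natCast t.cast_nonneg]
    push_cast
    ring_nf
  have hbound := hp.one_add_log_mul_rpow_add_one_le ha ht hs
  set y := (t : ℝ) ^ (1 + p.rho - (1 / 2 + s))
  have hy0 : 0 ≤ y := by positivity
  have hy1 : y ^ 2 + 1 ≤ (y + 1) ^ 2 := by linarith [add_sq y 1]
  have hsum := hp.sum_batch_sq_mul_rpow_sq_le s t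
  rw [hsq] at hsum
  refine Real.sqrt_le_iff.2 ⟨mul_nonneg (by positivity) (p.remainderSum_nonneg t), ?_⟩
  calc _ ≤ (2 * p.Crho) ^ 2 * ((1 + Real.log t) * (y ^ 2 + 1)) := hsum
    _ ≤ (2 * p.Crho : ℝ) ^ 2 * ((1 + Real.log t) ^ 2 * (y + 1) ^ 2) := by
        gcongr
        exact le_self_pow₀ hlog two_ne_zero
    _ = (2 * p.Crho * ((1 + Real.log t) * (y + 1))) ^ 2 := by ring
    _ ≤ (2 * p.Crho * (4 * p.remainderSum t)) ^ 2 := by gcongr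
    _ = _ := by ring

lemma sum_batch_mul_biasRate_le (hp : p.Valid) (ha : 0 < p.decay) {t : ℕ} (ht : 1 ≤ t) :
    ∑ i ∈ Finset.range t, (p.batch (i + 1) : ℝ) * p.biasRate (i + 1) ≤
      8 * p.Crho * p.remainderSum t := by
  rcases eq_or_ne p.Bnu 0 with hB | hB
  · simp only [biasRate_of_Bnu_eq_zero hB, mul_zero, Finset.sum_const_zero]
    exact mul_nonneg (by positivity) (p.remainderSum_nonneg t)
  · have hle := p.biasRate_le_remainder t
    simp only [biasRate_of_Bnu_ne_zero hB] at hle ⊢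
    exact hp.sum_batch_mul_rpow_le ha ht hle

lemma sum_batch_mul_errRate_sq_le (hp : p.Valid) (ha : 0 < p.decay) {t : ℕ} (ht : 1 ≤ t) :
    ∑ i ∈ Finset.range t, (p.batch (i + 1) : ℝ) * p.errRate i ^ 2 ≤
      32 * p.Crho * p.remainderSum t := by
  have hterm (i : ℕ) : (p.batch (i + 1) : ℝ) * p.errRate i ^ 2 ≤
      2 * ((p.batch (i + 1) : ℝ) * ((i + 1 : ℕ) : ℝ) ^ (-(2 * p.noiseExponent))) +
        2 * ((p.batch (i + 1) : ℝ) * p.biasRate (i + 1)) := by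
    have hnoise : ((i + 1 : ℕ) : ℝ) ^ (-(2 * p.noiseExponent)) =
        (((i + 1 : ℕ) : ℝ) ^ (-p.noiseExponent)) ^ 2 := by
      rw [← Real.rpow_mul_natCast (by positivity)]
      push_cast
      ring_nf
    have hbias : p.biasRate (i + 1) ^ 2 ≤ p.biasRate (i + 1) :=
      pow_le_of_le_one (p.biasRate_nonneg _) (hp.biasRate_le_one (Nat.le_add_left 1 i)) two_ne_zero
    rw [hnoise, ← mul_add, ← mul_add, mul_left_comm]
    gcongr
    exact (p.errRate_sq_le i).trans (by gcongr)
  refine (Finset.sum_le_sum fun i _ => hterm i).trans ?_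
  rw [Finset.sum_add_distrib, ← Finset.mul_sum, ← Finset.mul_sum]
  linarith [hp.sum_batch_mul_rpow_le ha ht (p.rpow_two_mul_le_remainder t),
    hp.sum_batch_mul_biasRate_le ha ht]

lemma sqrt_sum_batch_sq_mul_biasRate_sq_le (hp : p.Valid) (ha : 0 < p.decay) {t : ℕ}
    (ht : 1 ≤ t) :
    √(∑ i ∈ Finset.range t, (p.batch (i + 1) : ℝ) ^ 2 * p.biasRate (i + 1) ^ 2) ≤
      8 * p.Crho * p.remainderSum t := by
  rcases eq_or_ne p.Bnu 0 with hB | hB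
  · simp only [biasRate_of_Bnu_eq_zero hB, ne_eq, OfNat.ofNat_ne_zero, not_false_eq_true,
      zero_pow, mul_zero, Finset.sum_const_zero, Real.sqrt_zero]
    exact mul_nonneg (by positivity) (p.remainderSum_nonneg t)
  · have hle := p.biasRate_le_remainder t
    simp only [biasRate_of_Bnu_ne_zero hB] at hle ⊢
    refine hp.sqrt_sum_batch_sq_mul_rpow_sq_le ha ht (le_trans ?_ hle)
    exact Real.rpow_le_rpow_of_exponent_le (by exact_mod_cast ht) (by linarith)

lemma sqrt_sum_batch_sq_mul_errRate_sq_le (hp : p.Valid) (ha : 1 / 2 < p.decay) {t : ℕ}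
    (ht : 1 ≤ t) :
    √(∑ i ∈ Finset.range t, (p.batch (i + 1) : ℝ) ^ 2 * p.errRate i ^ 2) ≤
      32 * p.Crho * p.remainderSum t := by
  have ha0 : 0 < p.decay := one_half_pos.trans ha
  set A := ∑ i ∈ Finset.range t, (p.batch (i + 1) : ℝ) ^ 2 *
    (((i + 1 : ℕ) : ℝ) ^ (-p.noiseExponent)) ^ 2 with hA
  set B := ∑ i ∈ Finset.range t, (p.batch (i + 1) : ℝ) ^ 2 * p.biasRate (i + 1) ^ 2 with hB
  have hsum : ∑ i ∈ Finset.range t, (p.batch (i + 1) : ℝ) ^ 2 * p.errRate i ^ 2 ≤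
      2 ^ 2 * (A + B) :=
    calc _ ≤ ∑ i ∈ Finset.range t, (p.batch (i + 1) : ℝ) ^ 2 *
          (2 * ((((i + 1 : ℕ) : ℝ) ^ (-p.noiseExponent)) ^ 2 + p.biasRate (i + 1) ^ 2)) :=
          Finset.sum_le_sum fun i _ =>
            mul_le_mul_of_nonneg_left (p.errRate_sq_le i) (by positivity)
      _ = 2 * (A + B) := by
          rw [hA, hB, ← Finset.sum_add_distrib, Finset.mul_sum]
          exact Finset.sum_congr rfl fun i _ => by ring
      _ ≤ 2 ^ 2 * (A + B) := by
          gcongr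
          norm_num
  have hnoise : √A ≤ 8 * p.Crho * p.remainderSum t :=
    hp.sqrt_sum_batch_sq_mul_rpow_sq_le ha0 ht <|
      (Real.rpow_le_rpow_of_exponent_le (by exact_mod_cast ht) (by linarith)).trans
        (p.rpow_one_sub_decay_le_remainder t)
  have hbias : √B ≤ 8 * p.Crho * p.remainderSum t :=
    hp.sqrt_sum_batch_sq_mul_biasRate_sq_le ha0 ht
  have hadd : √(A + B) ≤ √A + √B := sqrt_add_le_sqrt_add_sqrt (by positivity) (by positivity)
  calc _ ≤ √(2 ^ 2 * (A + B)) := Real.sqrt_le_sqrt hsum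
    _ = 2 * √(A + B) := by rw [Real.sqrt_mul (by positivity), Real.sqrt_sq two_pos.le]
    _ ≤ _ := by linarith

lemma depRate_mul_add_le (hp : p.Valid) {K : ℝ} (hK : 0 ≤ K) (i : ℕ) :
    p.depRate (i + 1) * (p.Dnu * (K * p.errRate i) + p.Bnu) ≤
      p.Dnu * K * ((i + 1 : ℕ) : ℝ) ^ (-(p.rho * p.nu + p.noiseExponent)) +
        (p.Dnu * K + p.Bnu) * p.biasRate (i + 1) := by
  have hD := hp.Dnu_nonneg
  have hB := hp.Bnu_nonneg
  have hdep := hp.depRate_le (Nat.le_add_left 1 i)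
  have hy1 : ((i + 1 : ℕ) : ℝ) ^ (-(p.rho * p.nu)) ≤ 1 :=
    Real.rpow_le_one_of_one_le_of_nonpos (by exact_mod_cast Nat.le_add_left 1 i)
      (neg_nonpos.2 hp.rho_mul_nu_nonneg)
  have herr := p.errRate_nonneg i
  have hbias := p.biasRate_nonneg (i + 1)
  have hBbias : ((i + 1 : ℕ) : ℝ) ^ (-(p.rho * p.nu)) * p.Bnu = p.Bnu * p.biasRate (i + 1) := by
    rcases eq_or_ne p.Bnu 0 with h | h
    · rw [h, mul_zero, zero_mul]
    · rw [biasRate_of_Bnu_ne_zero h, mul_comm]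
  calc p.depRate (i + 1) * (p.Dnu * (K * p.errRate i) + p.Bnu)
      ≤ ((i + 1 : ℕ) : ℝ) ^ (-(p.rho * p.nu)) * (p.Dnu * (K * p.errRate i) + p.Bnu) := by
        gcongr
    _ = p.Dnu * K * ((i + 1 : ℕ) : ℝ) ^ (-(p.rho * p.nu + p.noiseExponent)) +
          (p.Dnu * K * (((i + 1 : ℕ) : ℝ) ^ (-(p.rho * p.nu)) * p.biasRate (i + 1)) +
            p.Bnu * p.biasRate (i + 1)) := by
        rw [neg_add, Real.rpow_add (by positivity), mul_add, hBbias, errRate]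
        ring
    _ ≤ p.Dnu * K * ((i + 1 : ℕ) : ℝ) ^ (-(p.rho * p.nu + p.noiseExponent)) +
          (p.Dnu * K * p.biasRate (i + 1) + p.Bnu * p.biasRate (i + 1)) := by
        gcongr
        exact mul_le_of_le_one_left hbias hy1
    _ = _ := by ring

lemma sum_batch_mul_depRate_mul_le (hp : p.Valid) (ha : 0 < p.decay) {K : ℝ} (hK : 0 ≤ K)
    {t : ℕ} (ht : 1 ≤ t) :
    ∑ i ∈ Finset.range t, (p.batch (i + 1) : ℝ) *
        (p.depRate (i + 1) * (p.Dnu * (K * p.errRate i) + p.Bnu)) ≤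
      8 * p.Crho * (2 * p.Dnu * K + p.Bnu) * p.remainderSum t := by
  have hD := hp.Dnu_nonneg
  have hB := hp.Bnu_nonneg
  have hlinear : p.Dnu * K * ∑ i ∈ Finset.range t, (p.batch (i + 1) : ℝ) *
      ((i + 1 : ℕ) : ℝ) ^ (-(p.rho * p.nu + p.noiseExponent)) ≤
        p.Dnu * K * (8 * p.Crho * p.remainderSum t) := by
    rcases eq_or_ne p.Dnu 0 with hD0 | hD0
    · simp only [hD0, zero_mul, le_refl]
    · gcongr
      exact hp.sum_batch_mul_rpow_le ha ht (rpow_add_le_remainder hD0 t)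
  calc _ ≤ ∑ i ∈ Finset.range t, (p.batch (i + 1) : ℝ) *
          (p.Dnu * K * ((i + 1 : ℕ) : ℝ) ^ (-(p.rho * p.nu + p.noiseExponent)) +
            (p.Dnu * K + p.Bnu) * p.biasRate (i + 1)) := by
        gcongr with i _
        exact hp.depRate_mul_add_le hK i
    _ = p.Dnu * K * ∑ i ∈ Finset.range t, (p.batch (i + 1) : ℝ) *
          ((i + 1 : ℕ) : ℝ) ^ (-(p.rho * p.nu + p.noiseExponent)) +
        (p.Dnu * K + p.Bnu) *
          ∑ i ∈ Finset.range t, (p.batch (i + 1) : ℝ) * p.biasRate (i + 1) := by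
        rw [Finset.mul_sum, Finset.mul_sum, ← Finset.sum_add_distrib]
        exact Finset.sum_congr rfl fun i _ => by ring
    _ ≤ p.Dnu * K * (8 * p.Crho * p.remainderSum t) +
        (p.Dnu * K + p.Bnu) * (8 * p.Crho * p.remainderSum t) := by
        gcongr
        exact hp.sum_batch_mul_biasRate_le ha ht
    _ = _ := by ring

lemma alpha_pos (hp : p.Valid) (ha : 0 < p.decay) : 0 < p.alpha := by
  have := mul_nonneg hp.rho_nonneg hp.beta_mem.1
  unfold decay at ha
  linarith

lemma weight_eq (hp : p.Valid) {t : ℕ} (ht : 1 ≤ t) :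
    p.weight t = p.Cgamma⁻¹ * ((p.batch t : ℝ) ^ (1 - p.beta) * (t : ℝ) ^ p.alpha) := by
  have ht0 : (0 : ℝ) < t := by exact_mod_cast ht
  have hb := hp.batch_pos ht
  have hg := hp.Cgamma_pos
  rw [weight, rate, Real.rpow_neg ht0.le, Real.rpow_sub hb, Real.rpow_one]
  field_simp

lemma weight_nonneg (hp : p.Valid) (ha : 0 < p.decay) (t : ℕ) : 0 ≤ p.weight t := by
  rcases t.eq_zero_or_pos with rfl | ht
  · exact (weight_zero (hp.alpha_pos ha)).ge
  · exact div_nonneg (hp.batch_pos ht).le (hp.rate_pos ht).le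

lemma weight_le_succ (hp : p.Valid) (ha : 0 < p.decay) (t : ℕ) :
    p.weight t ≤ p.weight (t + 1) := by
  have hα := hp.alpha_pos ha
  rcases t.eq_zero_or_pos with rfl | ht
  · exact (weight_zero hα).trans_le (hp.weight_nonneg ha _)
  · have hbatch : (p.batch t : ℝ) ≤ p.batch (t + 1) := by
      exact_mod_cast hp.batch_mono t.le_succ
    have hβ : 0 ≤ 1 - p.beta := sub_nonneg.2 hp.beta_mem.2
    have := hp.Cgamma_pos
    rw [hp.weight_eq ht, hp.weight_eq (Nat.le_add_left 1 t)]
    gcongr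
    exact t.le_succ

lemma weight_le (hp : p.Valid) {t : ℕ} (ht : 1 ≤ t) :
    p.weight t ≤ p.Cgamma⁻¹ * (2 * p.Crho) ^ (1 - p.beta) * (t : ℝ) ^ (p.decay + p.rho) := by
  have ht0 : (0 : ℝ) < t := by exact_mod_cast ht
  have := hp.Cgamma_pos
  have hbatch : (p.batch t : ℝ) ^ (1 - p.beta) ≤
      (2 * p.Crho) ^ (1 - p.beta) * (t : ℝ) ^ (p.rho * (1 - p.beta)) := by
    rw [Real.rpow_mul ht0.le, ← Real.mul_rpow (by positivity) (by positivity)]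
    exact Real.rpow_le_rpow (by positivity) (hp.batch_le ht) (sub_nonneg.2 hp.beta_mem.2)
  have hexp : p.decay + p.rho = p.rho * (1 - p.beta) + p.alpha := by rw [decay]; ring
  calc p.weight t ≤ p.Cgamma⁻¹ * ((2 * p.Crho) ^ (1 - p.beta) *
        (t : ℝ) ^ (p.rho * (1 - p.beta)) * (t : ℝ) ^ p.alpha) := by
        rw [hp.weight_eq ht]
        gcongr
    _ = _ := by rw [hexp, Real.rpow_add ht0]; ring

lemma sum_weight_sub_mul_rpow_le (hp : p.Valid) (ha : 0 < p.decay) {s : ℝ} (hs : 0 ≤ s) {t : ℕ}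
    (ht : 1 ≤ t) (hrem : (t : ℝ) ^ (-(1 - p.decay + s)) ≤ p.remainder t) :
    ∑ i ∈ Finset.range t, (p.weight (i + 1) - p.weight i) * ((i + 1 : ℕ) : ℝ) ^ (-s) +
        p.weight t * ((t + 1 : ℕ) : ℝ) ^ (-s) ≤
      4 * (p.Cgamma⁻¹ * (2 * p.Crho) ^ (1 - p.beta) * (s + 2)) * p.remainderSum t := by
  have hW : 0 ≤ p.Cgamma⁻¹ * (2 * (p.Crho : ℝ)) ^ (1 - p.beta) :=
    mul_nonneg (inv_nonneg.2 hp.Cgamma_pos.le) (by positivity)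
  refine (sum_sub_mul_rpow_neg_le (weight_zero (hp.alpha_pos ha)) (fun i hi => hp.weight_le hi)
    hW hs ht).trans ?_
  have hbound := hp.one_add_log_mul_rpow_add_one_le ha ht hrem
  rw [show 1 + p.rho - (1 - p.decay + s) = p.decay + p.rho - s by ring] at hbound
  calc _ ≤ p.Cgamma⁻¹ * (2 * (p.Crho : ℝ)) ^ (1 - p.beta) * (s + 2) * (4 * p.remainderSum t) := by
        gcongr
    _ = _ := by ring

lemma sum_weight_sub_mul_biasRate_le (hp : p.Valid) (ha : 0 < p.decay) (ha1 : p.decay < 1)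
    {t : ℕ} (ht : 1 ≤ t) :
    ∑ i ∈ Finset.range t, (p.weight (i + 1) - p.weight i) * p.biasRate (i + 1) +
        p.weight t * p.biasRate (t + 1) ≤
      4 * (p.Cgamma⁻¹ * (2 * p.Crho) ^ (1 - p.beta) * (p.rho * p.nu + 2)) *
        p.remainderSum t := by
  rcases eq_or_ne p.Bnu 0 with hB | hB
  · simp only [biasRate_of_Bnu_eq_zero hB, mul_zero, Finset.sum_const_zero, add_zero]
    have := hp.Cgamma_pos
    have := hp.rho_mul_nu_nonneg
    exact mul_nonneg (by positivity) (p.remainderSum_nonneg t)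
  · have hle := p.biasRate_le_remainder t
    simp only [biasRate_of_Bnu_ne_zero hB] at hle ⊢
    refine hp.sum_weight_sub_mul_rpow_le ha hp.rho_mul_nu_nonneg ht (le_trans ?_ hle)
    exact Real.rpow_le_rpow_of_exponent_le (by exact_mod_cast ht) (by linarith)

lemma exists_sum_weight_sub_mul_errRate_le (hp : p.Valid) (ha : 0 < p.decay)
    (ha1 : p.decay < 1) :
    ∃ K : ℝ, 0 ≤ K ∧ ∀ t : ℕ, 1 ≤ t →
      ∑ i ∈ Finset.range t, (p.weight (i + 1) - p.weight i) * p.errRate i +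
        p.weight t * p.errRate t ≤ K * p.remainderSum t := by
  have hs := hp.noiseExponent_nonneg ha
  have hν := hp.rho_mul_nu_nonneg
  have hγ := hp.Cgamma_pos
  refine ⟨4 * (p.Cgamma⁻¹ * (2 * p.Crho) ^ (1 - p.beta) * (p.noiseExponent + 2)) +
    4 * (p.Cgamma⁻¹ * (2 * p.Crho) ^ (1 - p.beta) * (p.rho * p.nu + 2)), by positivity,
    fun t ht => ?_⟩
  have hnoise := hp.sum_weight_sub_mul_rpow_le ha hs ht (p.rpow_one_sub_decay_le_remainder t)
  have hbias := hp.sum_weight_sub_mul_biasRate_le ha ha1 ht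
  simp only [errRate, mul_add, Finset.sum_add_distrib] at *
  linarith

end Valid

/-- The order in `N_t` of the remainder that is present even for unbiased gradients. -/
noncomputable def orderMain (p : Params) (t : ℕ) : ℝ := max
  ((p.total t : ℝ) ^
    (-((2 + p.rho * (2 * p.sigma + p.beta) - p.alpha) / (2 * (1 + p.rho)))))
  ((p.total t : ℝ) ^
    (-((p.rho * (2 * p.sigma - p.beta) + p.alpha) / (1 + p.rho))))

/-- The order in `N_t` of the remainder due to the part of the bias controlled by `D_ν`. -/
noncomputable def orderDep (p : Params) (t : ℕ) : ℝ :=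
  (p.total t : ℝ) ^ (-((p.delta + p.rho * p.nu) / (2 * (1 + p.rho))))

/-- The order `Ψ_t` in `N_t` of the remainder due to the part of the bias controlled by `B_ν`. -/
noncomputable def orderBias (p : Params) (t : ℕ) : ℝ :=
  max ((p.total t : ℝ) ^ (-(p.rho * (p.sigma + p.nu) / (2 * (1 + p.rho)))))
  (max ((p.total t : ℝ) ^
    (-((1 + p.rho * (p.beta + p.nu) - p.alpha) / (1 + p.rho))))
  (max ((p.total t : ℝ) ^ (-((1 + 2 * p.rho * p.nu) / (2 * (1 + p.rho)))))
  (max ((p.total t : ℝ) ^ (-((p.delta / 2 + p.rho * p.nu) / (2 * (1 + p.rho)))))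
    ((p.total t : ℝ) ^ (-(2 * p.rho * p.nu / (1 + p.rho)))))))

/-- The constant lost in replacing a bound of order `t^{-s}` by one of order
`N_t^{-s / (1 + ρ)}`. -/
noncomputable def conversionConst (p : Params) (s : ℝ) : ℝ :=
  (2 * p.Crho : ℝ) ^ (s / (1 + p.rho))

lemma conversionConst_nonneg (p : Params) (s : ℝ) : 0 ≤ p.conversionConst s := by
  unfold conversionConst
  positivity

lemma orderMain_nonneg (p : Params) (t : ℕ) : 0 ≤ p.orderMain t :=
  le_max_of_le_left (by positivity)

lemma orderDep_nonneg (p : Params) (t : ℕ) : 0 ≤ p.orderDep t := by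
  unfold orderDep
  positivity

lemma orderBias_nonneg (p : Params) (t : ℕ) : 0 ≤ p.orderBias t :=
  le_max_of_le_left (by positivity)

lemma isSoftO_mul_log {K : ℝ} (hK : 0 ≤ K) {v : ℕ → ℝ} (hv : ∀ t, 0 ≤ v t) :
    p.IsSoftO (fun t => K * (1 + Real.log (p.total t : ℝ)) * v t) v := by
  refine ⟨K, 1, fun t _ => ?_⟩
  have := zero_le_one.trans (one_le_one_add_log (p.total t))
  have := hv t
  rw [pow_one, abs_of_nonneg (by positivity)]

lemma delta_le (p : Params) : p.delta ≤ 2 * p.noiseExponent := by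
  have hexp : p.rho * (2 * p.sigma - p.beta) + p.alpha = 2 * p.noiseExponent := by
    rw [noiseExponent, decay]
    ring
  unfold delta
  split_ifs
  exacts [hexp.le, (min_le_left _ _).trans hexp.le]

lemma delta_le_of_Bnu_ne_zero (hB : p.Bnu ≠ 0) : p.delta ≤ 2 * (p.rho * p.nu) := by
  rw [delta, if_neg hB, ← mul_assoc]
  exact min_le_right _ _

namespace Valid

lemma rpow_neg_le_conversionConst_mul (hp : p.Valid) {s r : ℝ} (hs : 0 ≤ s) (hr : r ≤ s) {t : ℕ}
    (ht : 1 ≤ t) :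
    (t : ℝ) ^ (-s) ≤ p.conversionConst s * (p.total t : ℝ) ^ (-(r / (1 + p.rho))) := by
  have ht0 : (0 : ℝ) < t := by exact_mod_cast ht
  have hN := hp.total_pos ht
  have hρ := hp.one_add_rho_pos
  have htotal : (p.total t : ℝ) ^ (s / (1 + p.rho)) ≤ p.conversionConst s * (t : ℝ) ^ s := by
    have h := Real.rpow_le_rpow hN.le (hp.total_le ht) (by positivity : 0 ≤ s / (1 + p.rho))
    rwa [Real.mul_rpow (by positivity) (by positivity), ← Real.rpow_mul ht0.le,
      mul_div_cancel₀ _ hρ.ne'] at h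
  calc (t : ℝ) ^ (-s) ≤ p.conversionConst s * (p.total t : ℝ) ^ (-(s / (1 + p.rho))) := by
        rw [Real.rpow_neg ht0.le, Real.rpow_neg hN.le, ← div_eq_mul_inv,
          le_div_iff₀ (by positivity), inv_mul_le_iff₀ (by positivity), mul_comm]
        exact htotal
    _ ≤ _ := by
        gcongr
        · exact p.conversionConst_nonneg s
        · exact_mod_cast hp.one_le_total ht

lemma rpow_one_sub_decay_le_orderMain (hp : p.Valid) (ha : 0 < p.decay) (ha1 : p.decay < 1)
    {t : ℕ} (ht : 1 ≤ t) :
    (t : ℝ) ^ (-(1 - p.decay + p.noiseExponent)) ≤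
      p.conversionConst (1 - p.decay + p.noiseExponent) * p.orderMain t := by
  have := hp.one_add_rho_pos
  refine (hp.rpow_neg_le_conversionConst_mul (by linarith [hp.noiseExponent_nonneg ha]) le_rfl
    ht).trans (mul_le_mul_of_nonneg_left ?_ (p.conversionConst_nonneg _))
  refine le_trans (le_of_eq ?_) (le_max_left _ _)
  rw [noiseExponent, decay]
  congr 2
  field_simp
  ring

lemma rpow_two_mul_le_orderMain (hp : p.Valid) (ha : 0 < p.decay) {t : ℕ} (ht : 1 ≤ t) :
    (t : ℝ) ^ (-(2 * p.noiseExponent)) ≤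
      p.conversionConst (2 * p.noiseExponent) * p.orderMain t := by
  refine (hp.rpow_neg_le_conversionConst_mul (by linarith [hp.noiseExponent_nonneg ha]) le_rfl
    ht).trans (mul_le_mul_of_nonneg_left ?_ (p.conversionConst_nonneg _))
  refine le_trans (le_of_eq ?_) (le_max_right _ _)
  rw [noiseExponent, decay]
  ring_nf

lemma rpow_add_le_orderDep (hp : p.Valid) (ha : 0 < p.decay) {t : ℕ} (ht : 1 ≤ t) :
    (t : ℝ) ^ (-(p.rho * p.nu + p.noiseExponent)) ≤
      p.conversionConst (p.rho * p.nu + p.noiseExponent) * p.orderDep t := by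
  have hs := hp.noiseExponent_nonneg ha
  have hν := hp.rho_mul_nu_nonneg
  rw [orderDep, ← div_div]
  exact hp.rpow_neg_le_conversionConst_mul (by linarith) (by linarith [p.delta_le]) ht

lemma biasRate_le_orderBias (hp : p.Valid) {t : ℕ} (ht : 1 ≤ t) : p.biasRate t ≤
    if p.Bnu ≠ 0 then p.conversionConst (p.rho * p.nu) * p.orderBias t else 0 := by
  unfold biasRate
  split_ifs with hB
  · refine (hp.rpow_neg_le_conversionConst_mul (r := (p.delta / 2 + p.rho * p.nu) / 2)
      hp.rho_mul_nu_nonneg (by linarith [delta_le_of_Bnu_ne_zero hB]) ht).trans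
      (mul_le_mul_of_nonneg_left ?_ (p.conversionConst_nonneg _))
    rw [div_div]
    exact (le_max_left _ _).trans ((le_max_right _ _).trans
      ((le_max_right _ _).trans (le_max_right _ _)))
  · exact le_rfl

lemma remainder_le (hp : p.Valid) (ha : 0 < p.decay) (ha1 : p.decay < 1) {t : ℕ} (ht : 1 ≤ t) :
    p.remainder t ≤
      (p.conversionConst (1 - p.decay + p.noiseExponent) +
        p.conversionConst (2 * p.noiseExponent)) * p.orderMain t +
      (if p.Dnu ≠ 0 then
        p.conversionConst (p.rho * p.nu + p.noiseExponent) * p.orderDep t else 0) +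
      (if p.Bnu ≠ 0 then p.conversionConst (p.rho * p.nu) * p.orderBias t else 0) := by
  rw [remainder, add_mul]
  gcongr
  · exact hp.rpow_one_sub_decay_le_orderMain ha ha1 ht
  · exact hp.rpow_two_mul_le_orderMain ha ht
  · split_ifs
    exacts [hp.rpow_add_le_orderDep ha ht, le_rfl]
  · exact hp.biasRate_le_orderBias ht

lemma sqrt_sum_batch_rpow_div_total_le (hp : p.Valid) {s c : ℝ} (hs0 : 0 ≤ s) (hs1 : s ≤ 1)
    (hc : 0 ≤ c) {t : ℕ} (ht : 1 ≤ t) :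
    √(c * ∑ i ∈ Finset.Icc 1 t, (p.batch i : ℝ) ^ (2 - 2 * s)) / p.total t ≤
      √2 * √c * (p.Crho : ℝ) ^ ((1 - 2 * s) / (2 * (1 + p.rho))) /
        (p.total t : ℝ) ^ ((1 + 2 * p.rho * s) / (2 * (1 + p.rho))) := by
  have hN := hp.total_pos ht
  have hC := hp.cast_Crho_pos
  have hρ := hp.one_add_rho_pos
  have hCsq : (p.Crho : ℝ) ^ ((1 - 2 * s) / (1 + p.rho)) =
      ((p.Crho : ℝ) ^ ((1 - 2 * s) / (2 * (1 + p.rho)))) ^ 2 := by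
    rw [← Real.rpow_mul_natCast hC.le]
    congr 1
    push_cast
    field_simp
  have hNsq : (p.total t : ℝ) ^ (2 - (1 + 2 * p.rho * s) / (1 + p.rho)) =
      ((p.total t : ℝ) / (p.total t : ℝ) ^ ((1 + 2 * p.rho * s) / (2 * (1 + p.rho)))) ^ 2 := by
    rw [div_pow, ← Real.rpow_mul_natCast hN.le, Real.rpow_sub hN]
    push_cast
    congr 1
    · norm_num
    · field_simp
  have hsum := mul_le_mul_of_nonneg_left (hp.sum_batch_rpow_le hs0 hs1 ht) hc
  refine (div_le_div_of_nonneg_right (Real.sqrt_le_sqrt hsum) hN.le).trans_eq ?_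
  rw [hCsq, hNsq, ← mul_assoc, ← mul_assoc, Real.sqrt_mul (by positivity),
    Real.sqrt_mul (by positivity), Real.sqrt_sq (by positivity), Real.sqrt_sq (by positivity),
    mul_comm c, Real.sqrt_mul two_pos.le]
  field_simp

lemma exists_one_add_log_mul_remainder_le (hp : p.Valid) (ha : 0 < p.decay) (ha1 : p.decay < 1) :
    ∃ C₁ C₂ C₃ : ℝ, 0 ≤ C₁ ∧ 0 ≤ C₂ ∧ 0 ≤ C₃ ∧ ∀ t : ℕ, 1 ≤ t →
      (1 + Real.log t) * p.remainder t ≤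
        C₁ * (1 + Real.log (p.total t : ℝ)) * p.orderMain t +
        (if p.Dnu ≠ 0 then C₂ * (1 + Real.log (p.total t : ℝ)) * p.orderDep t else 0) +
        (if p.Bnu ≠ 0 then C₃ * (1 + Real.log (p.total t : ℝ)) * p.orderBias t else 0) := by
  refine ⟨p.conversionConst (1 - p.decay + p.noiseExponent) +
      p.conversionConst (2 * p.noiseExponent),
    p.conversionConst (p.rho * p.nu + p.noiseExponent), p.conversionConst (p.rho * p.nu),
    add_nonneg (p.conversionConst_nonneg _) (p.conversionConst_nonneg _),
    p.conversionConst_nonneg _, p.conversionConst_nonneg _, fun t ht => ?_⟩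
  have hlog : 1 + Real.log t ≤ 1 + Real.log (p.total t : ℝ) :=
    add_le_add_right (Real.log_le_log (by positivity) (hp.natCast_le_total t)) 1
  refine (mul_le_mul hlog (hp.remainder_le ha ha1 ht) (p.remainder_nonneg t)
    (zero_le_one.trans (one_le_one_add_log (p.total t)))).trans_eq ?_
  split_ifs <;> ring

end Valid

end Params

/-! ### Fourth moments of the iterates -/

section Model

variable {d : ℕ} {Ω : Type*}

/-- The displacement of the `(i + 1)`-st iterate caused by the projection. -/
noncomputable def overshoot (p : Params)
    (g : ℕ → Ω → EuclideanSpace ℝ (Fin d) → EuclideanSpace ℝ (Fin d))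
    (θ : ℕ → Ω → EuclideanSpace ℝ (Fin d)) (i : ℕ) (ω : Ω) : EuclideanSpace ℝ (Fin d) :=
  θ (i + 1) ω - (θ i ω - p.rate (i + 1) • g (i + 1) ω (θ i ω))

/-- A stochastic gradient recursion with gradient estimates `g` for the objective `F`. The
unprojected recursion is the projected one with `Θ = univ`, so that both are covered by `IsPSSG`;
the bounded gradients of the projected recursion enter only through the bound on the overshoot. -/
structure Model [mΩ : MeasurableSpace Ω] (p : Params) (P : Measure Ω) (𝓕 : Filtration ℕ mΩ)
    (Θ : Set (EuclideanSpace ℝ (Fin d)))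
    (g : ℕ → Ω → EuclideanSpace ℝ (Fin d) → EuclideanSpace ℝ (Fin d))
    (F : EuclideanSpace ℝ (Fin d) → ℝ) (θs : EuclideanSpace ℝ (Fin d))
    (θ : ℕ → Ω → EuclideanSpace ℝ (Fin d)) : Prop where
  isClosed : IsClosed Θ
  convex : Convex ℝ Θ
  mem_interior : θs ∈ interior Θ
  isMin : ∀ η, F θs ≤ F η
  quasiConvex : QuasiStronglyConvex p Θ F θs
  smooth : Smooth p Θ F θs
  depBias : DependenceBias p 4 P 𝓕 Θ g F θs
  expSmooth : ExpectedSmooth p 4 P 𝓕 Θ g θs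
  noise : GradientNoise p 4 P g θs
  measurable_gradient : ∀ t : ℕ, 1 ≤ t → ∀ ϑ : Ω → EuclideanSpace ℝ (Fin d),
    Measurable[𝓕 t] ϑ → Measurable[𝓕 t] fun ω => g t ω (ϑ ω)
  measurable_init : Measurable[𝓕 0] (θ 0)
  memLp_init : MemLp (θ 0) 4 P
  integral_init_le : ∫ ω, ‖θ 0 ω - θs‖ ^ 4 ∂P ≤ p.Delta0
  recursion : IsPSSG p Θ g θ
  norm_overshoot_le : ∀ i : ℕ, ∀ᵐ ω ∂P,
    ‖overshoot p g θ i ω‖ ≤ p.rate (i + 1) * (|p.G| / p.DTheta ^ 2) * ‖θ (i + 1) ω - θs‖ ^ 2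

variable {p : Params} {Θ : Set (EuclideanSpace ℝ (Fin d))}
  {g : ℕ → Ω → EuclideanSpace ℝ (Fin d) → EuclideanSpace ℝ (Fin d)}
  {F : EuclideanSpace ℝ (Fin d) → ℝ} {θs : EuclideanSpace ℝ (Fin d)}
  {θ : ℕ → Ω → EuclideanSpace ℝ (Fin d)}

lemma IsPSSG.mem (h : IsPSSG p Θ g θ) (t : ℕ) (ω : Ω) : θ t ω ∈ Θ := by
  cases t with
  | zero => exact h.1 ω
  | succ t => exact (h.2 t ω).1

variable [mΩ : MeasurableSpace Ω] {P : Measure Ω} {𝓕 : Filtration ℕ mΩ}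

namespace Model

lemma minimizer_mem (h : Model p P 𝓕 Θ g F θs θ) : θs ∈ Θ := interior_subset h.mem_interior

lemma iterate_mem (h : Model p P 𝓕 Θ g F θs θ) (t : ℕ) (ω : Ω) : θ t ω ∈ Θ :=
  h.recursion.mem t ω

lemma measurable_iterate (h : Model p P 𝓕 Θ g F θs θ) (t : ℕ) : Measurable[𝓕 t] (θ t) := by
  induction t with
  | zero => exact h.measurable_init
  | succ t ih =>
    have hθ : Measurable[𝓕 (t + 1)] (θ t) := ih.mono (𝓕.mono t.le_succ) le_rfl
    have hg := h.measurable_gradient (t + 1) (Nat.le_add_left 1 t) (θ t) hθ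
    refine measurable_of_isProjection (m := 𝓕 (t + 1)) h.convex h.isClosed
      (X := fun ω => θ t ω - p.rate (t + 1) • g (t + 1) ω (θ t ω)) ?_ (h.recursion.2 t)
    exact Measurable.sub (m := 𝓕 (t + 1)) hθ
      (Measurable.const_smul (m := 𝓕 (t + 1)) hg (p.rate (t + 1)))

lemma stronglyMeasurable_gradient (h : Model p P 𝓕 Θ g F θs θ) (t : ℕ) :
    StronglyMeasurable[𝓕 (t + 1)] fun ω => g (t + 1) ω (θ t ω) :=
  (h.measurable_gradient (t + 1) (Nat.le_add_left 1 t) (θ t)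
    ((h.measurable_iterate t).mono (𝓕.mono t.le_succ) le_rfl)).stronglyMeasurable

lemma stronglyMeasurable_score (h : Model p P 𝓕 Θ g F θs θ) (t : ℕ) :
    StronglyMeasurable[𝓕 (t + 1)] fun ω => g (t + 1) ω θs :=
  (h.measurable_gradient (t + 1) (Nat.le_add_left 1 t) (fun _ => θs)
    measurable_const).stronglyMeasurable

lemma memLp_score (h : Model p P 𝓕 Θ g F θs θ) (t : ℕ) :
    MemLp (fun ω => g (t + 1) ω θs) 4 P :=
  memLp_four_of_integrable ((h.stronglyMeasurable_score t).mono (𝓕.le _)).aestronglyMeasurable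
    (h.noise (t + 1) (Nat.le_add_left 1 t)).1

lemma norm_error_succ_le (h : Model p P 𝓕 Θ g F θs θ) (t : ℕ) (ω : Ω) :
    ‖θ (t + 1) ω - θs‖ ≤ ‖(θ t ω - θs) - p.rate (t + 1) • g (t + 1) ω (θ t ω)‖ := by
  have hproj := (h.recursion.2 t ω).norm_sub_le h.convex (isProjection_self h.minimizer_mem)
  rwa [sub_right_comm] at hproj

lemma memLp_gradient_of_memLp (h : Model p P 𝓕 Θ g F θs θ) {t : ℕ} (ht : MemLp (θ t) 4 P) :
    MemLp (fun ω => g (t + 1) ω (θ t ω)) 4 P := by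
  have hint := (h.expSmooth (t + 1) (Nat.le_add_left 1 t) (θ t) (h.measurable_iterate t)
    (h.iterate_mem t) (by exact_mod_cast ht)).1
  have hdiff : MemLp (fun ω => g (t + 1) ω (θ t ω) - g (t + 1) ω θs) 4 P :=
    memLp_four_of_integrable (((h.stronglyMeasurable_gradient t).sub
      (h.stronglyMeasurable_score t)).mono (𝓕.le _)).aestronglyMeasurable hint
  refine (hdiff.add (h.memLp_score t)).congr_norm
    ((h.stronglyMeasurable_gradient t).mono (𝓕.le _)).aestronglyMeasurable (ae_of_all P fun ω => ?_)
  rw [Pi.add_apply, sub_add_cancel]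

variable [IsProbabilityMeasure P]

lemma memLp_iterate (h : Model p P 𝓕 Θ g F θs θ) (t : ℕ) : MemLp (θ t) 4 P := by
  induction t with
  | zero => exact h.memLp_init
  | succ t ih =>
    have hc : MemLp (fun _ : Ω => θs) 4 P := memLp_const θs
    have hm : AEStronglyMeasurable (θ (t + 1)) P :=
      ((h.measurable_iterate (t + 1)).stronglyMeasurable.mono (𝓕.le _)).aestronglyMeasurable
    have herr : MemLp (fun ω => θ (t + 1) ω - θs) 4 P :=
      ((ih.sub hc).sub ((h.memLp_gradient_of_memLp ih).const_smul (p.rate (t + 1)))).of_le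
        (hm.sub aestronglyMeasurable_const) (ae_of_all P fun ω => h.norm_error_succ_le t ω)
    refine (herr.add hc).congr_norm hm (ae_of_all P fun ω => ?_)
    rw [Pi.add_apply, sub_add_cancel]

lemma memLp_error (h : Model p P 𝓕 Θ g F θs θ) (t : ℕ) : MemLp (fun ω => θ t ω - θs) 4 P :=
  (h.memLp_iterate t).sub (memLp_const θs)

lemma memLp_gradient (h : Model p P 𝓕 Θ g F θs θ) (t : ℕ) :
    MemLp (fun ω => g (t + 1) ω (θ t ω)) 4 P :=
  h.memLp_gradient_of_memLp (h.memLp_iterate t)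

lemma integral_norm_error_pow_four_succ_le (hp : p.Valid) (hmu : 0 < p.muNu)
    (h : Model p P 𝓕 Θ g F θs θ) (t : ℕ) :
    ∫ ω, ‖θ (t + 1) ω - θs‖ ^ 4 ∂P ≤
      p.contraction (t + 1) * ∫ ω, ‖θ t ω - θs‖ ^ 4 ∂P + p.forcing (t + 1) := by
  have hdep := h.depBias (t + 1) (Nat.le_add_left 1 t) (θ t) (h.measurable_iterate t)
    (h.iterate_mem t) (by exact_mod_cast h.memLp_iterate t)
  have hexp := h.expSmooth (t + 1) (Nat.le_add_left 1 t) (θ t) (h.measurable_iterate t)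
    (h.iterate_mem t) (by exact_mod_cast h.memLp_iterate t)
  have hbias : ∫ ω, ‖(P[fun ω => g (t + 1) ω (θ t ω) | 𝓕 t]) ω - gradient F (θ t ω)‖ ^ 4 ∂P ≤
      (p.depRate (t + 1) * p.Dnu) ^ 4 * ∫ ω, ‖θ t ω - θs‖ ^ 4 ∂P +
        (p.depRate (t + 1) * p.Bnu) ^ 4 :=
    hdep.2.2.trans_eq (by ring)
  have hstep := fourth_moment_step (𝓕.le t) (x := fun ω => θ t ω - θs)
    (hp.rate_pos (Nat.le_add_left 1 t)).le
    (by positivity : 0 < p.muNu / 32)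
    (mul_nonneg (p.depRate_nonneg (t + 1)) hp.Dnu_nonneg)
    ((h.measurable_iterate t).stronglyMeasurable.sub stronglyMeasurable_const)
    (h.memLp_error t) (h.memLp_gradient t) (h.memLp_score t)
    (fun ω => h.quasiConvex.le_inner h.isMin (h.iterate_mem t ω)) hdep.2.1 hbias hexp.2
    (h.noise (t + 1) (Nat.le_add_left 1 t)).2 (h.memLp_error (t + 1)) (h.norm_error_succ_le t)
  rwa [show 4 * (p.mu / 2) = 2 * p.mu by ring] at hstep

end Model

lemma exists_forall_lpNorm_error_le (hp : p.Valid) (hmu : 0 < p.muNu) (ha : 0 < p.decay)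
    (ha1 : p.decay < 1) :
    ∃ K : ℝ, 0 ≤ K ∧ ∀ {d : ℕ} {Ω : Type*} [mΩ : MeasurableSpace Ω] {P : Measure Ω}
      [IsProbabilityMeasure P] {𝓕 : Filtration ℕ mΩ} {Θ : Set (EuclideanSpace ℝ (Fin d))}
      {g : ℕ → Ω → EuclideanSpace ℝ (Fin d) → EuclideanSpace ℝ (Fin d)}
      {F : EuclideanSpace ℝ (Fin d) → ℝ} {θs : EuclideanSpace ℝ (Fin d)}
      {θ : ℕ → Ω → EuclideanSpace ℝ (Fin d)},
      Model p P 𝓕 Θ g F θs θ → ∀ t, lpNorm (fun ω => θ t ω - θs) 4 P ≤ K * p.errRate t := by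
  obtain ⟨K, hK0, hK⟩ := hp.exists_fourth_moment_bound hmu ha ha1
  refine ⟨K, hK0, fun {d Ω mΩ P _ 𝓕 Θ g F θs θ} h t => ?_⟩
  have hpow := hK (fun t => ∫ ω, ‖θ t ω - θs‖ ^ 4 ∂P)
    (fun t => integral_nonneg fun ω => by positivity) h.integral_init_le
    (h.integral_norm_error_pow_four_succ_le hp hmu) t
  rw [← lpNorm_four_pow (h.memLp_error t).aestronglyMeasurable] at hpow
  exact le_of_pow_le_pow_left₀ four_ne_zero (mul_nonneg hK0 (p.errRate_nonneg t)) hpow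

end Model

/-! ### Linearization at the minimizer -/

section Linearization

variable {d : ℕ} {Ω : Type*}

/-- The error of the first-order expansion at the critical point `θs` of the gradient of `F`. -/
noncomputable def linearizationError (F : EuclideanSpace ℝ (Fin d) → ℝ)
    (θs x : EuclideanSpace ℝ (Fin d)) : EuclideanSpace ℝ (Fin d) :=
  gradient F x - fderiv ℝ (gradient F) θs (x - θs)

/-- The fluctuation `∇f_{i+1}(θ_i) - ∇f_{i+1}(θ*)` of the gradient estimates around the scores. -/
def fluctuation (g : ℕ → Ω → EuclideanSpace ℝ (Fin d) → EuclideanSpace ℝ (Fin d))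
    (θs : EuclideanSpace ℝ (Fin d)) (θ : ℕ → Ω → EuclideanSpace ℝ (Fin d)) (i : ℕ) (ω : Ω) :
    EuclideanSpace ℝ (Fin d) :=
  g (i + 1) ω (θ i ω) - g (i + 1) ω θs

/-- The conditional bias `E[∇f_{i+1}(θ_i) | ℱ_i] - ∇F(θ_i)` of the gradient estimates. -/
noncomputable def conditionalBias [mΩ : MeasurableSpace Ω] (P : Measure Ω) (𝓕 : Filtration ℕ mΩ)
    (g : ℕ → Ω → EuclideanSpace ℝ (Fin d) → EuclideanSpace ℝ (Fin d))
    (F : EuclideanSpace ℝ (Fin d) → ℝ) (θ : ℕ → Ω → EuclideanSpace ℝ (Fin d)) (i : ℕ) (ω : Ω) :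
    EuclideanSpace ℝ (Fin d) :=
  (P[fun ω => g (i + 1) ω (θ i ω) | 𝓕 i]) ω - gradient F (θ i ω)

/-- The martingale `∑_{i<t} n_{i+1} (X_i - E[X_i | ℱ_i])` formed from a sequence for which `X_i` is
known at time `i + 1`. -/
noncomputable def centeredSum [mΩ : MeasurableSpace Ω] (p : Params) (P : Measure Ω)
    (𝓕 : Filtration ℕ mΩ) (X : ℕ → Ω → EuclideanSpace ℝ (Fin d)) (t : ℕ) (ω : Ω) :
    EuclideanSpace ℝ (Fin d) :=
  ∑ i ∈ Finset.range t, (p.batch (i + 1) : ℝ) • (X i ω - (P[X i | 𝓕 i]) ω)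

/-- What is left of `∑_{i<t} n_{i+1} ∇²F(θ*) (θ_i - θ*)` once the martingale of the scores is
removed. -/
noncomputable def linearizationRemainder [mΩ : MeasurableSpace Ω] (p : Params) (P : Measure Ω)
    (𝓕 : Filtration ℕ mΩ)
    (g : ℕ → Ω → EuclideanSpace ℝ (Fin d) → EuclideanSpace ℝ (Fin d))
    (F : EuclideanSpace ℝ (Fin d) → ℝ) (θs : EuclideanSpace ℝ (Fin d))
    (θ : ℕ → Ω → EuclideanSpace ℝ (Fin d)) (t : ℕ) : Ω → EuclideanSpace ℝ (Fin d) :=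
  (fun ω => ∑ i ∈ Finset.range t, p.weight (i + 1) • (θ i ω - θ (i + 1) ω))
  + (fun ω => ∑ i ∈ Finset.range t, p.weight (i + 1) • overshoot p g θ i ω)
  - (fun ω => ∑ i ∈ Finset.range t, (p.batch (i + 1) : ℝ) • linearizationError F θs (θ i ω))
  - (fun ω => ∑ i ∈ Finset.range t, (p.batch (i + 1) : ℝ) • conditionalBias P 𝓕 g F θ i ω)
  - centeredSum p P 𝓕 (fluctuation g θs θ) t

/-- The constant in the bound on `linearizationRemainder`, given the constants `K` of the `L⁴` rate
of the iterates and `W` of the summation by parts. -/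
noncomputable def Params.remainderConst (p : Params) (K W : ℝ) : ℝ :=
  K * W + |p.G| / p.DTheta ^ 2 * K ^ 2 * (32 * p.Crho) + p.Chess * K ^ 2 * (32 * p.Crho) +
    8 * p.Crho * (2 * p.Dnu * K + p.Bnu) + p.Ckappa * K * (32 * p.Crho)

lemma Params.Valid.remainderConst_nonneg {p : Params} (hp : p.Valid) {K W : ℝ} (hK : 0 ≤ K)
    (hW : 0 ≤ W) : 0 ≤ p.remainderConst K W := by
  have hCh := hp.Chess_nonneg
  have hD := hp.Dnu_nonneg
  have hB := hp.Bnu_nonneg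
  have hκ := hp.Ckappa_pos
  unfold remainderConst
  positivity

variable [mΩ : MeasurableSpace Ω] {p : Params} {P : Measure Ω}
  {𝓕 : Filtration ℕ mΩ} {Θ : Set (EuclideanSpace ℝ (Fin d))}
  {g : ℕ → Ω → EuclideanSpace ℝ (Fin d) → EuclideanSpace ℝ (Fin d)}
  {F : EuclideanSpace ℝ (Fin d) → ℝ} {θs : EuclideanSpace ℝ (Fin d)}
  {θ : ℕ → Ω → EuclideanSpace ℝ (Fin d)}

lemma sq_lpNorm_error_le {K : ℝ} (hK : ∀ i, lpNorm (fun ω => θ i ω - θs) 4 P ≤ K * p.errRate i)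
    (i : ℕ) : lpNorm (fun ω => θ i ω - θs) 4 P ^ 2 ≤ K ^ 2 * p.errRate i ^ 2 :=
  (pow_le_pow_left₀ lpNorm_nonneg (hK i) 2).trans_eq (mul_pow _ _ _)

namespace Model

lemma norm_linearizationError_le (hp : p.Valid) (h : Model p P 𝓕 Θ g F θs θ) (i : ℕ) (ω : Ω) :
    ‖linearizationError F θs (θ i ω)‖ ≤ p.Chess * ‖θ i ω - θs‖ ^ 2 :=
  h.smooth.norm_gradient_sub_le h.convex h.minimizer_mem h.quasiConvex.gradient_eq_zero
    (h.iterate_mem i ω) hp.Chess_nonneg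

lemma aestronglyMeasurable_gradient_objective (h : Model p P 𝓕 Θ g F θs θ) (i : ℕ) :
    AEStronglyMeasurable (fun ω => gradient F (θ i ω)) P :=
  ((Streaming.measurable_gradient F).comp
    ((h.measurable_iterate i).mono (𝓕.le i) le_rfl)).aestronglyMeasurable

variable [IsProbabilityMeasure P]

lemma aestronglyMeasurable_linearizationError (h : Model p P 𝓕 Θ g F θs θ) (i : ℕ) :
    AEStronglyMeasurable (fun ω => linearizationError F θs (θ i ω)) P :=
  (h.aestronglyMeasurable_gradient_objective i).sub
    ((fderiv ℝ (gradient F) θs).continuous.comp_aestronglyMeasurable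
      (h.memLp_error i).aestronglyMeasurable)

lemma memLp_linearizationError (hp : p.Valid) (h : Model p P 𝓕 Θ g F θs θ) (i : ℕ) :
    MemLp (fun ω => linearizationError F θs (θ i ω)) 2 P :=
  memLp_two_of_norm_le_sq (h.memLp_error i) (h.aestronglyMeasurable_linearizationError i)
    (ae_of_all P fun ω => h.norm_linearizationError_le hp i ω)

lemma lpNorm_linearizationError_le (hp : p.Valid) (h : Model p P 𝓕 Θ g F θs θ) (i : ℕ) :
    lpNorm (fun ω => linearizationError F θs (θ i ω)) 2 P ≤
      p.Chess * lpNorm (fun ω => θ i ω - θs) 4 P ^ 2 :=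
  lpNorm_two_le_of_norm_le_sq hp.Chess_nonneg (h.memLp_error i)
    (h.aestronglyMeasurable_linearizationError i)
    (ae_of_all P fun ω => h.norm_linearizationError_le hp i ω)

lemma memLp_overshoot (h : Model p P 𝓕 Θ g F θs θ) (i : ℕ) :
    MemLp (overshoot p g θ i) 2 P :=
  memLp_two_of_memLp_four ((h.memLp_iterate (i + 1)).sub
    ((h.memLp_iterate i).sub ((h.memLp_gradient i).const_smul (p.rate (i + 1)))))

lemma lpNorm_overshoot_le (hp : p.Valid) (h : Model p P 𝓕 Θ g F θs θ) (i : ℕ) :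
    lpNorm (overshoot p g θ i) 2 P ≤ p.rate (i + 1) * (|p.G| / p.DTheta ^ 2) *
      lpNorm (fun ω => θ (i + 1) ω - θs) 4 P ^ 2 := by
  have hr := hp.rate_pos (Nat.le_add_left 1 i)
  exact lpNorm_two_le_of_norm_le_sq (by positivity) (h.memLp_error (i + 1))
    (h.memLp_overshoot i).aestronglyMeasurable (h.norm_overshoot_le i)

lemma memLp_conditionalBias_four (h : Model p P 𝓕 Θ g F θs θ) (i : ℕ) :
    MemLp (conditionalBias P 𝓕 g F θ i) 4 P :=
  memLp_four_of_integrable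
    (integrable_condExp.aestronglyMeasurable.sub (h.aestronglyMeasurable_gradient_objective i))
    (h.depBias (i + 1) (Nat.le_add_left 1 i) (θ i) (h.measurable_iterate i) (h.iterate_mem i)
      (by exact_mod_cast h.memLp_iterate i)).2.1

lemma lpNorm_conditionalBias_le (hp : p.Valid) (h : Model p P 𝓕 Θ g F θs θ) (i : ℕ) :
    lpNorm (conditionalBias P 𝓕 g F θ i) 2 P ≤
      p.depRate (i + 1) * (p.Dnu * lpNorm (fun ω => θ i ω - θs) 4 P + p.Bnu) := by
  have h4 := h.memLp_conditionalBias_four i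
  have hD := hp.Dnu_nonneg
  have hB := hp.Bnu_nonneg
  have hν := p.depRate_nonneg (i + 1)
  have hl : 0 ≤ lpNorm (fun ω => θ i ω - θs) 4 P := lpNorm_nonneg
  have hdep := (h.depBias (i + 1) (Nat.le_add_left 1 i) (θ i) (h.measurable_iterate i)
    (h.iterate_mem i) (by exact_mod_cast h.memLp_iterate i)).2.2
  refine (lpNorm_mono_exponent (by norm_num) h4).trans
    (le_of_pow_le_pow_left₀ four_ne_zero (by positivity) ?_)
  calc lpNorm (conditionalBias P 𝓕 g F θ i) 4 P ^ 4
      ≤ p.depRate (i + 1) ^ 4 *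
          ((p.Dnu * lpNorm (fun ω => θ i ω - θs) 4 P) ^ 4 + p.Bnu ^ 4) := by
        rw [lpNorm_four_pow h4.aestronglyMeasurable, mul_pow p.Dnu,
          lpNorm_four_pow (h.memLp_error i).aestronglyMeasurable]
        exact hdep
    _ ≤ (p.depRate (i + 1) * (p.Dnu * lpNorm (fun ω => θ i ω - θs) 4 P + p.Bnu)) ^ 4 := by
        rw [mul_pow (p.depRate (i + 1))]
        exact mul_le_mul_of_nonneg_left (pow_add_pow_le (by positivity) hB four_ne_zero)
          (by positivity)

lemma memLp_fluctuation_four (h : Model p P 𝓕 Θ g F θs θ) (i : ℕ) :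
    MemLp (fluctuation g θs θ i) 4 P :=
  (h.memLp_gradient i).sub (h.memLp_score i)

lemma memLp_fluctuation (h : Model p P 𝓕 Θ g F θs θ) (i : ℕ) :
    MemLp (fluctuation g θs θ i) 2 P :=
  memLp_two_of_memLp_four (h.memLp_fluctuation_four i)

lemma lpNorm_fluctuation_le (hp : p.Valid) (h : Model p P 𝓕 Θ g F θs θ) (i : ℕ) :
    lpNorm (fluctuation g θs θ i) 2 P ≤ p.Ckappa * lpNorm (fun ω => θ i ω - θs) 4 P := by
  have h4 := h.memLp_fluctuation_four i
  have hexp := (h.expSmooth (i + 1) (Nat.le_add_left 1 i) (θ i) (h.measurable_iterate i)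
    (h.iterate_mem i) (by exact_mod_cast h.memLp_iterate i)).2
  refine (lpNorm_mono_exponent (by norm_num) h4).trans
    (le_of_pow_le_pow_left₀ four_ne_zero (mul_nonneg hp.Ckappa_pos.le lpNorm_nonneg) ?_)
  rw [lpNorm_four_pow h4.aestronglyMeasurable, mul_pow,
    lpNorm_four_pow (h.memLp_error i).aestronglyMeasurable]
  exact hexp

section Sums

variable {K W : ℝ} {t : ℕ}

lemma lpNorm_error_two_le (h : Model p P 𝓕 Θ g F θs θ)
    (hK : ∀ i, lpNorm (fun ω => θ i ω - θs) 4 P ≤ K * p.errRate i) (i : ℕ) :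
    lpNorm (fun ω => θ i ω - θs) 2 P ≤ K * p.errRate i :=
  (lpNorm_mono_exponent (by norm_num) (h.memLp_error i)).trans (hK i)

/-- The summation by parts moves the difference from the iterates to the weights, which
increase. -/
lemma lpNorm_sum_weight_smul_sub_succ_le (hp : p.Valid) (ha : 0 < p.decay)
    (h : Model p P 𝓕 Θ g F θs θ) (hK0 : 0 ≤ K)
    (hK : ∀ i, lpNorm (fun ω => θ i ω - θs) 4 P ≤ K * p.errRate i)
    (hW : ∑ i ∈ Finset.range t, (p.weight (i + 1) - p.weight i) * p.errRate i +
      p.weight t * p.errRate t ≤ W * p.remainderSum t) :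
    lpNorm (fun ω => ∑ i ∈ Finset.range t, p.weight (i + 1) • (θ i ω - θ (i + 1) ω)) 2 P ≤
      K * W * p.remainderSum t := by
  have herr : ∀ i, MemLp (fun ω => θ i ω - θs) 2 P := fun i =>
    memLp_two_of_memLp_four (h.memLp_error i)
  have hsum_memLp : MemLp (fun ω => ∑ i ∈ Finset.range t,
      (p.weight (i + 1) - p.weight i) • (θ i ω - θs)) 2 P :=
    memLp_finsetSum _ fun i _ => (herr i).const_smul (p.weight (i + 1) - p.weight i)
  have hinc : ∀ i, 0 ≤ p.weight (i + 1) - p.weight i := fun i =>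
    sub_nonneg.2 (hp.weight_le_succ ha i)
  have hparts : (fun ω => ∑ i ∈ Finset.range t, p.weight (i + 1) • (θ i ω - θ (i + 1) ω)) =
      (fun ω => ∑ i ∈ Finset.range t, (p.weight (i + 1) - p.weight i) • (θ i ω - θs)) -
        p.weight t • fun ω => θ t ω - θs := by
    funext ω
    have hsum := sum_range_sub_smul (Params.weight_zero (hp.alpha_pos ha))
      (fun i => θ i ω - θs) t
    simp only [sub_sub_sub_cancel_right] at hsum
    exact eq_sub_of_add_eq hsum.symm
  have hincSum : lpNorm (fun ω => ∑ i ∈ Finset.range t,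
      (p.weight (i + 1) - p.weight i) • (θ i ω - θs)) 2 P ≤
      ∑ i ∈ Finset.range t, (p.weight (i + 1) - p.weight i) * (K * p.errRate i) :=
    lpNorm_sum_smul_le one_le_two hinc herr (h.lpNorm_error_two_le hK)
  have hlast : lpNorm (p.weight t • fun ω => θ t ω - θs) 2 P ≤
      p.weight t * (K * p.errRate t) := by
    rw [lpNorm_const_smul, coe_nnnorm, Real.norm_of_nonneg (hp.weight_nonneg ha t)]
    exact mul_le_mul_of_nonneg_left (h.lpNorm_error_two_le hK t) (hp.weight_nonneg ha t)
  rw [hparts]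
  calc _ ≤ ∑ i ∈ Finset.range t, (p.weight (i + 1) - p.weight i) * (K * p.errRate i) +
        p.weight t * (K * p.errRate t) :=
        (lpNorm_sub_le hsum_memLp one_le_two).trans
          (add_le_add hincSum hlast)
    _ = K * (∑ i ∈ Finset.range t, (p.weight (i + 1) - p.weight i) * p.errRate i +
        p.weight t * p.errRate t) := by
        simp only [mul_add, Finset.mul_sum, mul_left_comm K]
    _ ≤ K * (W * p.remainderSum t) := mul_le_mul_of_nonneg_left hW hK0
    _ = K * W * p.remainderSum t := (mul_assoc _ _ _).symm

lemma lpNorm_sum_weight_smul_overshoot_le (hp : p.Valid) (ha : 0 < p.decay)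
    (h : Model p P 𝓕 Θ g F θs θ)
    (hK : ∀ i, lpNorm (fun ω => θ i ω - θs) 4 P ≤ K * p.errRate i) (ht : 1 ≤ t) :
    lpNorm (fun ω => ∑ i ∈ Finset.range t, p.weight (i + 1) • overshoot p g θ i ω) 2 P ≤
      |p.G| / p.DTheta ^ 2 * K ^ 2 * (32 * p.Crho) * p.remainderSum t := by
  have hterm : ∀ i, p.weight (i + 1) * (p.rate (i + 1) * (|p.G| / p.DTheta ^ 2) *
      lpNorm (fun ω => θ (i + 1) ω - θs) 4 P ^ 2) ≤
      |p.G| / p.DTheta ^ 2 * K ^ 2 * (p.batch (i + 1) * p.errRate i ^ 2) := fun i => by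
    have hr := hp.rate_pos (Nat.le_add_left 1 i)
    have hweight : p.weight (i + 1) * p.rate (i + 1) = p.batch (i + 1) :=
      div_mul_cancel₀ _ hr.ne'
    have hrate := p.errRate_nonneg (i + 1)
    calc _ = p.batch (i + 1) * (|p.G| / p.DTheta ^ 2) *
          lpNorm (fun ω => θ (i + 1) ω - θs) 4 P ^ 2 := by rw [← hweight]; ring
      _ ≤ p.batch (i + 1) * (|p.G| / p.DTheta ^ 2) * (K ^ 2 * p.errRate i ^ 2) := by
          gcongr
          refine (sq_lpNorm_error_le hK (i + 1)).trans ?_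
          gcongr
          exact hp.errRate_succ_le ha i
      _ = _ := by ring
  calc _ ≤ ∑ i ∈ Finset.range t, p.weight (i + 1) * (p.rate (i + 1) * (|p.G| / p.DTheta ^ 2) *
        lpNorm (fun ω => θ (i + 1) ω - θs) 4 P ^ 2) :=
        lpNorm_sum_smul_le one_le_two (fun i => hp.weight_nonneg ha (i + 1)) h.memLp_overshoot
          (h.lpNorm_overshoot_le hp)
    _ ≤ |p.G| / p.DTheta ^ 2 * K ^ 2 *
        ∑ i ∈ Finset.range t, (p.batch (i + 1) : ℝ) * p.errRate i ^ 2 := by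
        rw [Finset.mul_sum]
        exact Finset.sum_le_sum fun i _ => hterm i
    _ ≤ |p.G| / p.DTheta ^ 2 * K ^ 2 * (32 * p.Crho * p.remainderSum t) := by
        gcongr
        exact hp.sum_batch_mul_errRate_sq_le ha ht
    _ = _ := by ring

lemma lpNorm_sum_batch_smul_linearizationError_le (hp : p.Valid) (ha : 0 < p.decay)
    (h : Model p P 𝓕 Θ g F θs θ)
    (hK : ∀ i, lpNorm (fun ω => θ i ω - θs) 4 P ≤ K * p.errRate i) (ht : 1 ≤ t) :
    lpNorm (fun ω => ∑ i ∈ Finset.range t,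
      (p.batch (i + 1) : ℝ) • linearizationError F θs (θ i ω)) 2 P ≤
      p.Chess * K ^ 2 * (32 * p.Crho) * p.remainderSum t := by
  have hCh := hp.Chess_nonneg
  calc _ ≤ ∑ i ∈ Finset.range t, (p.batch (i + 1) : ℝ) *
        (p.Chess * (K ^ 2 * p.errRate i ^ 2)) :=
        lpNorm_sum_smul_le one_le_two (fun _ => Nat.cast_nonneg _) (h.memLp_linearizationError hp)
          fun i => (h.lpNorm_linearizationError_le hp i).trans
            (mul_le_mul_of_nonneg_left (sq_lpNorm_error_le hK i) hCh)
    _ = p.Chess * K ^ 2 *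
        ∑ i ∈ Finset.range t, (p.batch (i + 1) : ℝ) * p.errRate i ^ 2 := by
        rw [Finset.mul_sum]
        exact Finset.sum_congr rfl fun i _ => by ring
    _ ≤ p.Chess * K ^ 2 * (32 * p.Crho * p.remainderSum t) := by
        gcongr
        exact hp.sum_batch_mul_errRate_sq_le ha ht
    _ = _ := by ring

lemma lpNorm_sum_batch_smul_conditionalBias_le (hp : p.Valid) (ha : 0 < p.decay)
    (h : Model p P 𝓕 Θ g F θs θ) (hK0 : 0 ≤ K)
    (hK : ∀ i, lpNorm (fun ω => θ i ω - θs) 4 P ≤ K * p.errRate i) (ht : 1 ≤ t) :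
    lpNorm (fun ω => ∑ i ∈ Finset.range t,
      (p.batch (i + 1) : ℝ) • conditionalBias P 𝓕 g F θ i ω) 2 P ≤
      8 * p.Crho * (2 * p.Dnu * K + p.Bnu) * p.remainderSum t := by
  refine (lpNorm_sum_smul_le one_le_two (fun _ => Nat.cast_nonneg _)
    (fun i => memLp_two_of_memLp_four (h.memLp_conditionalBias_four i)) fun i =>
      (h.lpNorm_conditionalBias_le hp i).trans ?_).trans
    (hp.sum_batch_mul_depRate_mul_le ha hK0 ht)
  have hν := p.depRate_nonneg (i + 1)
  have hD := hp.Dnu_nonneg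
  gcongr
  exact hK i

lemma lpNorm_centeredSum_fluctuation_le (hp : p.Valid) (ha : 1 / 2 < p.decay)
    (h : Model p P 𝓕 Θ g F θs θ) (hK0 : 0 ≤ K)
    (hK : ∀ i, lpNorm (fun ω => θ i ω - θs) 4 P ≤ K * p.errRate i) (ht : 1 ≤ t) :
    lpNorm (centeredSum p P 𝓕 (fluctuation g θs θ) t) 2 P ≤
      p.Ckappa * K * (32 * p.Crho) * p.remainderSum t := by
  have hκ := hp.Ckappa_pos
  have hterm : ∀ i, ∫ ω, ‖fluctuation g θs θ i ω‖ ^ 2 ∂P ≤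
      (p.Ckappa * K * p.errRate i) ^ 2 := fun i => by
    have hrate := p.errRate_nonneg i
    rw [← Real.sqrt_le_left (by positivity),
      ← lpNorm_two_eq_sqrt (h.memLp_fluctuation i).aestronglyMeasurable, mul_assoc]
    exact (h.lpNorm_fluctuation_le hp i).trans (mul_le_mul_of_nonneg_left (hK i) hκ.le)
  calc _ ≤ √(∑ i ∈ Finset.range t, (p.batch (i + 1) : ℝ) ^ 2 *
        ∫ ω, ‖fluctuation g θs θ i ω‖ ^ 2 ∂P) :=
        lpNorm_sum_smul_sub_condExp_le 𝓕 (fun i => (p.batch (i + 1) : ℝ))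
          (fun i => (h.stronglyMeasurable_gradient i).sub (h.stronglyMeasurable_score i))
          h.memLp_fluctuation t
    _ ≤ √((p.Ckappa * K) ^ 2 *
        ∑ i ∈ Finset.range t, (p.batch (i + 1) : ℝ) ^ 2 * p.errRate i ^ 2) := by
        rw [Finset.mul_sum]
        refine Real.sqrt_le_sqrt (Finset.sum_le_sum fun i _ => ?_)
        exact (mul_le_mul_of_nonneg_left (hterm i) (by positivity)).trans_eq (by ring)
    _ = p.Ckappa * K *
        √(∑ i ∈ Finset.range t, (p.batch (i + 1) : ℝ) ^ 2 * p.errRate i ^ 2) := by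
        rw [Real.sqrt_mul (by positivity), Real.sqrt_sq (by positivity)]
    _ ≤ p.Ckappa * K * (32 * p.Crho * p.remainderSum t) := by
        gcongr
        exact hp.sqrt_sum_batch_sq_mul_errRate_sq_le ha ht
    _ = _ := by ring

end Sums

lemma memLp_sum_weight_smul_sub_succ (h : Model p P 𝓕 Θ g F θs θ) (t : ℕ) :
    MemLp (fun ω => ∑ i ∈ Finset.range t, p.weight (i + 1) • (θ i ω - θ (i + 1) ω)) 2 P :=
  memLp_finsetSum _ fun i _ => (memLp_two_of_memLp_four
    ((h.memLp_iterate i).sub (h.memLp_iterate (i + 1)))).const_smul (p.weight (i + 1))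

lemma memLp_sum_weight_smul_overshoot (h : Model p P 𝓕 Θ g F θs θ) (t : ℕ) :
    MemLp (fun ω => ∑ i ∈ Finset.range t, p.weight (i + 1) • overshoot p g θ i ω) 2 P :=
  memLp_finsetSum _ fun i _ => (h.memLp_overshoot i).const_smul (p.weight (i + 1))

lemma memLp_sum_batch_smul_linearizationError (hp : p.Valid) (h : Model p P 𝓕 Θ g F θs θ)
    (t : ℕ) : MemLp (fun ω => ∑ i ∈ Finset.range t,
      (p.batch (i + 1) : ℝ) • linearizationError F θs (θ i ω)) 2 P :=
  memLp_finsetSum _ fun i _ => (h.memLp_linearizationError hp i).const_smul (p.batch (i + 1) : ℝ)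

lemma memLp_sum_batch_smul_conditionalBias (h : Model p P 𝓕 Θ g F θs θ) (t : ℕ) :
    MemLp (fun ω => ∑ i ∈ Finset.range t,
      (p.batch (i + 1) : ℝ) • conditionalBias P 𝓕 g F θ i ω) 2 P :=
  memLp_finsetSum _ fun i _ =>
    (memLp_two_of_memLp_four (h.memLp_conditionalBias_four i)).const_smul (p.batch (i + 1) : ℝ)

lemma memLp_linearizationRemainder (hp : p.Valid) (h : Model p P 𝓕 Θ g F θs θ) (t : ℕ) :
    MemLp (linearizationRemainder p P 𝓕 g F θs θ t) 2 P :=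
  ((((h.memLp_sum_weight_smul_sub_succ t).add (h.memLp_sum_weight_smul_overshoot t)).sub
    (h.memLp_sum_batch_smul_linearizationError hp t)).sub
    (h.memLp_sum_batch_smul_conditionalBias t)).sub
    (memLp_sum_smul_sub_condExp 𝓕 (fun i => (p.batch (i + 1) : ℝ)) h.memLp_fluctuation t)

lemma lpNorm_linearizationRemainder_le (hp : p.Valid) (ha : 1 / 2 < p.decay)
    (h : Model p P 𝓕 Θ g F θs θ) {K W : ℝ} (hK0 : 0 ≤ K)
    (hK : ∀ i, lpNorm (fun ω => θ i ω - θs) 4 P ≤ K * p.errRate i) {t : ℕ} (ht : 1 ≤ t)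
    (hW : ∑ i ∈ Finset.range t, (p.weight (i + 1) - p.weight i) * p.errRate i +
      p.weight t * p.errRate t ≤ W * p.remainderSum t) :
    lpNorm (linearizationRemainder p P 𝓕 g F θs θ t) 2 P ≤
      p.remainderConst K W * p.remainderSum t := by
  have ha0 : 0 < p.decay := one_half_pos.trans ha
  have hdrift := h.memLp_sum_weight_smul_sub_succ t
  have hover := hdrift.add (h.memLp_sum_weight_smul_overshoot t)
  have hlin := hover.sub (h.memLp_sum_batch_smul_linearizationError hp t)
  have hbias := hlin.sub (h.memLp_sum_batch_smul_conditionalBias t)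
  unfold linearizationRemainder Params.remainderConst
  simp only [add_mul _ _ (p.remainderSum t)]
  exact (lpNorm_sub_le hbias one_le_two).trans <| add_le_add
    ((lpNorm_sub_le hlin one_le_two).trans <| add_le_add
      ((lpNorm_sub_le hover one_le_two).trans <| add_le_add
        ((lpNorm_add_le hdrift one_le_two).trans <| add_le_add
          (h.lpNorm_sum_weight_smul_sub_succ_le hp ha0 hK0 hK hW)
          (h.lpNorm_sum_weight_smul_overshoot_le hp ha0 hK ht))
        (h.lpNorm_sum_batch_smul_linearizationError_le hp ha0 hK ht))
      (h.lpNorm_sum_batch_smul_conditionalBias_le hp ha0 hK0 hK ht))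
    (h.lpNorm_centeredSum_fluctuation_le hp ha hK0 hK ht)

end Model

end Linearization

/-! ### The leading term -/

/-- The leading terms of the bound on the error of the averaged iterates, `Λ` being the limiting
variance `Lam`. -/
noncomputable def Params.leading (p : Params) (Λ : ℝ) (t : ℕ) : ℝ :=
  (if p.sigma = 1 / 2 then √Λ / √(p.total t : ℝ) else 0)
  + (if p.sigma < 1 / 2 then
      √2 * √Λ * (p.Crho : ℝ) ^ ((1 - 2 * p.sigma) / (2 * (1 + p.rho)))
        / (p.total t : ℝ) ^ ((1 + 2 * p.rho * p.sigma) / (2 * (1 + p.rho))) else 0)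
  + √2 * √p.Csigma'
      * (p.Crho : ℝ) ^ ((1 - 2 * (p.sigma + p.sigma')) / (2 * (1 + p.rho)))
      / (p.mu * (p.total t : ℝ) ^ ((1 + 2 * p.rho * (p.sigma + p.sigma')) / (2 * (1 + p.rho))))

section ScoreVariance

variable {d : ℕ} {Ω : Type*}

/-- The operator `∇²F(θ)⁻¹`, which is `0` if the Hessian is singular. -/
noncomputable def inverseHessian (F : EuclideanSpace ℝ (Fin d) → ℝ)
    (θ : EuclideanSpace ℝ (Fin d)) : EuclideanSpace ℝ (Fin d) →L[ℝ] EuclideanSpace ℝ (Fin d) :=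
  Matrix.toEuclideanCLM (𝕜 := ℝ) (hessianMatrix F θ)⁻¹

/-- The score `∇f_{i+1}(θ*)` preconditioned by the inverse Hessian. -/
noncomputable def newtonScore
    (g : ℕ → Ω → EuclideanSpace ℝ (Fin d) → EuclideanSpace ℝ (Fin d))
    (F : EuclideanSpace ℝ (Fin d) → ℝ) (θs : EuclideanSpace ℝ (Fin d)) (i : ℕ) (ω : Ω) :
    EuclideanSpace ℝ (Fin d) :=
  inverseHessian F θs (g (i + 1) ω θs)

variable [mΩ : MeasurableSpace Ω] {p : Params} {P : Measure Ω}
  {𝓕 : Filtration ℕ mΩ} {Θ : Set (EuclideanSpace ℝ (Fin d))}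
  {g : ℕ → Ω → EuclideanSpace ℝ (Fin d) → EuclideanSpace ℝ (Fin d)}
  {F : EuclideanSpace ℝ (Fin d) → ℝ} {θs : EuclideanSpace ℝ (Fin d)}
  {θ : ℕ → Ω → EuclideanSpace ℝ (Fin d)} {S : Matrix (Fin d) (Fin d) ℝ}
  {St : ℕ → Matrix (Fin d) (Fin d) ℝ}

lemma ScoreCovariance.trace_mul_scoreMatrix_mul_le (hp : p.Valid)
    (hS : ScoreCovariance p P g θs S St) {K : Matrix (Fin d) (Fin d) ℝ} (hK : K.IsHermitian)
    {c : ℝ} (hc : ∀ v, ‖Matrix.toEuclideanCLM (𝕜 := ℝ) K v‖ ≤ c * ‖v‖) {t : ℕ} (ht : 1 ≤ t) :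
    (K * scoreMatrix P g θs t * K).trace ≤
      (p.batch t : ℝ) ^ (-(2 * p.sigma)) * ((K * S * K).trace +
        c ^ 2 * (p.Csigma' * (p.batch t : ℝ) ^ (-(2 * p.sigma')))) := by
  have hn := hp.batch_pos ht
  have hgap := trace_mul_mul_nonneg hK (hS.le t ht)
  have hSt := trace_mul_mul_le hK (hS.posSemidef_t t ht) hc
  rw [hS.trace_t t ht] at hSt
  rw [Matrix.mul_sub, Matrix.sub_mul, Matrix.mul_add, Matrix.add_mul, Matrix.trace_sub,
    Matrix.trace_add, Matrix.mul_smul, Matrix.smul_mul, Matrix.trace_smul, smul_eq_mul] at hgap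
  rw [Real.rpow_neg hn.le, inv_mul_eq_div, le_div_iff₀ (by positivity), mul_comm]
  linarith

namespace Model

lemma posDef_hessianMatrix (hp : p.Valid) (h : Model p P 𝓕 Θ g F θs θ) :
    (hessianMatrix F θs).PosDef :=
  h.quasiConvex.posDef_hessianMatrix hp.mu_pos h.mem_interior
    (h.smooth.twice_differentiable θs h.minimizer_mem)

lemma isUnit_det_hessianMatrix (hp : p.Valid) (h : Model p P 𝓕 Θ g F θs θ) :
    IsUnit (hessianMatrix F θs).det :=
  (h.posDef_hessianMatrix hp).det_pos.ne'.isUnit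

lemma inverseHessian_fderiv (hp : p.Valid) (h : Model p P 𝓕 Θ g F θs θ)
    (v : EuclideanSpace ℝ (Fin d)) :
    inverseHessian F θs (fderiv ℝ (gradient F) θs v) = v := by
  rw [← toEuclideanCLM_hessianMatrix]
  exact toEuclideanCLM_inv_apply (h.isUnit_det_hessianMatrix hp) v

lemma norm_inverseHessian_le (hp : p.Valid) (h : Model p P 𝓕 Θ g F θs θ)
    (v : EuclideanSpace ℝ (Fin d)) : ‖inverseHessian F θs v‖ ≤ p.mu⁻¹ * ‖v‖ :=
  norm_toEuclideanCLM_inv_le (h.isUnit_det_hessianMatrix hp) hp.mu_pos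
    (h.quasiConvex.mul_norm_sq_le_inner_hessianMatrix h.mem_interior
      (h.smooth.twice_differentiable θs h.minimizer_mem)) v

lemma Lam_nonneg (hp : p.Valid) (h : Model p P 𝓕 Θ g F θs θ)
    (hS : ScoreCovariance p P g θs S St) : 0 ≤ Lam F θs S :=
  trace_mul_mul_nonneg (h.posDef_hessianMatrix hp).isHermitian.inv hS.posSemidef

variable [IsProbabilityMeasure P]

lemma memLp_newtonScore (h : Model p P 𝓕 Θ g F θs θ) (i : ℕ) :
    MemLp (newtonScore g F θs i) 2 P :=
  (inverseHessian F θs).comp_memLp' (memLp_two_of_memLp_four (h.memLp_score i))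

lemma integral_norm_newtonScore_sq_le (hp : p.Valid) (h : Model p P 𝓕 Θ g F θs θ)
    (hS : ScoreCovariance p P g θs S St) (i : ℕ) :
    ∫ ω, ‖newtonScore g F θs i ω‖ ^ 2 ∂P ≤
      (p.batch (i + 1) : ℝ) ^ (-(2 * p.sigma)) * (Lam F θs S +
        p.mu⁻¹ ^ 2 * (p.Csigma' * (p.batch (i + 1) : ℝ) ^ (-(2 * p.sigma')))) := by
  have hherm := (h.posDef_hessianMatrix hp).isHermitian.inv
  exact (integral_norm_toEuclideanCLM_sq hherm (memLp_two_of_memLp_four (h.memLp_score i))).trans_le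
    (hS.trace_mul_scoreMatrix_mul_le hp hherm (h.norm_inverseHessian_le hp)
      (Nat.le_add_left 1 i))

lemma sum_batch_sq_mul_integral_norm_newtonScore_sq_le (hp : p.Valid)
    (h : Model p P 𝓕 Θ g F θs θ) (hS : ScoreCovariance p P g θs S St) (t : ℕ) :
    ∑ i ∈ Finset.range t, (p.batch (i + 1) : ℝ) ^ 2 * ∫ ω, ‖newtonScore g F θs i ω‖ ^ 2 ∂P ≤
      Lam F θs S * ∑ i ∈ Finset.Icc 1 t, (p.batch i : ℝ) ^ (2 - 2 * p.sigma) +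
        p.mu⁻¹ ^ 2 * (p.Csigma' *
          ∑ i ∈ Finset.Icc 1 t, (p.batch i : ℝ) ^ (2 - 2 * (p.sigma + p.sigma'))) := by
  rw [← sum_range_add_one_eq_sum_Icc (fun i => (p.batch i : ℝ) ^ (2 - 2 * p.sigma)),
    ← sum_range_add_one_eq_sum_Icc (fun i => (p.batch i : ℝ) ^ (2 - 2 * (p.sigma + p.sigma')))]
  simp only [Finset.mul_sum, ← Finset.sum_add_distrib]
  refine Finset.sum_le_sum fun i _ => ?_
  have hn := hp.batch_pos (Nat.le_add_left 1 i)
  have hpow : ∀ s : ℝ, (p.batch (i + 1) : ℝ) ^ (2 - 2 * s) =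
      (p.batch (i + 1) : ℝ) ^ 2 * (p.batch (i + 1) : ℝ) ^ (-(2 * s)) := fun s => by
    rw [sub_eq_add_neg, Real.rpow_add hn, Real.rpow_two]
  refine (mul_le_mul_of_nonneg_left (h.integral_norm_newtonScore_sq_le hp hS i)
    (by positivity)).trans_eq ?_
  rw [hpow, hpow, mul_add 2 p.sigma, neg_add, Real.rpow_add hn]
  ring

end Model

lemma Params.Valid.sqrt_mul_sum_batch_rpow_sigma_div_total_le (hp : p.Valid) {Λ : ℝ} (hΛ : 0 ≤ Λ)
    {t : ℕ} (ht : 1 ≤ t) :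
    √(Λ * ∑ i ∈ Finset.Icc 1 t, (p.batch i : ℝ) ^ (2 - 2 * p.sigma)) / p.total t ≤
      (if p.sigma = 1 / 2 then √Λ / √(p.total t : ℝ) else 0)
      + (if p.sigma < 1 / 2 then
          √2 * √Λ * (p.Crho : ℝ) ^ ((1 - 2 * p.sigma) / (2 * (1 + p.rho)))
            / (p.total t : ℝ) ^ ((1 + 2 * p.rho * p.sigma) / (2 * (1 + p.rho))) else 0) := by
  rcases hp.sigma_mem.2.lt_or_eq with hlt | heq
  · rw [if_neg hlt.ne, if_pos hlt, zero_add]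
    exact hp.sqrt_sum_batch_rpow_div_total_le hp.sigma_mem.1 (by linarith) hΛ ht
  · have htotal : ∑ i ∈ Finset.Icc 1 t, (p.batch i : ℝ) ^ (2 - 2 * p.sigma) = p.total t := by
      norm_num [p.cast_total, heq]
    rw [if_pos heq, if_neg heq.not_lt, add_zero, htotal, Real.sqrt_mul hΛ, mul_div_assoc,
      Real.sqrt_div_self, ← div_eq_mul_inv]

lemma Model.sqrt_sum_div_total_le_leading [IsProbabilityMeasure P] (hp : p.Valid)
    (h : Model p P 𝓕 Θ g F θs θ) (hS : ScoreCovariance p P g θs S St) {t : ℕ} (ht : 1 ≤ t) :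
    √(∑ i ∈ Finset.range t, (p.batch (i + 1) : ℝ) ^ 2 *
      ∫ ω, ‖newtonScore g F θs i ω‖ ^ 2 ∂P) / p.total t ≤ p.leading (Lam F θs S) t := by
  have hΛ := h.Lam_nonneg hp hS
  have hmu := hp.mu_pos
  have hCs := hp.Csigma'_nonneg
  have hs := hp.sigma_mem
  have hs' := hp.sigma'_mem
  set A := ∑ i ∈ Finset.Icc 1 t, (p.batch i : ℝ) ^ (2 - 2 * p.sigma)
  set B := ∑ i ∈ Finset.Icc 1 t, (p.batch i : ℝ) ^ (2 - 2 * (p.sigma + p.sigma'))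
  have hB : √(p.Csigma' * B) / p.total t ≤ √2 * √p.Csigma' *
      (p.Crho : ℝ) ^ ((1 - 2 * (p.sigma + p.sigma')) / (2 * (1 + p.rho))) /
        (p.total t : ℝ) ^ ((1 + 2 * p.rho * (p.sigma + p.sigma')) / (2 * (1 + p.rho))) :=
    hp.sqrt_sum_batch_rpow_div_total_le (by linarith [hs.1, hs'.1]) (by linarith [hs.2, hs'.2])
      hCs ht
  calc _ ≤ √(Lam F θs S * A + p.mu⁻¹ ^ 2 * (p.Csigma' * B)) / p.total t := by
        gcongr
        exact h.sum_batch_sq_mul_integral_norm_newtonScore_sq_le hp hS t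
    _ ≤ (√(Lam F θs S * A) + √(p.mu⁻¹ ^ 2 * (p.Csigma' * B))) / p.total t := by
        gcongr
        exact sqrt_add_le_sqrt_add_sqrt (by positivity) (by positivity)
    _ = √(Lam F θs S * A) / p.total t + p.mu⁻¹ * (√(p.Csigma' * B) / p.total t) := by
        rw [Real.sqrt_mul (sq_nonneg p.mu⁻¹), Real.sqrt_sq (by positivity), add_div, mul_div_assoc]
    _ ≤ p.leading (Lam F θs S) t := by
        rw [Params.leading, mul_comm p.mu, ← div_div _ _ p.mu, div_eq_inv_mul _ p.mu]
        exact add_le_add (hp.sqrt_mul_sum_batch_rpow_sigma_div_total_le hΛ ht)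
          (mul_le_mul_of_nonneg_left hB (by positivity))

end ScoreVariance

/-! ### The error of the averaged iterates -/

section Average

variable {d : ℕ} {Ω : Type*} {p : Params} {θs : EuclideanSpace ℝ (Fin d)}
  {θ : ℕ → Ω → EuclideanSpace ℝ (Fin d)}

lemma average_sub (hp : p.Valid) {t : ℕ} (ht : 1 ≤ t) (ω : Ω) :
    average p θ t ω - θs =
      (p.total t : ℝ)⁻¹ • ∑ i ∈ Finset.range t, (p.batch (i + 1) : ℝ) • (θ i ω - θs) := by
  have hmean : (p.total t : ℝ)⁻¹ • ∑ i ∈ Finset.range t, (p.batch (i + 1) : ℝ) • θs = θs := by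
    rw [← Finset.sum_smul, sum_range_add_one_eq_sum_Icc (fun i => (p.batch i : ℝ)),
      ← p.cast_total, smul_smul, inv_mul_cancel₀ (hp.total_pos ht).ne', one_smul]
  simp only [smul_sub, Finset.sum_sub_distrib, hmean, average]

variable [mΩ : MeasurableSpace Ω] {P : Measure Ω} [IsProbabilityMeasure P]
  {𝓕 : Filtration ℕ mΩ} {Θ : Set (EuclideanSpace ℝ (Fin d))}
  {g : ℕ → Ω → EuclideanSpace ℝ (Fin d) → EuclideanSpace ℝ (Fin d)}
  {F : EuclideanSpace ℝ (Fin d) → ℝ}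

namespace Model

lemma sum_batch_smul_fderiv_eq (hp : p.Valid) (h : Model p P 𝓕 Θ g F θs θ) (t : ℕ) :
    (fun ω => ∑ i ∈ Finset.range t,
      (p.batch (i + 1) : ℝ) • fderiv ℝ (gradient F) θs (θ i ω - θs)) =ᵐ[P]
    linearizationRemainder p P 𝓕 g F θs θ t - centeredSum p P 𝓕 (fun i ω => g (i + 1) ω θs) t := by
  have hcond : ∀ i, P[fluctuation g θs θ i | 𝓕 i] =ᵐ[P]
      P[fun ω => g (i + 1) ω (θ i ω) | 𝓕 i] - P[fun ω => g (i + 1) ω θs | 𝓕 i] := fun i =>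
    condExp_sub ((h.memLp_gradient i).integrable (by norm_num))
      ((h.memLp_score i).integrable (by norm_num)) (𝓕 i)
  filter_upwards [ae_all_iff.2 hcond] with ω hω
  simp only [linearizationRemainder, centeredSum, Pi.add_apply, Pi.sub_apply,
    ← Finset.sum_sub_distrib, ← Finset.sum_add_distrib]
  refine Finset.sum_congr rfl fun i _ => ?_
  have hweight : (p.batch (i + 1) : ℝ) = p.weight (i + 1) * p.rate (i + 1) :=
    (div_mul_cancel₀ _ (hp.rate_pos (Nat.le_add_left 1 i)).ne').symm
  rw [hω i, Pi.sub_apply, hweight, overshoot, linearizationError, conditionalBias, fluctuation]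
  module

lemma inverseHessian_centeredSum_score (h : Model p P 𝓕 Θ g F θs θ) (t : ℕ) :
    (fun ω => inverseHessian F θs (centeredSum p P 𝓕 (fun i ω => g (i + 1) ω θs) t ω)) =ᵐ[P]
      centeredSum p P 𝓕 (newtonScore g F θs) t := by
  have hcomm : ∀ i, (fun ω => inverseHessian F θs ((P[fun ω => g (i + 1) ω θs | 𝓕 i]) ω)) =ᵐ[P]
      P[newtonScore g F θs i | 𝓕 i] := fun i =>
    (inverseHessian F θs).comp_condExp_comm ((h.memLp_score i).integrable (by norm_num))
  filter_upwards [ae_all_iff.2 hcomm] with ω hω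
  simp only [centeredSum, map_sum, map_smul, map_sub, hω, newtonScore]

lemma average_sub_ae_eq (hp : p.Valid) (h : Model p P 𝓕 Θ g F θs θ) {t : ℕ} (ht : 1 ≤ t) :
    (fun ω => average p θ t ω - θs) =ᵐ[P] (p.total t : ℝ)⁻¹ •
      ((fun ω => inverseHessian F θs (linearizationRemainder p P 𝓕 g F θs θ t ω)) -
        centeredSum p P 𝓕 (newtonScore g F θs) t) := by
  filter_upwards [h.sum_batch_smul_fderiv_eq hp t, h.inverseHessian_centeredSum_score t]
    with ω hsum hscore
  have hinv := congrArg (inverseHessian F θs) hsum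
  simp only [map_sum, map_smul, h.inverseHessian_fderiv hp, Pi.sub_apply, map_sub, hscore] at hinv
  rw [average_sub hp ht, hinv, Pi.smul_apply, Pi.sub_apply]

lemma memLp_average (h : Model p P 𝓕 Θ g F θs θ) (t : ℕ) : MemLp (average p θ t) 2 P :=
  (memLp_finsetSum _ fun i _ =>
    (memLp_two_of_memLp_four (h.memLp_iterate i)).const_smul (p.batch (i + 1) : ℝ)).const_smul
    (p.total t : ℝ)⁻¹

lemma sqrt_integral_norm_average_sub_sq_le (hp : p.Valid) (h : Model p P 𝓕 Θ g F θs θ) {t : ℕ}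
    (ht : 1 ≤ t) :
    √(∫ ω, ‖average p θ t ω - θs‖ ^ 2 ∂P) ≤
      √(∑ i ∈ Finset.range t, (p.batch (i + 1) : ℝ) ^ 2 *
        ∫ ω, ‖newtonScore g F θs i ω‖ ^ 2 ∂P) / p.total t +
      p.mu⁻¹ * (lpNorm (linearizationRemainder p P 𝓕 g F θs θ t) 2 P / p.total t) := by
  have hN := hp.total_pos ht
  have hmu := hp.mu_pos
  have hR := h.memLp_linearizationRemainder hp t
  have herr : AEStronglyMeasurable (fun ω => average p θ t ω - θs) P :=
    (h.memLp_average t).aestronglyMeasurable.sub aestronglyMeasurable_const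
  have hRinv : lpNorm (fun ω => inverseHessian F θs
      (linearizationRemainder p P 𝓕 g F θs θ t ω)) 2 P ≤
      p.mu⁻¹ * lpNorm (linearizationRemainder p P 𝓕 g F θs θ t) 2 P :=
    lpNorm_le_mul_lpNorm (by positivity) hR fun ω => h.norm_inverseHessian_le hp _
  have hscore : lpNorm (centeredSum p P 𝓕 (newtonScore g F θs) t) 2 P ≤
      √(∑ i ∈ Finset.range t, (p.batch (i + 1) : ℝ) ^ 2 *
        ∫ ω, ‖newtonScore g F θs i ω‖ ^ 2 ∂P) :=
    lpNorm_sum_smul_sub_condExp_le 𝓕 (fun i => (p.batch (i + 1) : ℝ))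
      (fun i => (inverseHessian F θs).continuous.comp_stronglyMeasurable
        (h.stronglyMeasurable_score i)) h.memLp_newtonScore t
  rw [← lpNorm_two_eq_sqrt herr, lpNorm_congr_ae herr (h.average_sub_ae_eq hp ht),
    lpNorm_const_smul, coe_nnnorm, Real.norm_of_nonneg (by positivity)]
  refine (mul_le_mul_of_nonneg_left
    ((lpNorm_sub_le ((inverseHessian F θs).comp_memLp' hR) one_le_two).trans
      (add_le_add hRinv hscore)) (by positivity)).trans_eq ?_
  ring

end Model

end Average

/-! ### Mini-batch gradients -/

section BatchGradient

variable {d : ℕ} {Ξ Ω : Type*} {p : Params} {f : EuclideanSpace ℝ (Fin d) → Ξ → ℝ}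

lemma hasFDerivAt_batchLoss (hf : ∀ x, Differentiable ℝ fun η => f η x) (ξ : ℕ → ℕ → Ω → Ξ)
    (t : ℕ) (ω : Ω) (η : EuclideanSpace ℝ (Fin d)) :
    HasFDerivAt (batchLoss p f ξ t ω) ((p.batch t : ℝ)⁻¹ •
      ∑ i ∈ Finset.Icc 1 (p.batch t), fderiv ℝ (fun η => f η (ξ t i ω)) η) η :=
  (HasFDerivAt.fun_sum fun i _ => (hf (ξ t i ω) η).hasFDerivAt).const_mul (p.batch t : ℝ)⁻¹

lemma gradient_batchLoss (hf : ∀ x, Differentiable ℝ fun η => f η x) (ξ : ℕ → ℕ → Ω → Ξ)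
    (t : ℕ) (ω : Ω) (η : EuclideanSpace ℝ (Fin d)) :
    gradient (batchLoss p f ξ t ω) η = batchGrad p f ξ t ω η := by
  simp only [gradient, batchGrad, (hasFDerivAt_batchLoss hf ξ t ω η).fderiv, map_smul, map_sum]

lemma measurable_batchGrad [MeasurableSpace Ω] (hf : ∀ x, Differentiable ℝ fun η => f η x)
    {ξ : ℕ → ℕ → Ω → Ξ} {t : ℕ} (hloss : ∀ η, Measurable fun ω => batchLoss p f ξ t ω η)
    {ϑ : Ω → EuclideanSpace ℝ (Fin d)} (hϑ : Measurable ϑ) :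
    Measurable fun ω => batchGrad p f ξ t ω (ϑ ω) := by
  simp only [← gradient_batchLoss hf]
  exact measurable_gradient_comp
    (fun ω η => (hasFDerivAt_batchLoss hf ξ t ω η).differentiableAt) hloss hϑ

end BatchGradient

/-! ### The two recursions as instances of the model -/

section Instances

variable {d : ℕ} {Ω : Type*} {p : Params} {Θ : Set (EuclideanSpace ℝ (Fin d))}
  {g : ℕ → Ω → EuclideanSpace ℝ (Fin d) → EuclideanSpace ℝ (Fin d)}
  {θs : EuclideanSpace ℝ (Fin d)} {θ : ℕ → Ω → EuclideanSpace ℝ (Fin d)}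

lemma IsSSG.isPSSG_univ (h : IsSSG p g θ) : IsPSSG p Set.univ g θ :=
  ⟨fun _ => Set.mem_univ _, fun t ω => h t ω ▸ isProjection_self (Set.mem_univ _)⟩

lemma IsSSG.overshoot_eq_zero (h : IsSSG p g θ) (i : ℕ) (ω : Ω) : overshoot p g θ i ω = 0 :=
  sub_eq_zero.2 (h i ω)

variable [MeasurableSpace Ω] {P : Measure Ω}

namespace BoundedGradients

lemma mem_interior (h : BoundedGradients p P Θ g θs) (hmem : θs ∈ Θ) : θs ∈ interior Θ := by
  by_contra hint
  have hdist := h.le_dist θs ⟨subset_closure hmem, hint⟩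
  rw [sub_self, norm_zero] at hdist
  exact hdist.not_gt h.DTheta_pos

/-- An iterate displaced by the projection lies on the boundary of `Θ`, hence at distance at least
`D_Θ` from the minimizer; this is what makes the overshoot quadratic in the error. -/
lemma norm_overshoot_le (h : BoundedGradients p P Θ g θs) (hp : p.Valid) (hΘ : Convex ℝ Θ)
    (hrec : IsPSSG p Θ g θ) (i : ℕ) : ∀ᵐ ω ∂P,
    ‖overshoot p g θ i ω‖ ≤ p.rate (i + 1) * (|p.G| / p.DTheta ^ 2) * ‖θ (i + 1) ω - θs‖ ^ 2 := by
  have hγ := (hp.rate_pos (Nat.le_add_left 1 i)).le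
  have hD := h.DTheta_pos
  filter_upwards [h.bounded (i + 1) (Nat.le_add_left 1 i)] with ω hω
  have hproj := hrec.2 i ω
  by_cases hne : θ (i + 1) ω = θ i ω - p.rate (i + 1) • g (i + 1) ω (θ i ω)
  · rw [overshoot, hne, sub_self, norm_zero]
    positivity
  have hdist : p.DTheta ≤ ‖θ (i + 1) ω - θs‖ := h.le_dist _ (hproj.mem_frontier hΘ hne)
  have hgrad : ‖g (i + 1) ω (θ i ω)‖ ≤ |p.G| :=
    abs_norm (g (i + 1) ω (θ i ω)) ▸ sq_le_sq.1 (hω (θ i ω) (hrec.mem i ω))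
  calc ‖overshoot p g θ i ω‖ ≤ ‖p.rate (i + 1) • g (i + 1) ω (θ i ω)‖ := by
        have hclosest := hproj.2 (θ i ω) (hrec.mem i ω)
        rwa [norm_sub_rev, sub_sub_cancel_left, norm_neg] at hclosest
    _ ≤ p.rate (i + 1) * (|p.G| / p.DTheta ^ 2 * p.DTheta ^ 2) := by
        rw [norm_smul, Real.norm_of_nonneg hγ, div_mul_cancel₀ _ (by positivity)]
        gcongr
    _ ≤ p.rate (i + 1) * (|p.G| / p.DTheta ^ 2 * ‖θ (i + 1) ω - θs‖ ^ 2) := by gcongr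
    _ = _ := (mul_assoc _ _ _).symm

end BoundedGradients

lemma mem_interior_and_isPSSG_and_norm_overshoot_le (hp : p.Valid) (hΘ : Convex ℝ Θ)
    (hmem : θs ∈ Θ) (h : (Θ = Set.univ ∧ IsSSG p g θ) ∨
      (IsPSSG p Θ g θ ∧ BoundedGradients p P Θ g θs)) :
    θs ∈ interior Θ ∧ IsPSSG p Θ g θ ∧ ∀ i, ∀ᵐ ω ∂P,
      ‖overshoot p g θ i ω‖ ≤
        p.rate (i + 1) * (|p.G| / p.DTheta ^ 2) * ‖θ (i + 1) ω - θs‖ ^ 2 := by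
  rcases h with ⟨rfl, hrec⟩ | ⟨hrec, hbdd⟩
  · refine ⟨by rwa [interior_univ], hrec.isPSSG_univ, fun i => ae_of_all P fun ω => ?_⟩
    have hγ := hp.rate_pos (Nat.le_add_left 1 i)
    rw [hrec.overshoot_eq_zero, norm_zero]
    positivity
  · exact ⟨hbdd.mem_interior hmem, hrec, hbdd.norm_overshoot_le hp hΘ hrec⟩

end Instances

end Streaming

open Streaming in
theorem mainTheorem2_general (p : Params) (hp : p.Valid) (hmu : 0 < p.muNu)
    (hdecay : p.decay ∈ Set.Ioo (1 / 2 : ℝ) 1) :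
    ∃ R R' Ψ : ℕ → ℝ,
      p.IsSoftO R p.orderMain ∧ p.IsSoftO R' p.orderDep ∧ p.IsSoftO Ψ p.orderBias ∧
      ∀ (d : ℕ) (Ω : Type*) [mΩ : MeasurableSpace Ω] (P : Measure Ω) [IsProbabilityMeasure P]
        (𝓕 : Filtration ℕ mΩ) (Θ : Set (EuclideanSpace ℝ (Fin d)))
        (g : ℕ → Ω → EuclideanSpace ℝ (Fin d) → EuclideanSpace ℝ (Fin d))
        (F : EuclideanSpace ℝ (Fin d) → ℝ) (θs : EuclideanSpace ℝ (Fin d))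
        (θ : ℕ → Ω → EuclideanSpace ℝ (Fin d))
        (S : Matrix (Fin d) (Fin d) ℝ) (St : ℕ → Matrix (Fin d) (Fin d) ℝ),
        Model p P 𝓕 Θ g F θs θ → ScoreCovariance p P g θs S St → ∀ t : ℕ, 1 ≤ t →
          MemLp (average p θ t) 2 P ∧
          √(∫ ω, ‖average p θ t ω - θs‖ ^ 2 ∂P) ≤ p.leading (Lam F θs S) t + R t +
            (if p.Dnu ≠ 0 then R' t else 0) + (if p.Bnu ≠ 0 then Ψ t else 0) := by
  have ha0 : 0 < p.decay := one_half_pos.trans hdecay.1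
  obtain ⟨K, hK0, hK⟩ := exists_forall_lpNorm_error_le hp hmu ha0 hdecay.2
  obtain ⟨W, hW0, hW⟩ := hp.exists_sum_weight_sub_mul_errRate_le ha0 hdecay.2
  obtain ⟨C₁, C₂, C₃, hC₁, hC₂, hC₃, hC⟩ := hp.exists_one_add_log_mul_remainder_le ha0 hdecay.2
  have hA0 : 0 ≤ p.mu⁻¹ * p.remainderConst K W :=
    mul_nonneg (inv_nonneg.2 hp.mu_pos.le) (hp.remainderConst_nonneg hK0 hW0)
  refine ⟨_, _, _, Params.isSoftO_mul_log (mul_nonneg hA0 hC₁) p.orderMain_nonneg,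
    Params.isSoftO_mul_log (mul_nonneg hA0 hC₂) p.orderDep_nonneg,
    Params.isSoftO_mul_log (mul_nonneg hA0 hC₃) p.orderBias_nonneg,
    fun d Ω _ P _ 𝓕 Θ g F θs θ S St h hS t ht => ⟨h.memLp_average t, ?_⟩⟩
  have hremainder : p.mu⁻¹ * (lpNorm (linearizationRemainder p P 𝓕 g F θs θ t) 2 P / p.total t) ≤
      p.mu⁻¹ * p.remainderConst K W * ((1 + Real.log t) * p.remainder t) := by
    have hN := hp.total_pos ht
    have hmu := hp.mu_pos
    rw [mul_assoc]
    gcongr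
    rw [div_le_iff₀ hN]
    exact (h.lpNorm_linearizationRemainder_le hp hdecay.1 hK0 (hK h) ht (hW t ht)).trans_eq
      (by rw [Params.remainderSum]; ring)
  refine (h.sqrt_integral_norm_average_sub_sq_le hp ht).trans ((add_le_add
    (h.sqrt_sum_div_total_le_leading hp hS ht)
    (hremainder.trans (mul_le_mul_of_nonneg_left (hC t ht) hA0))).trans_eq ?_)
  split_ifs <;> ring

theorem mainTheorem2 (p : Streaming.Params) (hp : p.Valid) (hmu : 0 < p.muNu)
    (hab : p.alpha - p.rho * p.beta ∈ Set.Ioo (1 / 2 : ℝ) 1) :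
    -- the remainders depend only on the constants in `p`
    ∃ R R' Ψ : ℕ → ℝ,
      p.IsSoftO R (fun t => max
        ((p.total t : ℝ) ^
          (-((2 + p.rho * (2 * p.sigma + p.beta) - p.alpha) / (2 * (1 + p.rho)))))
        ((p.total t : ℝ) ^
          (-((p.rho * (2 * p.sigma - p.beta) + p.alpha) / (1 + p.rho))))) ∧
      p.IsSoftO R' (fun t =>
        (p.total t : ℝ) ^ (-((p.delta + p.rho * p.nu) / (2 * (1 + p.rho))))) ∧
      p.IsSoftO Ψ (fun t =>
        max ((p.total t : ℝ) ^ (-(p.rho * (p.sigma + p.nu) / (2 * (1 + p.rho)))))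
        (max ((p.total t : ℝ) ^
          (-((1 + p.rho * (p.beta + p.nu) - p.alpha) / (1 + p.rho))))
        (max ((p.total t : ℝ) ^ (-((1 + 2 * p.rho * p.nu) / (2 * (1 + p.rho)))))
        (max ((p.total t : ℝ) ^ (-((p.delta / 2 + p.rho * p.nu) / (2 * (1 + p.rho)))))
          ((p.total t : ℝ) ^ (-(2 * p.rho * p.nu / (1 + p.rho)))))))) ∧
      ∀ (d : ℕ) (Ξ : Type*) [MeasurableSpace Ξ] (π : MeasureTheory.Measure Ξ)
        [MeasureTheory.IsProbabilityMeasure π]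
        (Ω : Type*) [mΩ : MeasurableSpace Ω] (P : MeasureTheory.Measure Ω)
        [MeasureTheory.IsProbabilityMeasure P]
        (𝓕 : MeasureTheory.Filtration ℕ mΩ)
        -- the loss, the data, the constraint set, the minimizer, the iterates
        (f : EuclideanSpace ℝ (Fin d) → Ξ → ℝ) (ξ : ℕ → ℕ → Ω → Ξ)
        (Θ : Set (EuclideanSpace ℝ (Fin d))) (θs : EuclideanSpace ℝ (Fin d))
        (θ : ℕ → Ω → EuclideanSpace ℝ (Fin d))
        (S : Matrix (Fin d) (Fin d) ℝ) (St : ℕ → Matrix (Fin d) (Fin d) ℝ),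
        (∀ x, Differentiable ℝ (fun η => f η x)) →
        (∀ η, MeasureTheory.Integrable (f η) π) →
        -- the mini-batch losses are adapted
        (∀ t : ℕ, 1 ≤ t → ∀ η, Measurable[𝓕 t] (fun ω => Streaming.batchLoss p f ξ t ω η)) →
        IsClosed Θ → Convex ℝ Θ → θs ∈ Θ →
        -- unique global minimizer
        (∀ η, η ≠ θs → Streaming.objective f π θs < Streaming.objective f π η) →
        Streaming.QuasiStronglyConvex p Θ (Streaming.objective f π) θs →
        Streaming.Smooth p Θ (Streaming.objective f π) θs →
        Streaming.DependenceBias p 4 P 𝓕 Θ (Streaming.batchGrad p f ξ)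
          (Streaming.objective f π) θs →
        Streaming.ExpectedSmooth p 4 P 𝓕 Θ (Streaming.batchGrad p f ξ) θs →
        Streaming.GradientNoise p 4 P (Streaming.batchGrad p f ξ) θs →
        Streaming.ScoreCovariance p P (Streaming.batchGrad p f ξ) θs S St →
        -- the initial point
        Measurable[𝓕 0] (θ 0) → MeasureTheory.MemLp (θ 0) 4 P →
        (∫ ω, ‖θ 0 ω - θs‖ ^ 4 ∂P) ≤ p.Delta0 →
        -- either no projection, or projection and bounded gradients
        ((Θ = Set.univ ∧ Streaming.IsSSG p (Streaming.batchGrad p f ξ) θ) ∨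
          (Streaming.IsPSSG p Θ (Streaming.batchGrad p f ξ) θ ∧
            Streaming.BoundedGradients p P Θ (Streaming.batchGrad p f ξ) θs)) →
        ∀ t : ℕ, 1 ≤ t →
          MeasureTheory.MemLp (Streaming.average p θ t) 2 P ∧
          Real.sqrt (∫ ω, ‖Streaming.average p θ t ω - θs‖ ^ 2 ∂P) ≤
            (if p.sigma = 1 / 2 then
              Real.sqrt (Streaming.Lam (Streaming.objective f π) θs S) /
                Real.sqrt (p.total t : ℝ) else 0)
            + (if p.sigma < 1 / 2 then
              Real.sqrt 2 * Real.sqrt (Streaming.Lam (Streaming.objective f π) θs S)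
                * (p.Crho : ℝ) ^ ((1 - 2 * p.sigma) / (2 * (1 + p.rho)))
                / (p.total t : ℝ) ^ ((1 + 2 * p.rho * p.sigma) / (2 * (1 + p.rho))) else 0)
            + Real.sqrt 2 * Real.sqrt p.Csigma'
                * (p.Crho : ℝ) ^ ((1 - 2 * (p.sigma + p.sigma')) / (2 * (1 + p.rho)))
                / (p.mu * (p.total t : ℝ) ^
                  ((1 + 2 * p.rho * (p.sigma + p.sigma')) / (2 * (1 + p.rho))))
            + R t
            + (if p.Dnu ≠ 0 then R' t else 0)
            + (if p.Bnu ≠ 0 then Ψ t else 0) := by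
  obtain ⟨R, R', Ψ, hR, hR', hΨ, hbound⟩ := mainTheorem2_general p hp hmu hab
  refine ⟨R, R', Ψ, hR, hR', hΨ, fun d Ξ _ π _ Ω _ P _ 𝓕 f ξ Θ θs θ S St hf _ hadapt hclosed hconv
    hmem hmin hquasi hsmooth hdep hexp hnoise hcov hinit hinit4 hinit_le hrec => ?_⟩
  have hisMin : ∀ η, Streaming.objective f π θs ≤ Streaming.objective f π η := fun η =>
    (eq_or_ne η θs).elim (fun h => h ▸ le_rfl) fun h => (hmin η h).le
  obtain ⟨hint, hpssg, hover⟩ :=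
    Streaming.mem_interior_and_isPSSG_and_norm_overshoot_le hp hconv hmem hrec
  have hmeas : ∀ t : ℕ, 1 ≤ t → ∀ ϑ : Ω → EuclideanSpace ℝ (Fin d), Measurable[𝓕 t] ϑ →
      Measurable[𝓕 t] fun ω => Streaming.batchGrad p f ξ t ω (ϑ ω) := fun t ht ϑ hϑ =>
    @Streaming.measurable_batchGrad _ _ _ _ _ (𝓕 t) hf _ t (hadapt t ht) ϑ hϑ
  exact hbound d Ω P 𝓕 Θ _ _ θs θ S St ⟨hclosed, hconv, hint, hisMin, hquasi, hsmooth, hdep, hexp,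
    hnoise, hmeas, hinit, hinit4, hinit_le, hpssg, hover⟩ hcov
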